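/- Let $0<\tau\le 1/2$, $\psi:=2\arccos(1-\tau)$, and let $n\ge 3$ robots $r_1,\dots,r_n$ in the Euclidean plane have positions $p_1(t),\dots,p_n(t)$, $t\ge 0$. Write $w_i:=p_i-p_{i-1}$, $\widehat w_i:=w_i/\|w_i\|$, and let $\alpha_i\in[0,\pi]$ be the angle at $p_i$ between the directions to $p_{i-1}$ and $p_{i+1}$. Suppose that the initial chain is connected, i.e. $\|w_i(0)\|\le 1$ for $2\le i\le n$, and that the robots follow the continuous-time strategy Max-MOB with outer-robot speed $1-\tau$: * All robots have speed at most $1$. The rules below hold at almost every time. * Outer robots: if $\|w_2\|<1$, then $r_1$ has velocity $-(1-\tau)\widehat w_2$. If $\|w_2\|=1$, then $r_1$ moves in direction $-\widehat w_2$ with the speed from $[0,1-\tau]$ closest to the one that keeps $\|w_2\|$ constant. (If $w_2=0$, only the bound $1-\tau$ on its speed is imposed.) Symmetrically for $r_n$. * An inner robot $r_i$ that differs in position from both neighbours and has $\alpha_i<\pi$ moves with speed $1$ along the bisector of $\alpha_i$ if $\alpha_i<\psi$ or $\|w_i\|=1$ or $\|w_{i+1}\|=1$, and does not move otherwise. At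 the switching points of this rule ($\alpha_i=\psi$, or $\alpha_i\ge\psi$ and an adjacent vector of length one), any speed in $[0,1]$ along the bisector is allowed, except that the speed is $1$ if $r_1,\dots,r_i$ or $r_i,\dots,r_n$ form a straight chain of unit vectors. A maximal block of coinciding consecutive inner robots, preceded and followed by robots at other positions to which the directions form an angle less than $\pi$, moves like a single such robot. * An inner robot on the segment between its neighbours (possibly at the position of a neighbour) stays on that segment from then on. Unless it belongs to a block as above, it moves with speed $1$ towards the midpoint of its neighbours as long as it is not there. Once it is at the midpoint, it stays at the midpoint. Then there is a time $t$ with $$0\le t\le 2(n-3)\left(\frac1{1-\tau}+\frac1{\sqrt{2-\sqrt2}}+10\right)+3n\left(\frac1\tau+\frac1{1-\tau}\right)$$ (so $t=O(n)$ for fixed $\tau$) at which the chain is a straight chain of length $n-1$, i.e. $\|w_i\|=1$ for $2\le i\le n$ and $w_2=\dots=w_n$, and all robots remain at rest from then on, or at which all robots are at the same position. -/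

import Mathlib

open MeasureTheory Set
open scoped RealInnerProductSpace EuclideanGeometry

noncomputable section

/-- The Euclidean plane. -/
abbrev Plane : Type := EuclideanSpace ℝ (Fin 2)

namespace MaxMob

/-- Unit vector pointing from `x` to `y` (zero if `x = y`). -/
def dir (x y : Plane) : Plane := ‖y - x‖⁻¹ • (y - x)

/-- Unit vector at `x` along the bisector of the angle formed by the directions to `a` and `b`. -/
def bisector (x a b : Plane) : Plane := ‖dir x a + dir x b‖⁻¹ • (dir x a + dir x b)

/-- The critical angle `ψ = 2 arccos (1 - τ)`. -/
def psi (τ : ℝ) : ℝ := 2 * Real.arccos (1 - τ)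

/-- A configuration of the robots `1, …, n` (only these indices are relevant) is connected if
neighbours have distance at most one. -/
def IsConnectedChain (n : ℕ) (q : ℕ → Plane) : Prop :=
  ∀ i, 1 ≤ i → i < n → dist (q i) (q (i + 1)) ≤ 1

/-- The straight chain of length `n - 1`: all chain vectors are equal and have length one. -/
def IsMaxChain (n : ℕ) (q : ℕ → Plane) : Prop :=
  (∀ i, 1 ≤ i → i < n → dist (q i) (q (i + 1)) = 1) ∧
  (∀ i, 1 < i → i < n → q (i + 1) - q i = q i - q (i - 1))

/-- All robots are at the same position. -/
def IsCollapsed (n : ℕ) (q : ℕ → Plane) : Prop :=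
  ∀ i, 1 ≤ i → i ≤ n → q i = q 1

/-- The inner robot `i` is collinear with and between its neighbours; coinciding with a neighbour
is allowed. -/
def IsStraightAt (q : ℕ → Plane) (i : ℕ) : Prop :=
  Wbtw ℝ (q (i - 1)) (q i) (q (i + 1))

/-- The inner robot `i` is at the midpoint between its neighbours. -/
def IsMidAt (q : ℕ → Plane) (i : ℕ) : Prop :=
  q i = midpoint ℝ (q (i - 1)) (q (i + 1))

/-- The inner robots `j, …, k` form a maximal block of coinciding consecutive robots, and the chain
has an angle smaller than `π` there. A single robot that differs in position from both of its
neighbours is the case `j = k`, and then the angle is the robot's angle `α_j`. -/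
def IsBend (n : ℕ) (q : ℕ → Plane) (j k : ℕ) : Prop :=
  1 < j ∧ j ≤ k ∧ k < n ∧ (∀ m, j ≤ m → m ≤ k → q m = q j) ∧
  q (j - 1) ≠ q j ∧ q (k + 1) ≠ q j ∧ ∠ (q (j - 1)) (q j) (q (k + 1)) < Real.pi

/-- The robots `1, …, j` lie on a line in this order, with consecutive distances equal to one. -/
def IsFullLeft (q : ℕ → Plane) (j : ℕ) : Prop :=
  ∀ m, 1 ≤ m → m < j → dist (q m) (q (m + 1)) = 1 ∧ (1 < m → IsStraightAt q m)

/-- The robots `k, …, n` lie on a line in this order, with consecutive distances equal to one. -/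
def IsFullRight (n : ℕ) (q : ℕ → Plane) (k : ℕ) : Prop :=
  ∀ m, k ≤ m → m < n → dist (q m) (q (m + 1)) = 1 ∧ (k < m → IsStraightAt q m)

/-- Velocity `vx` of an outer robot at `x` whose neighbour is at `y` and has velocity `vy`.
At distance less than one it moves away with speed `1 - τ`. Otherwise it moves away with the speed
from `[0, 1 - τ]` that is closest to the one keeping the distance constant. If it coincides with its
neighbour there is no direction to move away, and only the speed bound is imposed. -/
def OuterRule (τ : ℝ) (x y vx vy : Plane) : Prop :=
  (x = y → ‖vx‖ ≤ 1 - τ) ∧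
  (x ≠ y → dist x y < 1 → vx = (1 - τ) • dir y x) ∧
  (x ≠ y → 1 ≤ dist x y → vx = max 0 (min (1 - τ) ⟪vy, dir y x⟫) • dir y x)

/-- Velocities at a bend: movement along the bisector. The speed `s` is one if the angle is below `ψ`,
and zero if it is above `ψ` and no adjacent chain vector has length one. The rule switches where the
angle equals `ψ` or an adjacent chain vector has length one; there every speed in `[0, 1]` is allowed,
except that the speed is one if a vector of length one is the end of a completely stretched straight
part of the chain that starts at an outer robot (only then is the length one kept while moving). -/
def BendRule (τ : ℝ) (n : ℕ) (q v : ℕ → Plane) (j k : ℕ) : Prop :=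
  ∃ s : ℝ, 0 ≤ s ∧ s ≤ 1 ∧
    (∀ i, j ≤ i → i ≤ k → v i = s • bisector (q j) (q (j - 1)) (q (k + 1))) ∧
    (∠ (q (j - 1)) (q j) (q (k + 1)) < psi τ ∨ IsFullLeft q j ∨ IsFullRight n q k → s = 1) ∧
    (psi τ < ∠ (q (j - 1)) (q j) (q (k + 1)) →
      dist (q (j - 1)) (q j) ≠ 1 → dist (q j) (q (k + 1)) ≠ 1 → s = 0)

/-- Velocity of a straight inner robot `i` that is not yet at the midpoint between its neighbours:
speed one, directed towards the midpoint. (That it stays on the segment between its neighbours is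
part of `IsExecution`.) -/
def StraightRule (q v : ℕ → Plane) (i : ℕ) : Prop :=
  ‖v i‖ = 1 ∧ 0 ≤ ⟪v i, midpoint ℝ (q (i - 1)) (q (i + 1)) - q i⟫

/-- The positions `q` and velocities `v` of the robots `1, …, n` obey the strategy. -/
def Obeys (τ : ℝ) (n : ℕ) (q v : ℕ → Plane) : Prop :=
  OuterRule τ (q 1) (q 2) (v 1) (v 2) ∧
  OuterRule τ (q n) (q (n - 1)) (v n) (v (n - 1)) ∧
  (∀ j k, IsBend n q j k → BendRule τ n q v j k) ∧
  (∀ i, 1 < i → i < n → (¬ ∃ j k, j ≤ i ∧ i ≤ k ∧ IsBend n q j k) →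
    ¬ IsMidAt q i → StraightRule q v i)

/-- `p i t` is the position of robot `i` at time `t ≥ 0` in an execution of the strategy by `n`
robots: all speeds are at most one, a robot that is between its neighbours (at their midpoint) stays
there, and at almost every time the velocities exist and obey the strategy. -/
structure IsExecution (τ : ℝ) (n : ℕ) (p : ℕ → ℝ → Plane) : Prop where
  lipschitz : ∀ i, 1 ≤ i → i ≤ n → LipschitzOnWith 1 (p i) (Ici 0)
  straight : ∀ i, 1 < i → i < n → ∀ s t : ℝ, 0 ≤ s → s ≤ t →
    IsStraightAt (fun m => p m s) i → IsStraightAt (fun m => p m t) i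
  mid : ∀ i, 1 < i → i < n → ∀ s t : ℝ, 0 ≤ s → s ≤ t →
    IsMidAt (fun m => p m s) i → IsMidAt (fun m => p m t) i
  velocity : ∀ᵐ t ∂(volume.restrict (Ioi (0 : ℝ))), ∃ v : ℕ → Plane,
    (∀ i, 1 ≤ i → i ≤ n → HasDerivAt (p i) (v i) t) ∧ Obeys τ n (fun m => p m t) v

end MaxMob

end

/-! Positions are Lipschitz in time, so a derivative bound valid at almost every time integrates
(`LipOn.le_add_mul`), and a differentiable function has derivative zero at almost every time of a
level set (`ae_hasDerivAt_eq_zero`). Applied to unit distances, coincidences and collinear triples,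
the latter makes almost every time regular (`Reg`): unit vectors keep their length, coinciding
robots share their velocity and collinear triples stay collinear, all to first order. A maximum
principle for the longest chain vectors keeps the chain connected. At regular times the rules
determine the velocities needed: a run of unit vectors passes the velocity component along its
direction from robot to robot, which tells when an outer robot is slowed down and when a bend next
to a unit vector can move.

The chain is cut into parts in line. Such a part stays in line from any regular time on
(`IsExecution.forever_of_reg`), so bends only disappear. Let `1, …, h` and `h, …, y` be in line.
Until `1, …, y` or `h, …, y + 1` comes in line, the potential `2 * deviation + reserve` falls at
unit rate: either the first robot runs at speed `1 - τ`, or the first part is completely stretched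
and its bend moves at full speed. A merger does not raise the potential, so all mergers together
take linear time (`IsExecution.exists_single`).

The argument has one exception: both ends of the chain are completely stretched and the two bends
are almost straight, with half-angle cosines summing to less than `1 / 2`. Then this sum decreases
at rate at least `1 / (2 * n)`, so one of the two bends vanishes within time `n`
(`IsExecution.two_bends_straighten`). Either way at most one bend is left.

A single bend with a small angle moves at full speed; the total length plus `(n - 1) * halfCos`
falls at rate `2 * τ` until the cosine is at most `1 - τ`. From then on whatever the bend does not
spend on straightening goes into the growth of the length, which is bounded, so the chain comes in
line (`IsExecution.straighten_single_bend`). In line, both ends move apart with speed `1 - τ` until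
the chain is fully stretched, unless all robots coincide (`IsExecution.finish`). -/

namespace MaxMob

open Filter Topology

/-! ### Lipschitz curves and derivatives almost everywhere. -/

section Analysis

set_option linter.unusedSectionVars false

variable {E : Type*} [NormedAddCommGroup E] [InnerProductSpace ℝ E]

/-- `f` is Lipschitz continuous on `[a, b]`. -/
def LipOn (a b : ℝ) (f : ℝ → E) : Prop :=
  ∃ K : ℝ, ∀ x ∈ Icc a b, ∀ y ∈ Icc a b, ‖f x - f y‖ ≤ K * |x - y|

theorem LipOn.exists_nonneg {a b : ℝ} {f : ℝ → E} (hf : LipOn a b f) :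
    ∃ K : ℝ, 0 ≤ K ∧ ∀ x ∈ Icc a b, ∀ y ∈ Icc a b, ‖f x - f y‖ ≤ K * |x - y| := by
  obtain ⟨K, hK⟩ := hf
  refine ⟨|K|, abs_nonneg K, fun x hx y hy => (hK x hx y hy).trans ?_⟩
  exact mul_le_mul_of_nonneg_right (le_abs_self K) (abs_nonneg _)

theorem LipOn.lipschitzOnWith {a b : ℝ} {f : ℝ → E} (hf : LipOn a b f) :
    ∃ K : NNReal, LipschitzOnWith K f (Icc a b) := by
  obtain ⟨K, hK0, hK⟩ := hf.exists_nonneg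
  refine ⟨⟨K, hK0⟩, LipschitzOnWith.of_dist_le_mul fun x hx y hy => ?_⟩
  rw [dist_eq_norm, Real.dist_eq]
  exact hK x hx y hy

theorem LipOn.continuousOn {a b : ℝ} {f : ℝ → E} (hf : LipOn a b f) : ContinuousOn f (Icc a b) := by
  obtain ⟨K, hK⟩ := hf.lipschitzOnWith
  exact hK.continuousOn

theorem LipOn.mono {a b a' b' : ℝ} {f : ℝ → E} (hf : LipOn a b f) (ha : a ≤ a') (hb : b' ≤ b) :
    LipOn a' b' f := by
  obtain ⟨K, hK⟩ := hf
  exact ⟨K, fun x hx y hy => hK x ⟨ha.trans hx.1, hx.2.trans hb⟩ y ⟨ha.trans hy.1, hy.2.trans hb⟩⟩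

theorem LipOn.bound {a b : ℝ} {f : ℝ → E} (hf : LipOn a b f) :
    ∃ C : ℝ, 0 ≤ C ∧ ∀ x ∈ Icc a b, ‖f x‖ ≤ C := by
  obtain ⟨C, hC⟩ := isCompact_Icc.exists_bound_of_continuousOn hf.continuousOn
  exact ⟨|C|, abs_nonneg C, fun x hx => (hC x hx).trans (le_abs_self C)⟩

theorem LipOn.const {a b : ℝ} (c : E) : LipOn a b (fun _ => c) :=
  ⟨0, fun x _ y _ => by simp⟩

theorem LipOn.add {a b : ℝ} {f g : ℝ → E} (hf : LipOn a b f) (hg : LipOn a b g) :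
    LipOn a b (fun t => f t + g t) := by
  obtain ⟨K, hK⟩ := hf
  obtain ⟨L, hL⟩ := hg
  refine ⟨K + L, fun x hx y hy => ?_⟩
  calc ‖f x + g x - (f y + g y)‖ = ‖(f x - f y) + (g x - g y)‖ := by congr 1; abel
    _ ≤ ‖f x - f y‖ + ‖g x - g y‖ := norm_add_le _ _
    _ ≤ K * |x - y| + L * |x - y| := add_le_add (hK x hx y hy) (hL x hx y hy)
    _ = (K + L) * |x - y| := by ring

theorem LipOn.smul {a b : ℝ} {f : ℝ → ℝ} {g : ℝ → E} (hf : LipOn a b f) (hg : LipOn a b g) :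
    LipOn a b (fun t => f t • g t) := by
  obtain ⟨A, hA0, hA⟩ := hf.bound
  obtain ⟨B, hB0, hB⟩ := hg.bound
  obtain ⟨K, hK0, hK⟩ := hf.exists_nonneg
  obtain ⟨L, hL0, hL⟩ := hg.exists_nonneg
  refine ⟨A * L + K * B, fun x hx y hy => ?_⟩
  calc ‖f x • g x - f y • g y‖ = ‖f x • (g x - g y) + (f x - f y) • g y‖ := by
        congr 1; rw [smul_sub, sub_smul]; abel
    _ ≤ ‖f x • (g x - g y)‖ + ‖(f x - f y) • g y‖ := norm_add_le _ _
    _ = ‖f x‖ * ‖g x - g y‖ + ‖f x - f y‖ * ‖g y‖ := by rw [norm_smul, norm_smul]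
    _ ≤ A * (L * |x - y|) + (K * |x - y|) * B := by
        gcongr
        · exact hA x hx
        · exact hL x hx y hy
        · exact hK x hx y hy
        · exact hB y hy
    _ = (A * L + K * B) * |x - y| := by ring

theorem LipOn.neg {a b : ℝ} {f : ℝ → E} (hf : LipOn a b f) : LipOn a b (fun t => - f t) := by
  obtain ⟨K, hK⟩ := hf
  refine ⟨K, fun x hx y hy => ?_⟩
  rw [← neg_sub', norm_neg]
  exact hK x hx y hy

theorem LipOn.sub {a b : ℝ} {f g : ℝ → E} (hf : LipOn a b f) (hg : LipOn a b g) :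
    LipOn a b (fun t => f t - g t) := by
  simpa only [sub_eq_add_neg] using hf.add hg.neg

theorem LipOn.mul {a b : ℝ} {f g : ℝ → ℝ} (hf : LipOn a b f) (hg : LipOn a b g) :
    LipOn a b (fun t => f t * g t) := hf.smul hg

theorem LipOn.const_mul {a b : ℝ} {f : ℝ → ℝ} (c : ℝ) (hf : LipOn a b f) :
    LipOn a b (fun t => c * f t) := (LipOn.const c).mul hf

theorem LipOn.id {a b : ℝ} : LipOn a b (fun t : ℝ => t) := ⟨1, fun x _ y _ => by simp⟩

theorem LipOn.norm {a b : ℝ} {f : ℝ → E} (hf : LipOn a b f) : LipOn a b (fun t => ‖f t‖) := by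
  obtain ⟨K, hK⟩ := hf
  exact ⟨K, fun x hx y hy => (abs_norm_sub_norm_le _ _).trans (hK x hx y hy)⟩

theorem LipOn.sup {a b : ℝ} {f g : ℝ → ℝ} (hf : LipOn a b f) (hg : LipOn a b g) :
    LipOn a b (fun t => max (f t) (g t)) := by
  obtain ⟨K, hK0, hK⟩ := hf.exists_nonneg
  obtain ⟨L, hL0, hL⟩ := hg.exists_nonneg
  refine ⟨max K L, fun x hx y hy => (abs_max_sub_max_le_max _ _ _ _).trans (max_le ?_ ?_)⟩
  · exact (hK x hx y hy).trans (mul_le_mul_of_nonneg_right (le_max_left _ _) (abs_nonneg _))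
  · exact (hL x hx y hy).trans (mul_le_mul_of_nonneg_right (le_max_right _ _) (abs_nonneg _))

theorem LipOn.inv {a b : ℝ} {f : ℝ → ℝ} (hf : LipOn a b f) (h0 : ∀ t ∈ Icc a b, 0 < f t) :
    LipOn a b (fun t => (f t)⁻¹) := by
  rcases (Icc a b).eq_empty_or_nonempty with he | hne
  · exact ⟨0, fun x hx => by simp [he] at hx⟩
  -- By compactness `f` has a positive lower bound `m`, which gives the constant `K / m ^ 2`.
  obtain ⟨t0, ht0, hmin⟩ := isCompact_Icc.exists_isMinOn hne hf.continuousOn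
  obtain ⟨K, hK0, hK⟩ := hf.exists_nonneg
  set m := f t0 with hm
  have hm0 : 0 < m := h0 t0 ht0
  refine ⟨K / (m * m), fun x hx y hy => ?_⟩
  have hx0 := h0 x hx
  have hy0 := h0 y hy
  have hmx : m ≤ f x := hmin hx
  have hmy : m ≤ f y := hmin hy
  have : (f x)⁻¹ - (f y)⁻¹ = -(f x - f y) / (f x * f y) := by field_simp; ring
  rw [this, norm_div, norm_neg, Real.norm_of_nonneg (mul_pos hx0 hy0).le, div_mul_eq_mul_div]
  exact div_le_div₀ (mul_nonneg hK0 (abs_nonneg _)) (hK x hx y hy) (mul_pos hm0 hm0)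
    (mul_le_mul hmx hmy hm0.le hx0.le)

theorem LipOn.inner {a b : ℝ} {f g : ℝ → E} (hf : LipOn a b f) (hg : LipOn a b g) :
    LipOn a b (fun t => ⟪f t, g t⟫) := by
  obtain ⟨A, hA0, hA⟩ := hf.bound
  obtain ⟨B, hB0, hB⟩ := hg.bound
  obtain ⟨K, hK0, hK⟩ := hf.exists_nonneg
  obtain ⟨L, hL0, hL⟩ := hg.exists_nonneg
  refine ⟨A * L + K * B, fun x hx y hy => ?_⟩
  calc ‖⟪f x, g x⟫ - ⟪f y, g y⟫‖ = ‖⟪f x, g x - g y⟫ + ⟪f x - f y, g y⟫‖ := by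
        congr 1; rw [inner_sub_right, inner_sub_left]; ring
    _ ≤ ‖⟪f x, g x - g y⟫‖ + ‖⟪f x - f y, g y⟫‖ := norm_add_le _ _
    _ ≤ ‖f x‖ * ‖g x - g y‖ + ‖f x - f y‖ * ‖g y‖ :=
        add_le_add (norm_inner_le_norm _ _) (norm_inner_le_norm _ _)
    _ ≤ A * (L * |x - y|) + (K * |x - y|) * B := by
        gcongr
        · exact hA x hx
        · exact hL x hx y hy
        · exact hK x hx y hy
        · exact hB y hy
    _ = (A * L + K * B) * |x - y| := by ring

/-- A Lipschitz function whose derivative is almost everywhere at most `m` grows at most with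
slope `m`. -/
theorem LipOn.le_add_mul {a b m : ℝ} {f : ℝ → ℝ} (hf : LipOn a b f) (hab : a ≤ b)
    (hd : ∀ᵐ t : ℝ, t ∈ Ioo a b → ∃ d ≤ m, HasDerivAt f d t) : f b ≤ f a + m * (b - a) := by
  obtain ⟨K, hK⟩ := hf.lipschitzOnWith
  -- A Lipschitz function is absolutely continuous, so it is the integral of its derivative.
  have hac : AbsolutelyContinuousOnInterval f a b := by
    rw [← uIcc_of_le hab] at hK
    exact hK.absolutelyContinuousOnInterval
  have h1 := hac.integral_deriv_eq_sub
  have h2 : ∫ t in a..b, deriv f t ≤ ∫ _ in a..b, m := by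
    apply intervalIntegral.integral_mono_ae_restrict hab hac.intervalIntegrable_deriv
      intervalIntegrable_const
    rw [EventuallyLE, ← restrict_Ioo_eq_restrict_Icc, ae_restrict_iff' measurableSet_Ioo]
    filter_upwards [hd] with t ht hmem
    obtain ⟨d, hdm, hder⟩ := ht hmem
    rw [hder.deriv]
    exact hdm
  simp only [intervalIntegral.integral_const, smul_eq_mul] at h2
  linarith

/-- Almost everywhere on a level set, the derivative vanishes. -/
theorem ae_hasDerivAt_eq_zero (f : ℝ → E) :
    ∀ᵐ t : ℝ, f t = 0 → ∀ d, HasDerivAt f d t → d = 0 := by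
  set S : Set ℝ := {t | f t = 0 ∧ ∃ d, d ≠ 0 ∧ HasDerivAt f d t} with hS
  -- A zero with nonzero derivative is an isolated zero, and a set of isolated points on the line is
  -- countable.
  have hiso : S ⊆ {x ∈ S | 𝓝[S ∩ Ioi x] x = ⊥} := by
    rintro t ht
    refine ⟨ht, ?_⟩
    obtain ⟨h0, d, hd0, hd⟩ := ht
    have h1 : ∀ᶠ z in 𝓝[≠] t, f z ≠ 0 := hd.eventually_ne hd0
    rw [← empty_mem_iff_bot]
    have h2 : ∀ᶠ z in 𝓝[S ∩ Ioi t] t, f z ≠ 0 :=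
      h1.filter_mono (nhdsWithin_mono _ fun z hz => ne_of_gt hz.2)
    filter_upwards [h2, self_mem_nhdsWithin] with z hz hzS
    exact hz hzS.1.1
  have hc : S.Countable := countable_setOfPred_isolated_right_within.mono hiso
  have hnull := hc.ae_notMem volume
  filter_upwards [hnull] with t ht h0 d hd
  by_contra hne
  exact ht ⟨h0, d, hne, hd⟩

/-- Induction along the half-line. -/
theorem real_induction {a : ℝ} {P : ℝ → Prop} (h0 : P a)
    (hleft : ∀ s, a < s → (∀ r, a ≤ r → r < s → P r) → P s)
    (hright : ∀ s, a ≤ s → (∀ r, a ≤ r → r ≤ s → P r) → ∃ ε > 0, ∀ r, s < r → r < s + ε → P r)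
    (t : ℝ) (ht : a ≤ t) : P t := by
  by_contra hP
  set B : Set ℝ := {s | a ≤ s ∧ ¬ P s} with hB
  have hBne : B.Nonempty := ⟨t, ht, hP⟩
  have hBb : BddBelow B := ⟨a, fun s hs => hs.1⟩
  set s := sInf B with hs
  have has : a ≤ s := le_csInf hBne fun r hr => hr.1
  have hlt : ∀ r, a ≤ r → r < s → P r := fun r har hrs => by
    by_contra hr
    exact absurd (csInf_le hBb (show r ∈ B from ⟨har, hr⟩)) (not_le.2 hrs)
  have hPs : P s := by
    rcases has.eq_or_lt with h | h
    · rw [← h]; exact h0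
    · exact hleft s h hlt
  obtain ⟨ε, hε, hr⟩ := hright s has fun r har hrs => by
    rcases hrs.eq_or_lt with h | h
    · rw [h]; exact hPs
    · exact hlt r har h
  obtain ⟨r, hrB, hrs⟩ := exists_lt_of_csInf_lt hBne (show sInf B < s + ε by linarith)
  have hsr : s ≤ r := csInf_le hBb hrB
  rcases hsr.eq_or_lt with h | h
  · exact hrB.2 (h ▸ hPs)
  · exact hrB.2 (hr r h hrs)

/-- Derivative of the norm of a curve. -/
theorem hasDerivAt_norm {f : ℝ → E} {d : E} {t : ℝ} (hf : HasDerivAt f d t) (h : f t = 0 → d = 0) :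
    HasDerivAt (fun s => ‖f s‖) (‖f t‖⁻¹ * ⟪f t, d⟫) t := by
  -- At a zero of the curve the norm is differentiable because the curve moves by `o(s - t)`; the
  -- formula then reads zero.
  by_cases h0 : f t = 0
  · have hd := h h0
    subst hd
    rw [h0, inner_zero_left, mul_zero]
    rw [hasDerivAt_iff_isLittleO] at hf ⊢
    simp only [h0, sub_zero, smul_zero, norm_zero] at hf ⊢
    exact hf.norm_left
  · have h1 := (hf.norm_sq).sqrt (by positivity)
    have h2 : (fun s => √(‖f s‖ ^ 2)) = fun s => ‖f s‖ := by
      funext s; exact Real.sqrt_sq (norm_nonneg _)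
    rw [h2] at h1
    convert h1 using 1
    rw [Real.sqrt_sq (norm_nonneg _)]
    have : ‖f t‖ ≠ 0 := norm_ne_zero_iff.2 h0
    field_simp

end Analysis

end MaxMob

/-! ### Geometry of a single configuration. -/

noncomputable section

namespace MaxMob

/-! ### Directions -/

theorem norm_dir {x y : Plane} (h : x ≠ y) : ‖dir x y‖ = 1 := by
  have : ‖y - x‖ ≠ 0 := norm_ne_zero_iff.2 (sub_ne_zero.2 h.symm)
  rw [dir, norm_smul, norm_inv, norm_norm, inv_mul_cancel₀ this]

theorem dist_smul_dir (x y : Plane) : dist x y • dir x y = y - x := by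
  rcases eq_or_ne x y with rfl | h
  · simp
  · have : ‖y - x‖ ≠ 0 := norm_ne_zero_iff.2 (sub_ne_zero.2 h.symm)
    rw [dir, dist_eq_norm', smul_smul, mul_inv_cancel₀ this, one_smul]

theorem dir_swap (x y : Plane) : dir y x = - dir x y := by
  rw [dir, dir, ← neg_sub y x, norm_neg, smul_neg]

theorem dir_eq_of_sub_eq {x y e : Plane} {r : ℝ} (hr : 0 < r) (he : ‖e‖ = 1) (h : y - x = r • e) :
    dir x y = e := by
  rw [dir, h, norm_smul, he, Real.norm_of_nonneg hr.le, mul_one, smul_smul,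
    inv_mul_cancel₀ hr.ne', one_smul]

theorem dist_eq_of_sub_eq {x y e : Plane} {r : ℝ} (hr : 0 ≤ r) (he : ‖e‖ = 1) (h : y - x = r • e) :
    dist x y = r := by
  rw [dist_eq_norm', h, norm_smul, he, Real.norm_of_nonneg hr, mul_one]

/-! ### Chains in line -/

/-- Length of the chain `x, …, y`. -/
def chainLen (q : ℕ → Plane) (x y : ℕ) : ℝ := ∑ i ∈ Finset.Ico x y, dist (q i) (q (i + 1))

/-- The robots `x, …, y` lie on a segment in this order. -/
def Inline (q : ℕ → Plane) (x y : ℕ) : Prop := chainLen q x y ≤ dist (q x) (q y)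

variable {q : ℕ → Plane} {x y a b : ℕ}

theorem chainLen_nonneg : 0 ≤ chainLen q x y := Finset.sum_nonneg fun _ _ => dist_nonneg

theorem chainLen_add {a b c : ℕ} (hab : a ≤ b) (hbc : b ≤ c) :
    chainLen q a b + chainLen q b c = chainLen q a c :=
  Finset.sum_Ico_consecutive _ hab hbc

theorem chainLen_succ (x : ℕ) : chainLen q x (x + 1) = dist (q x) (q (x + 1)) := by
  simp [chainLen]

theorem dist_le_chainLen (h : x ≤ y) : dist (q x) (q y) ≤ chainLen q x y :=
  dist_le_Ico_sum_dist q h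

theorem inline_self (x : ℕ) : Inline q x x := by simp [Inline, chainLen]

theorem inline_succ (x : ℕ) : Inline q x (x + 1) := (chainLen_succ x).le

theorem Inline.chainLen_eq (h : Inline q x y) (hxy : x ≤ y) : chainLen q x y = dist (q x) (q y) :=
  le_antisymm h (dist_le_chainLen hxy)

theorem Inline.sub (h : Inline q x y) (hxa : x ≤ a) (hab : a ≤ b) (hby : b ≤ y) :
    Inline q a b := by
  have h1 : chainLen q x a + chainLen q a y = chainLen q x y := chainLen_add hxa (hab.trans hby)
  have h2 : chainLen q a b + chainLen q b y = chainLen q a y := chainLen_add hab hby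
  have h3 := dist_triangle4 (q x) (q a) (q b) (q y)
  have h4 : dist (q x) (q a) ≤ chainLen q x a := dist_le_chainLen hxa
  have h5 : dist (q b) (q y) ≤ chainLen q b y := dist_le_chainLen hby
  unfold Inline at h ⊢
  linarith

theorem Inline.dist_add (h : Inline q x y) (hxa : x ≤ a) (hay : a ≤ y) :
    dist (q x) (q a) + dist (q a) (q y) = dist (q x) (q y) := by
  rw [← h.chainLen_eq (hxa.trans hay), ← (h.sub le_rfl hxa hay).chainLen_eq hxa,
    ← (h.sub hxa hay le_rfl).chainLen_eq hay, chainLen_add hxa hay]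

theorem Inline.sub_left_eq (h : Inline q x y) (hxa : x ≤ a) (hay : a ≤ y) :
    q a - q x = dist (q x) (q a) • dir (q x) (q y) := by
  have hw : Wbtw ℝ (q x) (q a) (q y) := dist_add_dist_eq_iff.1 (h.dist_add hxa hay)
  obtain ⟨r, ⟨hr0, hr1⟩, hr⟩ := hw
  have h1 : q a - q x = r • (q y - q x) := by
    rw [← hr, AffineMap.lineMap_apply]
    simp
  have h2 : dist (q x) (q a) = r * dist (q x) (q y) := by
    rw [dist_eq_norm', h1, norm_smul, Real.norm_of_nonneg hr0, dist_eq_norm']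
  rw [h2, mul_smul, dist_smul_dir, h1]

theorem Inline.sub_eq (h : Inline q x y) (hxa : x ≤ a) (hab : a ≤ b) (hby : b ≤ y) :
    q b - q a = dist (q a) (q b) • dir (q x) (q y) := by
  have h1 := h.sub_left_eq hxa (hab.trans hby)
  have h2 := h.sub_left_eq (hxa.trans hab) hby
  have h3 := (h.sub le_rfl (hxa.trans hab) hby).dist_add hxa hab
  have : q b - q a = (q b - q x) - (q a - q x) := by abel
  rw [this, h1, h2, ← sub_smul, ← h3, add_sub_cancel_left]

theorem Inline.dir_eq (h : Inline q x y) (hxa : x ≤ a) (hab : a ≤ b) (hby : b ≤ y)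
    (hne : q a ≠ q b) : dir (q a) (q b) = dir (q x) (q y) := by
  have hxy : q x ≠ q y := by
    intro he
    have h1 : chainLen q x y ≤ 0 := by
      have := h
      rwa [Inline, he, dist_self] at this
    have h2 := chainLen_add (q := q) hxa (hab.trans hby)
    have h3 := chainLen_add (q := q) hab hby
    have h4 : dist (q a) (q b) ≤ chainLen q a b := dist_le_chainLen hab
    have := chainLen_nonneg (q := q) (x := x) (y := a)
    have := chainLen_nonneg (q := q) (x := b) (y := y)
    have := dist_pos.2 hne
    linarith
  exact dir_eq_of_sub_eq (dist_pos.2 hne) (norm_dir hxy) (h.sub_eq hxa hab hby)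

theorem Inline.eq_of_eq (h : Inline q x y) (hxa : x ≤ a) (hab : a ≤ b) (hby : b ≤ y)
    (he : q a = q b) {m : ℕ} (ham : a ≤ m) (hmb : m ≤ b) : q m = q a := by
  have h1 := (h.sub hxa hab hby).dist_add ham hmb
  have h2 : dist (q a) (q b) = 0 := by rw [he, dist_self]
  have h3 : dist (q a) (q m) = 0 := by
    linarith [dist_nonneg (x := q a) (y := q m), dist_nonneg (x := q m) (y := q b)]
  exact (dist_eq_zero.1 h3).symm

/-- The common part contains two different positions and so fixes the direction of both chains. A
common part reduced to one point would allow a bend. -/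
theorem Inline.join (h1 : Inline q x b) (h2 : Inline q a y) (hxa : x ≤ a) (hab : a ≤ b)
    (hby : b ≤ y) (hne : q a ≠ q b) : Inline q x y := by
  have e1 : dir (q a) (q b) = dir (q x) (q b) := h1.dir_eq hxa hab le_rfl hne
  have e2 : dir (q a) (q b) = dir (q a) (q y) := h2.dir_eq le_rfl hab hby hne
  have hb : q b - q x = dist (q x) (q b) • dir (q a) (q b) := by
    rw [e1]; exact h1.sub_eq le_rfl (hxa.trans hab) le_rfl
  have hy : q y - q b = dist (q b) (q y) • dir (q a) (q b) := by
    rw [e2]; exact h2.sub_eq hab hby le_rfl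
  have hxy : q y - q x = (dist (q x) (q b) + dist (q b) (q y)) • dir (q a) (q b) := by
    rw [add_smul, ← hb, ← hy]; abel
  have hd := dist_eq_of_sub_eq (add_nonneg dist_nonneg dist_nonneg) (norm_dir hne) hxy
  unfold Inline
  rw [hd, ← chainLen_add (hxa.trans hab) hby, h1.chainLen_eq (hxa.trans hab),
    (h2.sub hab hby le_rfl).chainLen_eq hby]

theorem Inline.join_of_eq (h1 : Inline q x a) (h2 : Inline q a y) (hxa : x ≤ a) (hay : a ≤ y)
    (he : q x = q a ∨ q a = q y) : Inline q x y := by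
  unfold Inline
  rw [← chainLen_add hxa hay, h1.chainLen_eq hxa, h2.chainLen_eq hay]
  rcases he with he | he <;> simp [he]

theorem isStraightAt_iff_inline {i : ℕ} (hi : 1 ≤ i) :
    IsStraightAt q i ↔ Inline q (i - 1) (i + 1) := by
  obtain ⟨k, rfl⟩ : ∃ k, i = k + 1 := ⟨i - 1, by omega⟩
  have h : chainLen q k (k + 1 + 1) = dist (q k) (q (k + 1)) + dist (q (k + 1)) (q (k + 1 + 1)) := by
    rw [← chainLen_add (Nat.le_succ k) (Nat.le_succ (k + 1)), chainLen_succ, chainLen_succ]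
  simp only [IsStraightAt, Inline, Nat.add_sub_cancel, h]
  rw [← dist_add_dist_eq_iff]
  exact ⟨fun h => h.le, fun h => le_antisymm h (dist_triangle _ _ _)⟩

theorem Inline.isStraightAt (h : Inline q x y) {i : ℕ} (hxi : x < i) (hiy : i < y) :
    IsStraightAt q i :=
  (isStraightAt_iff_inline (by omega)).2 (h.sub (by omega) (by omega) (by omega))

theorem Inline.extend (h : Inline q x y) (hxy : x < y) (hs : IsStraightAt q y)
    (hne : q (y - 1) ≠ q y) : Inline q x (y + 1) :=
  h.join ((isStraightAt_iff_inline (by omega)).1 hs) (by omega) (by omega) (by omega) hne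

/-- The start of the block of coinciding robots that ends with `i`. -/
theorem exists_block_start {x i : ℕ} (hxi : x ≤ i) (hne : q x ≠ q i) :
    ∃ a, x < a ∧ a ≤ i ∧ q (a - 1) ≠ q a ∧ ∀ m, a ≤ m → m ≤ i → q m = q a := by
  induction i, hxi using Nat.le_induction with
  | base => exact absurd rfl hne
  | succ i hxi ih =>
    by_cases h : q i = q (i + 1)
    · obtain ⟨a, ha1, ha2, ha3, ha4⟩ := ih (by rwa [h])
      refine ⟨a, ha1, by omega, ha3, fun m hm1 hm2 => ?_⟩
      rcases Nat.lt_or_ge i m with hm | hm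
      · rw [show m = i + 1 by omega, ← h]; exact ha4 i ha2 le_rfl
      · exact ha4 m hm1 hm
    · exact ⟨i + 1, by omega, le_rfl, by simpa using h, fun m h1 h2 => by
        rw [show m = i + 1 by omega]⟩

/-- The end of the block of coinciding robots that starts with `i`. -/
theorem exists_block_end {i y : ℕ} (hiy : i ≤ y) (hne : q i ≠ q y) :
    ∃ b, i ≤ b ∧ b < y ∧ q b ≠ q (b + 1) ∧ ∀ m, i ≤ m → m ≤ b → q m = q i := by
  induction y, hiy using Nat.le_induction with
  | base => exact absurd rfl hne
  | succ y hiy ih =>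
    by_cases h : q i = q y
    · by_cases hall : ∀ m, i ≤ m → m ≤ y → q m = q i
      · exact ⟨y, hiy, by omega, by rwa [← h], hall⟩
      · push Not at hall
        obtain ⟨m, hm1, hm2, hm3⟩ := hall
        have hex : ∃ m, i ≤ m ∧ q m ≠ q i := ⟨m, hm1, hm3⟩
        classical
        set k := Nat.find hex with hk
        have hk1 := Nat.find_spec hex
        have hk2 : k ≤ m := Nat.find_min' hex ⟨hm1, hm3⟩
        have hki : k ≠ i := fun h => hk1.2 (by rw [← hk, h])
        have hmin : ∀ r, i ≤ r → r < k → q r = q i := fun r hr1 hr2 => by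
          by_contra hc
          exact Nat.find_min hex hr2 ⟨hr1, hc⟩
        have hik : i ≤ k := hk1.1
        refine ⟨k - 1, by omega, by omega, ?_, fun r hr1 hr2 => hmin r hr1 (by omega)⟩
        rw [Nat.sub_add_cancel (by omega), hmin (k - 1) (by omega) (by omega)]
        exact hk1.2.symm
    · obtain ⟨b, h1, h2, h3, h4⟩ := ih h
      exact ⟨b, h1, by omega, h3, h4⟩

/-- A block `a, …, b` of coinciding robots strictly inside the chain `x, …, y`. -/
def InnerBlock (q : ℕ → Plane) (x y a b : ℕ) : Prop :=
  x < a ∧ a < b ∧ b < y ∧ (∀ m, a ≤ m → m ≤ b → q m = q a) ∧ q (a - 1) ≠ q a ∧ q b ≠ q (b + 1)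

/-- Betweenness of each robot is not enough: within a block of at least two coinciding robots it is
trivial, and the chain may turn there. A robot that differs from its predecessor and its successor
passes the direction on, so it suffices to exclude interior blocks. -/
theorem inline_of_straight (hs : ∀ i, x < i → i < y → IsStraightAt q i)
    (hb : ∀ a b, ¬ InnerBlock q x y a b) (hxy : x ≤ y) : Inline q x y := by
  have key : ∀ k, x ≤ k → k ≤ y → Inline q x k := by
    intro k hk
    induction k, hk using Nat.le_induction with
    | base => exact fun _ => inline_self x
    | succ k hk ih =>
      intro hky
      have hi := ih (by omega)
      by_cases h1 : q x = q k
      · exact hi.join_of_eq (inline_succ k) hk (by omega) (Or.inl h1)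
      by_cases h2 : q k = q (k + 1)
      · exact hi.join_of_eq (inline_succ k) hk (by omega) (Or.inr h2)
      obtain ⟨a, ha1, ha2, ha3, ha4⟩ := exists_block_start hk h1
      rcases ha2.eq_or_lt with h | h
      · subst h
        exact hi.extend ha1 (hs _ ha1 (by omega)) ha3
      · exact absurd ⟨ha1, h, by omega, ha4, ha3, h2⟩ (hb a k)
  exact key y hxy le_rfl

/-! ### Bends -/

/-- The data of a moving bend: `s` is the speed, `c` the cosine of half the angle, `u` the direction
of the bisector, `e₀` and `e₁` the directions of the incoming and the outgoing chain vector. -/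
structure BendData (τ : ℝ) (n : ℕ) (q v : ℕ → Plane) (j k : ℕ) (s c : ℝ) (u e₀ e₁ : Plane) :
    Prop where
  e₀_eq : e₀ = dir (q (j - 1)) (q j)
  e₁_eq : e₁ = dir (q k) (q (k + 1))
  s_nonneg : 0 ≤ s
  s_le : s ≤ 1
  c_pos : 0 < c
  c_le : c ≤ 1
  norm_u : ‖u‖ = 1
  norm_e₀ : ‖e₀‖ = 1
  norm_e₁ : ‖e₁‖ = 1
  sub_eq : e₁ - e₀ = (2 * c) • u
  inner_u_e₀ : ⟪u, e₀⟫ = -c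
  inner_u_e₁ : ⟪u, e₁⟫ = c
  vel : ∀ i, j ≤ i → i ≤ k → v i = s • u
  full_speed : 1 - τ < c → s = 1
  full_left : IsFullLeft q j → s = 1
  full_right : IsFullRight n q k → s = 1
  rest : c < 1 - τ → dist (q (j - 1)) (q j) ≠ 1 → dist (q k) (q (k + 1)) ≠ 1 → s = 0

theorem inner_dir_eq_cos (x a b : Plane) :
    ⟪dir x a, dir x b⟫ = Real.cos (∠ a x b) := by
  rw [EuclideanGeometry.angle, InnerProductGeometry.cos_angle, dir, dir, real_inner_smul_left,
    real_inner_smul_right]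
  simp only [vsub_eq_sub]
  field_simp

theorem norm_dir_add_dir {x a b : Plane} (ha : a ≠ x) (hb : b ≠ x) :
    ‖dir x a + dir x b‖ = 2 * Real.cos (∠ a x b / 2) := by
  have h0 : 0 ≤ Real.cos (∠ a x b / 2) := Real.cos_nonneg_of_mem_Icc
    ⟨by linarith [EuclideanGeometry.angle_nonneg a x b, Real.pi_pos],
      by linarith [EuclideanGeometry.angle_le_pi a x b]⟩
  rw [← abs_of_nonneg (norm_nonneg (dir x a + dir x b)),
    ← abs_of_nonneg (mul_nonneg zero_le_two h0), ← sq_eq_sq_iff_abs_eq_abs, norm_add_sq_real,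
    norm_dir ha.symm, norm_dir hb.symm, inner_dir_eq_cos x a b, mul_pow, Real.cos_sq (∠ a x b / 2)]
  ring_nf

/-- The cosine of `ψ / 2` is `1 - τ` and the cosine decreases on `[0, π]`. The thresholds on angles
become thresholds on half-angle cosines, the quantities that enter the velocities. -/
theorem lt_psi_iff {τ θ : ℝ} (hτ0 : 0 < τ) (hτ : τ ≤ 1 / 2) (h0 : 0 ≤ θ) (h1 : θ ≤ Real.pi) :
    θ < psi τ ↔ 1 - τ < Real.cos (θ / 2) := by
  have ha : Real.cos (psi τ / 2) = 1 - τ := by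
    rw [psi, mul_div_cancel_left₀ _ two_ne_zero, Real.cos_arccos (by linarith) (by linarith)]
  rw [← ha, Real.strictAntiOn_cos.lt_iff_gt]
  · constructor <;> intro h <;> linarith
  · rw [psi, mul_div_cancel_left₀ _ two_ne_zero]
    exact ⟨Real.arccos_nonneg _, Real.arccos_le_pi _⟩
  · exact ⟨by linarith, by linarith [Real.pi_pos]⟩

theorem psi_lt_iff {τ θ : ℝ} (hτ0 : 0 < τ) (hτ : τ ≤ 1 / 2) (h0 : 0 ≤ θ) (h1 : θ ≤ Real.pi) :
    psi τ < θ ↔ Real.cos (θ / 2) < 1 - τ := by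
  have ha : Real.cos (psi τ / 2) = 1 - τ := by
    rw [psi, mul_div_cancel_left₀ _ two_ne_zero, Real.cos_arccos (by linarith) (by linarith)]
  rw [← ha, Real.strictAntiOn_cos.lt_iff_gt]
  · constructor <;> intro h <;> linarith
  · exact ⟨by linarith, by linarith [Real.pi_pos]⟩
  · rw [psi, mul_div_cancel_left₀ _ two_ne_zero]
    exact ⟨Real.arccos_nonneg _, Real.arccos_le_pi _⟩

theorem BendRule.bendData {τ : ℝ} (hτ0 : 0 < τ) (hτ : τ ≤ 1 / 2) {n : ℕ} {q v : ℕ → Plane}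
    {j k : ℕ} (hb : IsBend n q j k) (hr : BendRule τ n q v j k) :
    ∃ s c : ℝ, ∃ u : Plane,
      BendData τ n q v j k s c u (dir (q (j - 1)) (q j)) (dir (q k) (q (k + 1))) := by
  obtain ⟨hj, hjk, hkn, hblock, hne0, hne1, hang⟩ := hb
  obtain ⟨s, hs0, hs1, hvel, hfull, hrest⟩ := hr
  have hqk : q k = q j := hblock k hjk le_rfl
  set d0 := dir (q j) (q (j - 1)) with hd0
  set d1 := dir (q j) (q (k + 1)) with hd1
  set θ := ∠ (q (j - 1)) (q j) (q (k + 1)) with hθ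
  have hθ0 : 0 ≤ θ := EuclideanGeometry.angle_nonneg _ _ _
  have hθ1 : θ ≤ Real.pi := EuclideanGeometry.angle_le_pi _ _ _
  set c := Real.cos (θ / 2) with hc
  have hc0 : 0 < c := Real.cos_pos_of_mem_Ioo ⟨by linarith [Real.pi_pos], by linarith⟩
  have hnorm : ‖d0 + d1‖ = 2 * c := norm_dir_add_dir hne0 hne1
  have n0 : ‖d0‖ = 1 := norm_dir hne0.symm
  have n1 : ‖d1‖ = 1 := norm_dir hne1.symm
  have he0 : dir (q (j - 1)) (q j) = -d0 := dir_swap _ _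
  have he1 : dir (q k) (q (k + 1)) = d1 := by rw [hqk]
  set u := bisector (q j) (q (j - 1)) (q (k + 1)) with hu
  have hu' : d0 + d1 = (2 * c) • u := by
    rw [hu, bisector, ← hd0, ← hd1, hnorm, smul_smul, mul_inv_cancel₀ (by positivity), one_smul]
  have hin : ⟪d0, d1⟫ = 2 * c ^ 2 - 1 := by
    have := norm_add_sq_real d0 d1
    rw [hnorm, n0, n1] at this
    linarith
  have hu2 : u = (2 * c)⁻¹ • (d0 + d1) := by
    rw [hu', smul_smul, inv_mul_cancel₀ (by positivity), one_smul]
  have s0 : ⟪d0, d0⟫ = 1 := by rw [real_inner_self_eq_norm_sq, n0, one_pow]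
  have s1 : ⟪d1, d1⟫ = 1 := by rw [real_inner_self_eq_norm_sq, n1, one_pow]
  refine ⟨s, c, u, ⟨rfl, rfl, hs0, hs1, hc0, Real.cos_le_one _, ?_, ?_, ?_, ?_, ?_, ?_, hvel,
    ?_, ?_, ?_, ?_⟩⟩
  · rw [hu2, norm_smul, hnorm, norm_inv, Real.norm_of_nonneg (by positivity),
      inv_mul_cancel₀ (by positivity)]
  · rw [he0, norm_neg, n0]
  · rw [he1, n1]
  · rw [he0, he1, ← hu']; abel
  · rw [he0, hu2, inner_neg_right, real_inner_smul_left, inner_add_left, s0, real_inner_comm,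
      hin]
    field_simp; ring
  · rw [he1, hu2, real_inner_smul_left, inner_add_left, s1, hin]
    field_simp; ring
  · intro h
    exact hfull (Or.inl ((lt_psi_iff hτ0 hτ hθ0 hθ1).2 h))
  · exact fun h => hfull (Or.inr (Or.inl h))
  · exact fun h => hfull (Or.inr (Or.inr h))
  · intro h h1 h2
    exact hrest ((psi_lt_iff hτ0 hτ hθ0 hθ1).2 h) h1 (by rwa [hqk] at h2)

/-- An inner robot that does not belong to a bend is between its neighbours. -/
theorem isStraightAt_of_not_bend {n : ℕ} {q : ℕ → Plane} {i : ℕ} (h1 : 1 < i) (hn : i < n)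
    (h : ¬ ∃ j k, j ≤ i ∧ i ≤ k ∧ IsBend n q j k) : IsStraightAt q i := by
  by_cases ha : q (i - 1) = q i
  · unfold IsStraightAt; rw [ha]; exact wbtw_self_left ℝ _ _
  by_cases hb : q (i + 1) = q i
  · unfold IsStraightAt; rw [hb]; exact wbtw_self_right ℝ _ _
  have hpi : ∠ (q (i - 1)) (q i) (q (i + 1)) = Real.pi := by
    by_contra hne
    refine h ⟨i, i, le_rfl, le_rfl, h1, le_rfl, hn, fun m h1 h2 => by rw [le_antisymm h2 h1], ha,
      hb, lt_of_le_of_ne (EuclideanGeometry.angle_le_pi _ _ _) hne⟩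
  exact (EuclideanGeometry.angle_eq_pi_iff_sbtw.1 hpi).wbtw

/-- A block of coinciding inner robots is a bend or in line with its neighbours. -/
theorem isBend_or_wbtw {n : ℕ} {q : ℕ → Plane} {j k : ℕ} (hj : 1 < j) (hjk : j ≤ k) (hk : k < n)
    (hb : ∀ m, j ≤ m → m ≤ k → q m = q j) (h0 : q (j - 1) ≠ q j) (h1 : q (k + 1) ≠ q j) :
    IsBend n q j k ∨ Wbtw ℝ (q (j - 1)) (q j) (q (k + 1)) := by
  by_cases hpi : ∠ (q (j - 1)) (q j) (q (k + 1)) = Real.pi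
  · exact Or.inr (EuclideanGeometry.angle_eq_pi_iff_sbtw.1 hpi).wbtw
  · exact Or.inl ⟨hj, hjk, hk, hb, h0, h1,
      lt_of_le_of_ne (EuclideanGeometry.angle_le_pi _ _ _) hpi⟩

theorem IsBend.not_wbtw {n : ℕ} {q : ℕ → Plane} {j k : ℕ} (hb : IsBend n q j k) :
    ¬ Wbtw ℝ (q (j - 1)) (q j) (q (k + 1)) := by
  obtain ⟨_, _, _, _, h0, h1, h2⟩ := hb
  intro hw
  exact h2.ne (EuclideanGeometry.angle_eq_pi_iff_sbtw.2 ⟨hw, h0.symm, h1.symm⟩)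

/-- A block inside a chain in line is in line with its neighbours. -/
theorem Inline.wbtw (h : Inline q x y) {i j k : ℕ} (hxi : x ≤ i) (hij : i ≤ j) (hjk : j ≤ k)
    (hky : k ≤ y) : Wbtw ℝ (q i) (q j) (q k) :=
  dist_add_dist_eq_iff.1 ((h.sub hxi (hij.trans hjk) hky).dist_add hij hjk)

/-- Robots strictly inside a chain in line, at positions different from its ends, do not belong to
bends. -/
theorem Inline.not_bend {n : ℕ} (h : Inline q x y) {i : ℕ} (hxi : x < i) (hiy : i < y)
    (h0 : q x ≠ q i) (h1 : q i ≠ q y) : ¬ ∃ j k, j ≤ i ∧ i ≤ k ∧ IsBend n q j k := by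
  rintro ⟨j, k, hji, hik, hb⟩
  have hblock := hb.2.2.2.1
  have hxj : x < j := by
    by_contra hc
    exact h0 ((hblock x (by omega) (by omega)).trans (hblock i hji hik).symm)
  have hky : k < y := by
    by_contra hc
    exact h1 ((hblock i hji hik).trans (hblock y (by omega) (by omega)).symm)
  exact hb.not_wbtw (h.wbtw (by omega) (by omega) (by omega) (by omega))

end MaxMob

end

/-! ### Consequences of the rules at a regular time. -/

noncomputable section

namespace MaxMob

/-- Positions and velocities at a regular time of an execution. -/
structure Reg (τ : ℝ) (n : ℕ) (q v : ℕ → Plane) : Prop where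
  speed : ∀ i, 1 ≤ i → i ≤ n → ‖v i‖ ≤ 1
  short : ∀ i, 1 ≤ i → i < n → dist (q i) (q (i + 1)) ≤ 1
  obeys : Obeys τ n q v
  unit : ∀ i, 1 ≤ i → i < n → dist (q i) (q (i + 1)) = 1 → ⟪q (i + 1) - q i, v (i + 1) - v i⟫ = 0
  coin : ∀ i j, 1 ≤ i → i ≤ n → 1 ≤ j → j ≤ n → q i = q j → v i = v j
  coll : ∀ i j k, 1 ≤ i → i ≤ n → 1 ≤ j → j ≤ n → 1 ≤ k → k ≤ n → ∀ (r : ℝ) (w : Plane),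
    q j - q i = r • (q k - q i) → q k ≠ q i → ⟪w, q k - q i⟫ = 0 →
    ⟪w, v j - v i⟫ = r * ⟪w, v k - v i⟫

/-! ### Reversal of the chain -/

/-- The chain in reversed order. -/
def rev (n : ℕ) (q : ℕ → Plane) (i : ℕ) : Plane := q (n + 1 - i)

variable {τ : ℝ} {n : ℕ} {q v : ℕ → Plane}

theorem rev_eq {i j : ℕ} (h : n + 1 - i = j) : rev n q i = q j := by rw [rev, h]

theorem isBend_of_rev {j k : ℕ} (h : IsBend n (rev n q) j k) :
    IsBend n q (n + 1 - k) (n + 1 - j) := by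
  obtain ⟨hj, hjk, hk, hb, h0, h1, h2⟩ := h
  have e1 : rev n q k = q (n + 1 - k) := rfl
  have e2 : rev n q (j - 1) = q (n + 1 - j + 1) := rev_eq (by omega)
  have e3 : rev n q (k + 1) = q (n + 1 - k - 1) := rev_eq (by omega)
  have e4 : rev n q j = q (n + 1 - k) := by rw [← e1]; exact (hb k hjk le_rfl).symm
  rw [e2, e4] at h0
  rw [e3, e4] at h1
  rw [e2, e3, e4] at h2
  refine ⟨by omega, by omega, by omega, fun m h3 h4 => ?_, h1, h0, ?_⟩
  · have := hb (n + 1 - m) (by omega) (by omega)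
    rw [e4, rev, show n + 1 - (n + 1 - m) = m by omega] at this
    exact this
  · rwa [EuclideanGeometry.angle_comm]

theorem IsBend.rev {j k : ℕ} (h : IsBend n q j k) :
    IsBend n (rev n q) (n + 1 - k) (n + 1 - j) := by
  obtain ⟨hj, hjk, hk, hb, h0, h1, h2⟩ := h
  have e2 : MaxMob.rev n q (n + 1 - j + 1) = q (j - 1) := rev_eq (by omega)
  have e3 : MaxMob.rev n q (n + 1 - k - 1) = q (k + 1) := rev_eq (by omega)
  have e4 : MaxMob.rev n q (n + 1 - k) = q j := by
    rw [rev_eq (j := k) (by omega)]; exact hb k hjk le_rfl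
  refine ⟨by omega, by omega, by omega, fun m h3 h4 => ?_, ?_, ?_, ?_⟩
  · rw [e4]; exact hb (n + 1 - m) (by omega) (by omega)
  · rw [e3, e4]; exact h1
  · rw [e2, e4]; exact h0
  · rw [e2, e3, e4, EuclideanGeometry.angle_comm]; exact h2

theorem isStraightAt_rev {i : ℕ} (h1 : 1 ≤ i) (hn : i ≤ n) :
    IsStraightAt (rev n q) i ↔ IsStraightAt q (n + 1 - i) := by
  unfold IsStraightAt
  rw [rev_eq (j := n + 1 - i + 1) (show n + 1 - (i - 1) = _ by omega),
    rev_eq (j := n + 1 - i - 1) (show n + 1 - (i + 1) = _ by omega), wbtw_comm]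
  rfl

theorem isFullRight_of_rev {j : ℕ} (hj : 1 ≤ j) (hjn : j ≤ n) (h : IsFullLeft (rev n q) j) :
    IsFullRight n q (n + 1 - j) := by
  intro m h1 h2
  obtain ⟨h3, h4⟩ := h (n - m) (by omega) (by omega)
  rw [rev_eq (j := m + 1) (by omega), rev_eq (j := m) (by omega), dist_comm] at h3
  refine ⟨h3, fun h5 => ?_⟩
  obtain ⟨h6, h7⟩ := h (n + 1 - m) (by omega) (by omega)
  have := h7 (by omega)
  rw [isStraightAt_rev (by omega) (by omega)] at this
  rwa [show n + 1 - (n + 1 - m) = m by omega] at this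

theorem isFullLeft_of_rev {k : ℕ} (hj : 1 ≤ k) (hjn : k ≤ n) (h : IsFullRight n (rev n q) k) :
    IsFullLeft q (n + 1 - k) := by
  intro m h1 h2
  obtain ⟨h3, h4⟩ := h (n - m) (by omega) (by omega)
  rw [rev_eq (j := m + 1) (by omega), rev_eq (j := m) (by omega), dist_comm] at h3
  refine ⟨h3, fun h5 => ?_⟩
  obtain ⟨h6, h7⟩ := h (n + 1 - m) (by omega) (by omega)
  have := h7 (by omega)
  rw [isStraightAt_rev (by omega) (by omega)] at this
  rwa [show n + 1 - (n + 1 - m) = m by omega] at this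

theorem bisector_comm (x a b : Plane) : bisector x a b = bisector x b a := by
  rw [bisector, bisector, add_comm]

theorem Obeys.rev (hn : 3 ≤ n) (h : Obeys τ n q v) : Obeys τ n (rev n q) (rev n v) := by
  obtain ⟨ho1, ho2, hb, hs⟩ := h
  have g1 : ∀ f : ℕ → Plane, MaxMob.rev n f 1 = f n := fun f => rev_eq (by omega)
  have g2 : ∀ f : ℕ → Plane, MaxMob.rev n f 2 = f (n - 1) := fun f => rev_eq (by omega)
  have g3 : ∀ f : ℕ → Plane, MaxMob.rev n f n = f 1 := fun f => rev_eq (by omega)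
  have g4 : ∀ f : ℕ → Plane, MaxMob.rev n f (n - 1) = f 2 := fun f => rev_eq (by omega)
  refine ⟨by rwa [g1, g2, g1, g2], by rwa [g3, g4, g3, g4], fun j k hjk => ?_,
    fun i h1 h2 hnb hnm => ?_⟩
  · have hbend := isBend_of_rev hjk
    obtain ⟨s, hs0, hs1, hvel, hfull, hrest⟩ := hb _ _ hbend
    obtain ⟨hj, hjk', hk, hblock, h0, h1, h2⟩ := hjk
    have e2 : MaxMob.rev n q (j - 1) = q (n + 1 - j + 1) := rev_eq (by omega)
    have e3 : MaxMob.rev n q (k + 1) = q (n + 1 - k - 1) := rev_eq (by omega)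
    have e4 : MaxMob.rev n q j = q (n + 1 - k) := (hblock k hjk' le_rfl).symm
    refine ⟨s, hs0, hs1, fun i h3 h4 => ?_, fun h => hfull ?_, fun h h3 h4 => hrest ?_ ?_ ?_⟩
    · rw [e2, e3, e4, bisector_comm]
      exact hvel (n + 1 - i) (by omega) (by omega)
    · rcases h with h | h | h
      · left; rwa [e2, e3, e4, EuclideanGeometry.angle_comm] at h
      · right; right; exact isFullRight_of_rev (by omega) (by omega) h
      · right; left; exact isFullLeft_of_rev (by omega) (by omega) h
    · rwa [e2, e3, e4, EuclideanGeometry.angle_comm] at h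
    · rwa [e4, e3, dist_comm] at h4
    · rwa [e4, e2, dist_comm] at h3
  · have e2 : MaxMob.rev n q (i - 1) = q (n + 1 - i + 1) := rev_eq (by omega)
    have e3 : MaxMob.rev n q (i + 1) = q (n + 1 - i - 1) := rev_eq (by omega)
    have := hs (n + 1 - i) (by omega) (by omega) ?_ ?_
    · unfold StraightRule at this ⊢
      rw [e2, e3, midpoint_comm]
      exact this
    · rintro ⟨j, k, h3, h4, h5⟩
      exact hnb ⟨_, _, by omega, by omega, h5.rev⟩
    · unfold IsMidAt at hnm ⊢
      rw [e2, e3, midpoint_comm] at hnm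
      exact hnm

theorem Reg.rev (hn : 3 ≤ n) (h : Reg τ n q v) : Reg τ n (rev n q) (rev n v) where
  speed i h1 h2 := h.speed _ (by omega) (by omega)
  short i h1 h2 := by
    rw [rev_eq (j := n - i + 1) (by omega), rev_eq (j := n - i) (by omega), dist_comm]
    exact h.short _ (by omega) (by omega)
  obeys := h.obeys.rev hn
  unit i h1 h2 := by
    rw [rev_eq (j := n - i + 1) (show n + 1 - i = _ by omega),
      rev_eq (j := n - i) (show n + 1 - (i + 1) = _ by omega),
      rev_eq (j := n - i + 1) (show n + 1 - i = _ by omega),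
      rev_eq (j := n - i) (show n + 1 - (i + 1) = _ by omega), dist_comm]
    intro h3
    have := h.unit (n - i) (by omega) (by omega) h3
    rw [← neg_sub, ← neg_sub (v _), inner_neg_neg]
    exact this
  coin i j h1 h2 h3 h4 h5 := h.coin _ _ (by omega) (by omega) (by omega) (by omega) h5
  coll i j k h1 h2 h3 h4 h5 h6 r w h7 h8 h9 :=
    h.coll _ _ _ (by omega) (by omega) (by omega) (by omega) (by omega) (by omega) r w h7 h8 h9

theorem inline_rev {x y : ℕ} (hy : y ≤ n) :
    Inline (rev n q) x y ↔ Inline q (n + 1 - y) (n + 1 - x) := by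
  have : chainLen (rev n q) x y = chainLen q (n + 1 - y) (n + 1 - x) := by
    unfold chainLen
    rw [← Finset.sum_Ico_reflect _ _ (show y ≤ n + 1 by omega)]
    refine Finset.sum_congr rfl fun i hi => ?_
    rw [Finset.mem_Ico] at hi
    rw [rev_eq (j := n - i + 1) (by omega), rev_eq (j := n - i) (by omega), dist_comm]
  unfold Inline
  rw [this, dist_comm]
  rfl

/-! ### Outer robots -/

theorem OuterRule.norm_le {x y vx vy : Plane} (hτ : τ ≤ 1 / 2) (h : OuterRule τ x y vx vy) :
    ‖vx‖ ≤ 1 - τ := by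
  by_cases hxy : x = y
  · exact h.1 hxy
  have hd : ‖dir y x‖ = 1 := norm_dir (Ne.symm hxy)
  by_cases hlt : dist x y < 1
  · rw [h.2.1 hxy hlt, norm_smul, hd, mul_one, Real.norm_of_nonneg (by linarith)]
  · rw [h.2.2 hxy (not_lt.1 hlt), norm_smul, hd, mul_one,
      Real.norm_of_nonneg (le_max_left _ _)]
    exact max_le (by linarith) (min_le_left _ _)

theorem Reg.speed_first (hτ : τ ≤ 1 / 2) (h : Reg τ n q v) : ‖v 1‖ ≤ 1 - τ :=
  h.obeys.1.norm_le hτ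

theorem Reg.speed_last (hτ : τ ≤ 1 / 2) (h : Reg τ n q v) : ‖v n‖ ≤ 1 - τ :=
  h.obeys.2.1.norm_le hτ

theorem midpoint_sub (x y z : Plane) :
    midpoint ℝ x y - z = (1 / 2 : ℝ) • ((x - z) + (y - z)) := by
  rw [midpoint_eq_smul_add, invOf_eq_inv]
  module

theorem eq_midpoint_of_sub_eq {x y z : Plane} (h : y - x = z - y) : y = midpoint ℝ x z := by
  have := midpoint_sub x z y
  rw [← h, show x - y + (y - x) = 0 by abel, smul_zero] at this
  exact (sub_eq_zero.1 this).symm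

theorem sub_eq_of_eq_midpoint {x y z : Plane} (h : y = midpoint ℝ x z) : y - x = z - y := by
  have := midpoint_sub x z y
  rw [← h, sub_self, eq_comm, smul_eq_zero] at this
  have h2 := this.resolve_left (by norm_num)
  have h3 : z - y = (x - y + (z - y)) + (y - x) := by abel
  rw [h3, h2, zero_add]

/-- The first two robots are at different positions unless all robots coincide. -/
theorem Reg.first_ne (hτ0 : 0 < τ) (hτ : τ ≤ 1 / 2) (hr : Reg τ n q v) {h : ℕ} (h1 : 1 ≤ h)
    (hn : h ≤ n) (hne : q 1 ≠ q h) : q 1 ≠ q 2 := by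
  intro h12
  obtain ⟨b, hb1, hbh, hb2, hb3⟩ := exists_block_end h1 hne
  have hb : 2 ≤ b := by
    by_contra hc
    have : b = 1 := by omega
    subst this
    exact hb2 h12
  -- The last robot `b` at the position of robot `1` would be straight and off its midpoint, hence
  -- have speed one, while coincidence gives it the velocity of robot `1`, of norm at most `1 - τ`.
  have hst := hr.obeys.2.2.2 b (by omega) (by omega) ?_ ?_
  · have h2 := hr.speed_first hτ
    rw [← hr.coin b 1 (by omega) (by omega) le_rfl (by omega) (hb3 b hb1 le_rfl), hst.1] at h2
    linarith
  · rintro ⟨j, k, hj, hk, hbend⟩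
    have := hbend.1
    exact hbend.2.2.2.2.1 ((hb3 (j - 1) (by omega) (by omega)).trans
      (hb3 j (by omega) (by omega)).symm)
  · intro hmid
    have h2 := sub_eq_of_eq_midpoint hmid
    rw [hb3 (b - 1) (by omega) (by omega), hb3 b hb1 le_rfl, sub_self, eq_comm, sub_eq_zero] at h2
    exact hb2 ((hb3 b hb1 le_rfl).trans h2.symm)

theorem Reg.last_ne (hn3 : 3 ≤ n) (hτ0 : 0 < τ) (hτ : τ ≤ 1 / 2) (hr : Reg τ n q v) {h : ℕ}
    (h1 : 1 ≤ h) (hn : h ≤ n) (hne : q h ≠ q n) : q (n - 1) ≠ q n := by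
  have := (hr.rev hn3).first_ne hτ0 hτ (h := n + 1 - h) (by omega) (by omega) ?_
  · rw [rev_eq (j := n) (by omega), rev_eq (j := n - 1) (by omega)] at this
    exact this.symm
  · rw [rev_eq (j := n) (by omega), rev_eq (j := h) (by omega)]
    exact hne.symm

/-! ### Blocks in line with their neighbours do not occur at regular times -/

/-- A sideways motion at full speed is contagious. Since robot `i` lies strictly between `p` and `i
+ 1`, its component along `w`, which is one, is a proper average of theirs, and both are at most
one; so robot `i + 1` also has velocity `w`. The induction passes `w` on along the chain until it
meets a bend, whose velocity is not perpendicular to the incoming vector unless it is zero, or robot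
`n`, which is slower than one. -/
theorem Reg.no_perp (hτ0 : 0 < τ) (hτ : τ ≤ 1 / 2) (hr : Reg τ n q v) (w : Plane) (hw : ‖w‖ = 1) :
    ∀ d i p : ℕ, n - i = d → 1 ≤ i → i < n → 1 ≤ p → p ≤ n → v i = w → ⟪w, q (i + 1) - q i⟫ = 0 →
      q i ≠ q (i + 1) → q p ≠ q i → Wbtw ℝ (q p) (q i) (q (i + 1)) → False := by
  intro d
  induction d using Nat.strong_induction_on with
  | _ d ih =>
    intro i p hd h1 hin hp1 hpn hvi hperp hne hpi hwb
    obtain ⟨r, ⟨hr0, hr1⟩, hrr⟩ := hwb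
    have e1 : q i - q p = r • (q (i + 1) - q p) := by
      rw [← hrr, AffineMap.lineMap_apply]; simp
    have hr0' : 0 < r := by
      rcases hr0.eq_or_lt with h | h
      · rw [← h, zero_smul, sub_eq_zero] at e1; exact absurd e1.symm hpi
      · exact h
    have hr1' : r < 1 := by
      rcases hr1.eq_or_lt with h | h
      · rw [h, one_smul] at e1
        exact absurd (sub_left_injective e1) hne
      · exact h
    have e2 : q (i + 1) - q i = (1 - r) • (q (i + 1) - q p) := by
      rw [sub_smul, one_smul, ← e1]; abel
    have hperp2 : ⟪w, q (i + 1) - q p⟫ = 0 := by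
      rw [e2, real_inner_smul_right] at hperp
      exact (mul_eq_zero.1 hperp).resolve_left (by linarith)
    have hne2 : q (i + 1) ≠ q p := by
      intro he
      rw [he, sub_self, smul_zero, sub_eq_zero] at e1
      exact hpi e1.symm
    have hcoll := hr.coll p i (i + 1) hp1 hpn h1 hin.le (by omega) (by omega) r w e1 hne2 hperp2
    rw [inner_sub_right, inner_sub_right, hvi, real_inner_self_eq_norm_sq, hw] at hcoll
    have hbound : ∀ j, 1 ≤ j → j ≤ n → ⟪w, v j⟫ ≤ 1 := fun j h2 h3 => by
      have := real_inner_le_norm w (v j)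
      rw [hw, one_mul] at this
      exact this.trans (hr.speed j h2 h3)
    have hp := hbound p hp1 hpn
    have hb := hbound (i + 1) (by omega) (by omega)
    -- `hcoll` says `1 = (1 - r) * ⟪w, v p⟫ + r * ⟪w, v (i + 1)⟫` with `0 < r < 1`.
    have hb1 : ⟪w, v (i + 1)⟫ = 1 := by nlinarith
    have hv1 : v (i + 1) = w := by
      have hsp := hr.speed (i + 1) (by omega) (by omega)
      have h2 := norm_sub_sq_real w (v (i + 1))
      rw [hb1, hw] at h2
      have h3 : ‖w - v (i + 1)‖ ^ 2 ≤ 0 := by nlinarith [norm_nonneg (v (i + 1))]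
      have h4 : ‖w - v (i + 1)‖ = 0 := by nlinarith [norm_nonneg (w - v (i + 1))]
      exact (sub_eq_zero.1 (norm_eq_zero.1 h4)).symm
    have hlast : v n ≠ w := fun h => by
      have := hr.speed_last hτ
      rw [h, hw] at this
      linarith
    by_cases hin' : q (i + 1) = q n
    · exact hlast ((hr.coin (i + 1) n (by omega) (by omega) (by omega) le_rfl hin').symm.trans hv1)
    obtain ⟨b, hb1, hbn, hb2, hb3⟩ := exists_block_end (show i + 1 ≤ n by omega) hin'
    have hqb := hb3 b hb1 le_rfl
    rcases isBend_or_wbtw (by omega) hb1 hbn hb3 (by simpa using hne)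
      (by rw [← hqb]; exact hb2.symm) with hbend | hwb'
    · obtain ⟨s, c, u, hB⟩ := (hr.obeys.2.2.1 _ _ hbend).bendData hτ0 hτ hbend
      have hvu := hB.vel (i + 1) le_rfl hb1
      have h2 : ⟪w, dir (q i) (q (i + 1))⟫ = 0 := by
        rw [dir, real_inner_smul_right, hperp, mul_zero]
      rw [← hv1, hvu, real_inner_smul_left] at h2
      have h3 := hB.inner_u_e₀
      simp only [Nat.add_sub_cancel] at h3
      rw [h3] at h2
      have hs : s = 0 := by
        rcases mul_eq_zero.1 h2 with h | h
        · exact h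
        · linarith [hB.c_pos]
      rw [hv1, hs, zero_smul] at hvu
      rw [hvu, norm_zero] at hw
      exact zero_ne_one hw
    · simp only [Nat.add_sub_cancel] at hwb'
      rw [← hqb] at hwb'
      have hvb : v b = w := (hr.coin b (i + 1) (by omega) (by omega) (by omega) (by omega) hqb).trans
        hv1
      refine ih (n - b) (by omega) b i rfl (by omega) hbn h1 hin.le hvb ?_ hb2 ?_ hwb'
      · obtain ⟨r', ⟨hr0', hr1'⟩, hrr'⟩ := hwb'
        have e3 : q b - q i = r' • (q (b + 1) - q i) := by
          rw [← hrr', AffineMap.lineMap_apply]; simp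
        have hr' : r' ≠ 0 := by
          rintro rfl
          rw [zero_smul, hqb, sub_eq_zero] at e3
          exact hne e3.symm
        have h4 : ⟪w, q (b + 1) - q i⟫ = 0 := by
          rw [hqb] at e3
          rw [e3, real_inner_smul_right] at hperp
          exact (mul_eq_zero.1 hperp).resolve_left hr'
        have h5 : q (b + 1) - q b = (1 - r') • (q (b + 1) - q i) := by
          rw [sub_smul, one_smul, ← e3]; abel
        rw [h5, real_inner_smul_right, h4, mul_zero]
      · rw [hqb]; exact hne

/-- The rule pulls the first robot of the block backwards and the last one forwards, both at speed
one. Coinciding robots share their velocity, so it is perpendicular to the chain, which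
`Reg.no_perp` excludes. -/
theorem Reg.not_innerBlock (hτ0 : 0 < τ) (hτ : τ ≤ 1 / 2) (hr : Reg τ n q v) {x y a b : ℕ}
    (hx : 1 ≤ x) (hy : y ≤ n) (hin : Inline q x y) : ¬ InnerBlock q x y a b := by
  rintro ⟨hxa, hab, hby, hblock, h0, h1⟩
  have hqb := hblock b hab.le le_rfl
  have hxa' : q x ≠ q a := fun he =>
    h0 ((hin.eq_of_eq le_rfl hxa.le (by omega) he (by omega) (by omega)).trans he)
  have hay' : q a ≠ q y := fun he => h1
    (hqb.trans (hin.eq_of_eq hxa.le (by omega) le_rfl he (m := b + 1) (by omega) (by omega)).symm)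
  have hva := hr.obeys.2.2.2 a (by omega) (by omega)
    (hin.not_bend hxa (by omega) hxa' hay') ?_
  have hvb := hr.obeys.2.2.2 b (by omega) (by omega)
    (hin.not_bend (by omega) (by omega) (by rwa [hqb]) (by rwa [hqb])) ?_
  · have hxy : q x ≠ q y := fun he => hxa'
      (hin.eq_of_eq le_rfl (by omega) le_rfl he (by omega) (by omega)).symm
    have ea := hin.sub_eq (a := a - 1) (b := a) (by omega) (by omega) (by omega)
    have eb := hin.sub_eq (a := b) (b := b + 1) (by omega) (by omega) (by omega)
    set e := dir (q x) (q y)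
    have hvv : v b = v a := hr.coin b a (by omega) (by omega) (by omega) (by omega) hqb
    have ha2 := hva.2
    have hb2 := hvb.2
    rw [midpoint_sub, hblock (a + 1) (by omega) (by omega), sub_self, add_zero, ← neg_sub (q a), ea,
      real_inner_smul_right, inner_neg_right, real_inner_smul_right] at ha2
    rw [midpoint_sub, hblock (b - 1) (by omega) (by omega), hqb, sub_self, zero_add, ← hqb, eb,
      real_inner_smul_right, real_inner_smul_right, hvv] at hb2
    have hda : 0 < dist (q (a - 1)) (q a) := dist_pos.2 h0
    have hdb : 0 < dist (q b) (q (b + 1)) := dist_pos.2 h1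
    have hz : ⟪v a, e⟫ = 0 := by
      apply le_antisymm
      · by_contra hc
        push Not at hc
        nlinarith [mul_pos hda hc]
      · by_contra hc
        push Not at hc
        nlinarith [mul_pos hdb (neg_pos.2 hc)]
    refine hr.no_perp hτ0 hτ (v a) hva.1 _ b (a - 1) rfl (by omega) (by omega) (by omega)
      (by omega) hvv ?_ h1 (by rwa [hqb]) (hin.wbtw (by omega) (by omega) (by omega) (by omega))
    rw [eb, real_inner_smul_right, hz, mul_zero]
  · intro hmid
    have h2 := sub_eq_of_eq_midpoint hmid
    rw [hblock (b - 1) (by omega) (by omega), hqb, sub_self, eq_comm, sub_eq_zero] at h2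
    exact h1 (hqb.trans h2.symm)
  · intro hmid
    have h2 := sub_eq_of_eq_midpoint hmid
    rw [hblock (a + 1) (by omega) (by omega), sub_self, sub_eq_zero] at h2
    exact h0 h2.symm

/-! ### Runs of vectors of length one -/

/-- Vectors of length one keep this length to first order, so the velocity components of their two
ends along `e` agree. -/
theorem run_inner_eq (hr : Reg τ n q v) {k i : ℕ} {e : Plane} (he : ‖e‖ = 1) (hk : 1 ≤ k)
    (hki : k ≤ i) (hin : i ≤ n) (hrun : ∀ m, k ≤ m → m < i → q (m + 1) - q m = e) :
    ⟪v i, e⟫ = ⟪v k, e⟫ := by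
  induction i, hki using Nat.le_induction with
  | base => rfl
  | succ i hki ih =>
    have h1 := hrun i hki (by omega)
    have h2 := hr.unit i (by omega) (by omega) (by rw [dist_eq_norm', h1, he])
    rw [h1, inner_sub_right, real_inner_comm, real_inner_comm (v i)] at h2
    rw [← ih (by omega) fun m hm1 hm2 => hrun m hm1 (by omega)]
    linarith

/-- At the end `i` of a run of vectors equal to `e` with `‖e‖ = 1`, a robot that does not belong to
a bend is at the midpoint of its neighbours, or it moves with speed one and not in direction `e`. -/
theorem Reg.end_of_run (hr : Reg τ n q v) {i : ℕ} {e : Plane} (he : ‖e‖ = 1) (h1 : 1 < i)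
    (hin : i < n) (hi : q i - q (i - 1) = e) (hnb : ¬ ∃ j k, j ≤ i ∧ i ≤ k ∧ IsBend n q j k) :
    q (i + 1) - q i = e ∨ (‖v i‖ = 1 ∧ ⟪v i, e⟫ ≤ 0) := by
  have hst := isStraightAt_of_not_bend h1 hin hnb
  have hil := (isStraightAt_iff_inline h1.le).1 hst
  have hne : q (i - 1) ≠ q i := by
    intro h
    rw [h, sub_self] at hi
    rw [← hi, norm_zero] at he
    exact zero_ne_one he
  have hdir : dir (q (i - 1)) (q (i + 1)) = e := by
    rw [← hil.dir_eq le_rfl (by omega) (by omega) hne]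
    exact dir_eq_of_sub_eq zero_lt_one he (by rw [hi, one_smul])
  have hnext := hil.sub_eq (a := i) (b := i + 1) (by omega) (by omega) le_rfl
  rw [hdir] at hnext
  have hd1 := hr.short i h1.le hin
  rcases hd1.eq_or_lt with h | h
  · left; rw [hnext, h, one_smul]
  · right
    have hrule := hr.obeys.2.2.2 i h1 hin hnb fun hmid => by
      have h2 := sub_eq_of_eq_midpoint hmid
      rw [hi, hnext] at h2
      have h3 : ‖e‖ = dist (q i) (q (i + 1)) * ‖e‖ := by
        nth_rw 1 [h2]; rw [norm_smul, Real.norm_of_nonneg dist_nonneg]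
      rw [he, mul_one] at h3
      linarith
    refine ⟨hrule.1, ?_⟩
    have h2 := hrule.2
    have h3 : q (i - 1) - q i = (-1 : ℝ) • e := by rw [← hi, neg_one_smul]; abel
    rw [midpoint_sub, hnext, h3, ← add_smul, smul_smul, real_inner_smul_right] at h2
    by_contra hc
    push Not at hc
    nlinarith

theorem isFullRight_of_run {k : ℕ} {e : Plane} (he : ‖e‖ = 1) (hk : 1 ≤ k)
    (hrun : ∀ m, k ≤ m → m < n → q (m + 1) - q m = e) : IsFullRight n q k := by
  intro m h1 h2
  refine ⟨by rw [dist_eq_norm', hrun m h1 h2, he], fun h3 => ?_⟩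
  have h4 := hrun (m - 1) (by omega) (by omega)
  rw [Nat.sub_add_cancel (by omega)] at h4
  unfold IsStraightAt
  rw [eq_midpoint_of_sub_eq (h4.trans (hrun m h1 h2).symm)]
  exact wbtw_midpoint ℝ _ _

theorem isFullLeft_of_run {k : ℕ} {e : Plane} (he : ‖e‖ = 1)
    (hrun : ∀ m, 1 ≤ m → m < k → q (m + 1) - q m = e) : IsFullLeft q k := by
  intro m h1 h2
  refine ⟨by rw [dist_eq_norm', hrun m h1 h2, he], fun h3 => ?_⟩
  have h4 := hrun (m - 1) (by omega) (by omega)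
  rw [Nat.sub_add_cancel (by omega)] at h4
  unfold IsStraightAt
  rw [eq_midpoint_of_sub_eq (h4.trans (hrun m h1 h2).symm)]
  exact wbtw_midpoint ℝ _ _

/-- If the run of vectors `e` ends before robot `n`, the robot at its end does not advance along
`e`: at a bend it moves against the incoming vector, otherwise the next vector is shorter and it
moves back towards its midpoint. The run transports this component to `k`. -/
theorem Reg.run_right (hτ0 : 0 < τ) (hτ : τ ≤ 1 / 2) (hr : Reg τ n q v) {k : ℕ} {e : Plane}
    (he : ‖e‖ = 1) (hk : 1 ≤ k) :
    ∀ d i : ℕ, n - i = d → k < i → i ≤ n → (∀ m, k ≤ m → m < i → q (m + 1) - q m = e) →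
      ⟪v k, e⟫ ≤ 0 ∨ IsFullRight n q k := by
  intro d
  induction d using Nat.strong_induction_on with
  | _ d ih =>
    intro i hd hki hin hrun
    rcases hin.eq_or_lt with h | h
    · subst h
      exact Or.inr (isFullRight_of_run he hk hrun)
    have hi := hrun (i - 1) (by omega) (by omega)
    rw [Nat.sub_add_cancel (by omega)] at hi
    have hv := run_inner_eq hr he hk hki.le hin hrun
    by_cases hb : ∃ j k, j ≤ i ∧ i ≤ k ∧ IsBend n q j k
    · left
      obtain ⟨j, k', hj, hk', hb⟩ := hb
      have hji : j = i := by
        by_contra hc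
        have h2 := (hb.2.2.2.1 (i - 1) (by omega) (by omega)).trans
          (hb.2.2.2.1 i hj hk').symm
        rw [h2, sub_self] at hi
        rw [← hi, norm_zero] at he
        exact zero_ne_one he
      subst hji
      obtain ⟨s, c, u, hB⟩ := (hr.obeys.2.2.1 _ _ hb).bendData hτ0 hτ hb
      have h3 : dir (q (j - 1)) (q j) = e := dir_eq_of_sub_eq zero_lt_one he (by rw [hi, one_smul])
      rw [← hv, hB.vel j le_rfl hk', real_inner_smul_left, ← h3, hB.inner_u_e₀]
      nlinarith [mul_nonneg hB.s_nonneg hB.c_pos.le]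
    · rcases hr.end_of_run he (by omega) h hi hb with h2 | h2
      · refine ih (n - (i + 1)) (by omega) (i + 1) rfl (by omega) (by omega) fun m h3 h4 => ?_
        rcases Nat.lt_or_ge m i with h5 | h5
        · exact hrun m h3 h5
        · rw [show m = i by omega]; exact h2
      · left; rw [← hv]; exact h2.2

/-- A bend next to a vector of length one only moves if this vector is the end of a completely
stretched part of the chain. -/
theorem Reg.bend_right (hτ0 : 0 < τ) (hτ : τ ≤ 1 / 2) (hr : Reg τ n q v) {j k : ℕ} {s c : ℝ}
    {u e₀ e₁ : Plane} (hb : IsBend n q j k) (hB : BendData τ n q v j k s c u e₀ e₁)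
    (h1 : dist (q k) (q (k + 1)) = 1) : s = 0 ∨ IsFullRight n q k := by
  have hj := hb.1
  have hjk := hb.2.1
  have hkn := hb.2.2.1
  have hs : q (k + 1) - q k = e₁ := by
    rw [hB.e₁_eq, ← dist_smul_dir, h1, one_smul]
  rcases hr.run_right hτ0 hτ (k := k) hB.norm_e₁ (by omega) _ (k + 1) rfl (by omega) (by omega)
    (fun m h2 h3 => by rw [show m = k by omega]; exact hs) with h2 | h2
  · left
    rw [hB.vel k hjk le_rfl, real_inner_smul_left, hB.inner_u_e₁] at h2
    have := hB.c_pos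
    have := hB.s_nonneg
    by_contra hc
    have : 0 < s := lt_of_le_of_ne hB.s_nonneg (Ne.symm hc)
    nlinarith [mul_pos this hB.c_pos]
  · exact Or.inr h2

theorem BendData.rev {j k : ℕ} {s c : ℝ} {u e₀ e₁ : Plane} (hb : IsBend n q j k)
    (hB : BendData τ n q v j k s c u e₀ e₁) :
    BendData τ n (rev n q) (rev n v) (n + 1 - k) (n + 1 - j) s c u (-e₁) (-e₀) where
  e₀_eq := by
    have := hb.2.2.1
    rw [rev_eq (j := k + 1) (by omega), rev_eq (j := k) (by omega), dir_swap, hB.e₁_eq]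
  e₁_eq := by
    have := hb.1
    have := hb.2.1
    have := hb.2.2.1
    rw [rev_eq (j := j) (by omega), rev_eq (j := j - 1) (by omega), dir_swap, hB.e₀_eq]
  s_nonneg := hB.s_nonneg
  s_le := hB.s_le
  c_pos := hB.c_pos
  c_le := hB.c_le
  norm_u := hB.norm_u
  norm_e₀ := by rw [norm_neg, hB.norm_e₁]
  norm_e₁ := by rw [norm_neg, hB.norm_e₀]
  sub_eq := by rw [← hB.sub_eq]; abel
  inner_u_e₀ := by rw [inner_neg_right, hB.inner_u_e₁]
  inner_u_e₁ := by rw [inner_neg_right, hB.inner_u_e₀, neg_neg]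
  vel i h1 h2 := hB.vel _
    (by have := hb.2.1; have := hb.2.2.1; omega) (by have := hb.2.2.1; omega)
  full_speed := hB.full_speed
  full_left h := hB.full_right (by
    have := hb.1
    have := hb.2.1
    have := hb.2.2.1
    have := isFullRight_of_rev (by omega) (by omega) h
    rwa [show n + 1 - (n + 1 - k) = k by omega] at this)
  full_right h := hB.full_left (by
    have := hb.1
    have := hb.2.1
    have := hb.2.2.1
    have := isFullLeft_of_rev (by omega) (by omega) h
    rwa [show n + 1 - (n + 1 - j) = j by omega] at this)
  rest h1 h2 h3 := by
    have := hb.1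
    have := hb.2.1
    have := hb.2.2.1
    rw [rev_eq (j := k + 1) (by omega), rev_eq (j := k) (by omega), dist_comm] at h2
    rw [rev_eq (j := j) (by omega), rev_eq (j := j - 1) (by omega), dist_comm] at h3
    exact hB.rest h1 h3 h2

theorem Reg.bend_left (hn : 3 ≤ n) (hτ0 : 0 < τ) (hτ : τ ≤ 1 / 2) (hr : Reg τ n q v) {j k : ℕ}
    {s c : ℝ} {u e₀ e₁ : Plane} (hb : IsBend n q j k) (hB : BendData τ n q v j k s c u e₀ e₁)
    (h1 : dist (q (j - 1)) (q j) = 1) : s = 0 ∨ IsFullLeft q j := by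
  have hj := hb.1
  have hjk := hb.2.1
  have hkn := hb.2.2.1
  rcases (hr.rev hn).bend_right hτ0 hτ hb.rev (hB.rev hb)
    (by rwa [rev_eq (j := j) (by omega), rev_eq (j := j - 1) (by omega), dist_comm]) with h | h
  · exact Or.inl h
  · right
    have := isFullLeft_of_rev (by omega) (by omega) h
    rwa [show n + 1 - (n + 1 - j) = j by omega] at this

/-- A bend whose angle exceeds `ψ` is at rest unless it is the end of a completely stretched part of
the chain. -/
theorem Reg.bend_cases (hn : 3 ≤ n) (hτ0 : 0 < τ) (hτ : τ ≤ 1 / 2) (hr : Reg τ n q v) {j k : ℕ}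
    {s c : ℝ} {u e₀ e₁ : Plane} (hb : IsBend n q j k) (hB : BendData τ n q v j k s c u e₀ e₁) :
    s = 0 ∨ 1 - τ ≤ c ∨ IsFullLeft q j ∨ IsFullRight n q k := by
  by_cases hc : 1 - τ ≤ c
  · exact Or.inr (Or.inl hc)
  push Not at hc
  by_cases h0 : dist (q (j - 1)) (q j) = 1
  · rcases hr.bend_left hn hτ0 hτ hb hB h0 with h | h
    · exact Or.inl h
    · exact Or.inr (Or.inr (Or.inl h))
  by_cases h1 : dist (q k) (q (k + 1)) = 1
  · rcases hr.bend_right hτ0 hτ hb hB h1 with h | h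
    · exact Or.inl h
    · exact Or.inr (Or.inr (Or.inr h))
  exact Or.inl (hB.rest hc h0 h1)

/-! ### The outer parts of the chain -/

/-- If the run of unit vectors stops at a robot `i` before the position of `h`, this robot moves
with speed one. Its component along the line is that of robot `1`, and since robots `1`, `i`, `h`
stay collinear while robot `1` moves along the line, its perpendicular component is `l` times that
of `h`. The equation is the theorem of Pythagoras. -/
theorem Reg.outer_run (hr : Reg τ n q v) {h : ℕ} {x : ℝ} (hhn : h ≤ n) (hin : Inline q 1 h)
    (hne : q 1 ≠ q h) (hv1 : v 1 = -x • dir (q 1) (q h)) :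
    ∀ d i : ℕ, h - i = d → 1 < i → i ≤ h →
      (∀ m, 1 ≤ m → m < i → q (m + 1) - q m = dir (q 1) (q h)) →
      (∃ a, 1 < a ∧ a ≤ h ∧ q a = q h ∧
        ∀ m, 1 ≤ m → m < a → q (m + 1) - q m = dir (q 1) (q h)) ∨
      ∃ l : ℝ, 0 ≤ l ∧ l < 1 ∧ x ^ 2 + l ^ 2 * (‖v h‖ ^ 2 - ⟪v h, dir (q 1) (q h)⟫ ^ 2) = 1 := by
  set e := dir (q 1) (q h) with he
  have hne1 : ‖e‖ = 1 := norm_dir hne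
  have hee : ⟪e, e⟫ = 1 := by rw [real_inner_self_eq_norm_sq, hne1, one_pow]
  intro d
  induction d using Nat.strong_induction_on with
  | _ d ih =>
    intro i hd h1i hih hrun
    by_cases hqi : q i = q h
    · exact Or.inl ⟨i, h1i, hih, hqi, hrun⟩
    have hih' : i < h := lt_of_le_of_ne hih fun h => hqi (by rw [h])
    have hi := hrun (i - 1) (by omega) (by omega)
    rw [Nat.sub_add_cancel (by omega)] at hi
    have h1i' : q 1 ≠ q i := by
      intro hc
      have := hin.eq_of_eq le_rfl h1i.le hih hc (m := i - 1) (by omega) (by omega)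
      rw [this, ← hc, sub_self] at hi
      rw [← hi, norm_zero] at hne1
      exact zero_ne_one hne1
    have hv := run_inner_eq hr hne1 le_rfl h1i.le (by omega) hrun
    rcases hr.end_of_run hne1 h1i (by omega) hi (hin.not_bend h1i hih' h1i' hqi) with h2 | h2
    · refine ih (h - (i + 1)) (by omega) (i + 1) rfl (by omega) (by omega) fun m h3 h4 => ?_
      rcases Nat.lt_or_ge m i with h5 | h5
      · exact hrun m h3 h5
      · rw [show m = i by omega]; exact h2
    · right
      have hpos : 0 < dist (q 1) (q h) := dist_pos.2 hne
      have hadd := hin.dist_add h1i.le hih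
      have hdi : 0 < dist (q i) (q h) := dist_pos.2 hqi
      set l := dist (q 1) (q i) / dist (q 1) (q h) with hl
      have hqih : q i - q 1 = l • (q h - q 1) := by
        rw [hin.sub_left_eq h1i.le hih, ← dist_smul_dir (q 1) (q h), smul_smul, hl,
          div_mul_cancel₀ _ hpos.ne']
      have hve : ⟪v i, e⟫ = -x := by
        rw [hv, hv1, real_inner_smul_left, hee, mul_one]
      have hkey : ∀ w : Plane, ⟪w, e⟫ = 0 → ⟪w, v i⟫ = l * ⟪w, v h⟫ := by
        intro w hw
        have := hr.coll 1 i h le_rfl (by omega) h1i.le (by omega) (by omega) hhn l w hqih hne.symm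
          (by rw [← dist_smul_dir, real_inner_smul_right, hw, mul_zero])
        rw [inner_sub_right, inner_sub_right, hv1, real_inner_smul_right, hw] at this
        linarith
      set p := v h - ⟪v h, e⟫ • e with hp
      set z := v i + x • e - l • p with hz
      have hpe : ⟪p, e⟫ = 0 := by
        rw [hp, inner_sub_left, real_inner_smul_left, hee, mul_one, sub_self]
      have hze : ⟪z, e⟫ = 0 := by
        rw [hz, inner_sub_left, inner_add_left, real_inner_smul_left, real_inner_smul_left, hee,
          hpe, hve]
        ring
      -- `z` is perpendicular to `e`, and collinearity to first order makes it perpendicular to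
      -- itself.
      have hzz : z = 0 := by
        have h3 := hkey z hze
        have h4 : ⟪z, z⟫ = ⟪z, v i⟫ - l * ⟪z, v h⟫ := by
          conv_lhs => rw [hz]
          rw [inner_sub_right, inner_add_right, real_inner_smul_right, real_inner_smul_right,
            hp, inner_sub_right, real_inner_smul_right, hze]
          ring
        rw [h3, sub_self] at h4
        exact inner_self_eq_zero.1 h4
      have hvi : v i = -x • e + l • p := by
        have h3 : v i = z + (-x • e + l • p) := by rw [hz]; module
        rw [h3, hzz, zero_add]
      have hpp : ‖p‖ ^ 2 = ‖v h‖ ^ 2 - ⟪v h, e⟫ ^ 2 := by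
        rw [hp, norm_sub_sq_real, real_inner_smul_right, norm_smul, hne1, mul_one,
          Real.norm_eq_abs, sq_abs]
        ring
      refine ⟨l, div_nonneg dist_nonneg dist_nonneg, (div_lt_one hpos).2 (by linarith), ?_⟩
      have h5 : ‖v i‖ ^ 2 = x ^ 2 + l ^ 2 * ‖p‖ ^ 2 := by
        rw [hvi, norm_add_sq_real, norm_smul, norm_smul, hne1, real_inner_smul_left,
          real_inner_smul_right, real_inner_comm, hpe, mul_pow, mul_pow, Real.norm_eq_abs,
          Real.norm_eq_abs, sq_abs, sq_abs]
        ring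
      rw [← hpp, ← h5, h2.1, one_pow]

/-- The velocity of the first robot of a chain in line: it moves away with speed `1 - τ`, or the
vectors up to the position of `h` have length one, or it is pushed by another robot. -/
theorem Reg.outer_cases (hτ0 : 0 < τ) (hτ : τ ≤ 1 / 2) (hr : Reg τ n q v) {h : ℕ}
    (h1 : 1 < h) (hhn : h ≤ n) (hin : Inline q 1 h) (hne : q 1 ≠ q h) :
    ∃ x : ℝ, 0 ≤ x ∧ x ≤ 1 - τ ∧ v 1 = -x • dir (q 1) (q h) ∧
      (x = 1 - τ ∨
      (∃ a, 1 < a ∧ a ≤ h ∧ q a = q h ∧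
        ∀ m, 1 ≤ m → m < a → q (m + 1) - q m = dir (q 1) (q h)) ∨
      ∃ l : ℝ, 0 ≤ l ∧ l < 1 ∧ x ^ 2 + l ^ 2 * (‖v h‖ ^ 2 - ⟪v h, dir (q 1) (q h)⟫ ^ 2) = 1) := by
  have h12 := hr.first_ne hτ0 hτ h1.le hhn hne
  have hd : dir (q 2) (q 1) = - dir (q 1) (q h) := by
    rw [dir_swap, hin.dir_eq le_rfl (by omega) (by omega) h12]
  obtain ⟨-, ho1, ho2⟩ := hr.obeys.1
  rcases (hr.short 1 le_rfl (by omega)).eq_or_lt with heq | hlt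
  · have hv := ho2 h12 heq.ge
    set x := max 0 (min (1 - τ) ⟪v 2, dir (q 2) (q 1)⟫) with hx
    have hv1 : v 1 = -x • dir (q 1) (q h) := by rw [hv, hd, smul_neg, neg_smul]
    refine ⟨x, le_max_left _ _, max_le (by linarith) (min_le_left _ _), hv1, Or.inr ?_⟩
    refine hr.outer_run hhn hin hne hv1 _ 2 rfl (by omega) (by omega) fun m h2 h3 => ?_
    rw [show m = 1 by omega]
    rw [hin.sub_eq le_rfl (by omega) (by omega), heq, one_smul]
  · have hv := ho1 h12 hlt
    exact ⟨1 - τ, by linarith, le_rfl, by rw [hv, hd, smul_neg, neg_smul], Or.inl rfl⟩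

end MaxMob

end

/-! ### Connectivity, and regularity of almost every time. -/

noncomputable section

namespace MaxMob

open Filter Topology

/-! ### A maximum principle -/

theorem LipOn.finset_sup' {ι : Type*} {a b : ℝ} {f : ι → ℝ → ℝ} {s : Finset ι} (hs : s.Nonempty)
    (hf : ∀ i ∈ s, LipOn a b (f i)) : LipOn a b (fun t => s.sup' hs fun i => f i t) := by
  induction hs using Finset.Nonempty.cons_induction with
  | singleton i => simpa using hf i (by simp)
  | cons i s hi hs ih =>
    simp only [Finset.sup'_cons hs]
    exact (hf i (by simp)).sup (ih fun j hj => hf j (by simp [hj]))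

theorem LipOn.ae_differentiableAt {a b : ℝ} {f : ℝ → ℝ} (hf : LipOn a b f) (hab : a ≤ b) :
    ∀ᵐ t : ℝ, t ∈ Ioo a b → DifferentiableAt ℝ f t := by
  obtain ⟨K, hK⟩ := hf.lipschitzOnWith
  rw [← uIcc_of_le hab] at hK
  filter_upwards [hK.absolutelyContinuousOnInterval.ae_differentiableAt] with t ht hmem
  exact ht (by rw [uIcc_of_le hab]; exact Ioo_subset_Icc_self hmem)

/-- If the derivatives of the maximal functions of a finite family are not positive whenever the
maximum exceeds `C`, then the bound `C` is kept. -/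
theorem le_of_maximum_principle {ι : Type*} {a b C : ℝ} {f : ι → ℝ → ℝ} {s : Finset ι}
    (hab : a ≤ b) (hf : ∀ i ∈ s, LipOn a b (f i)) (h0 : ∀ i ∈ s, f i a ≤ C)
    (hd : ∀ᵐ t : ℝ, t ∈ Ioo a b → ∃ d : ι → ℝ, (∀ i ∈ s, HasDerivAt (f i) (d i) t) ∧
      ∀ M D : ℝ, C < M → (∃ i ∈ s, f i t = M) → (∀ i ∈ s, f i t ≤ M) →
        (∀ i ∈ s, f i t = M → d i = D) → D ≤ 0) :
    ∀ i ∈ s, f i b ≤ C := by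
  intro i0 hi0
  have hs : s.Nonempty := ⟨i0, hi0⟩
  set G : ℝ → ℝ := fun t => max (s.sup' hs fun i => f i t) C with hG
  have hGL : LipOn a b G := (LipOn.finset_sup' hs hf).sup (LipOn.const C)
  have hz1 := ae_hasDerivAt_eq_zero (fun t => G t - C)
  -- At almost every time, all members that attain the truncated maximum `G` have the derivative of
  -- `G`, so they share one value `D`.
  have hz2 : ∀ᵐ t : ℝ, ∀ i ∈ s, G t - f i t = 0 → ∀ d, HasDerivAt (fun t => G t - f i t) d t →
      d = 0 := by
    rw [Finset.eventually_all]
    exact fun i _ => ae_hasDerivAt_eq_zero fun t => G t - f i t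
  have hmono : G b ≤ G a + 0 * (b - a) := by
    refine hGL.le_add_mul hab ?_
    filter_upwards [hGL.ae_differentiableAt hab, hd, hz1, hz2] with t h1 h2 h3 h4 hmem
    have hder := (h1 hmem).hasDerivAt
    refine ⟨deriv G t, ?_, hder⟩
    obtain ⟨d, hd1, hd2⟩ := h2 hmem
    by_cases hc : G t = C
    · exact (h3 (by rw [hc, sub_self]) _ (hder.sub_const C)).le
    have hGC : C < G t := lt_of_le_of_ne (le_max_right _ _) (Ne.symm hc)
    have hGs : G t = s.sup' hs fun i => f i t := by
      rcases max_choice (s.sup' hs fun i => f i t) C with h | h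
      · exact h
      · exact absurd h hc
    refine hd2 (G t) (deriv G t) hGC ?_ ?_ ?_
    · obtain ⟨i, hi, hie⟩ := Finset.exists_mem_eq_sup' hs (fun i => f i t)
      exact ⟨i, hi, by rw [hGs, hie]⟩
    · intro i hi
      rw [hGs]
      exact Finset.le_sup' (fun i => f i t) hi
    · intro i hi hie
      have := h4 i hi (by rw [hie, sub_self]) _ (hder.sub (hd1 i hi))
      linarith
  have hGa : G a ≤ C := max_le (Finset.sup'_le hs _ h0) le_rfl
  have : f i0 b ≤ G b := (Finset.le_sup' (fun i => f i b) hi0).trans (le_max_left _ _)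
  linarith

/-! ### Connectivity is kept -/

variable {τ : ℝ} {n : ℕ} {q v : ℕ → Plane}

/-- Suppose for contradiction that all longest vectors grow at a common positive rate. Then the head
of a longest vector does not advance. This is clear at a bend or before a shorter straight vector;
if the next vector is again longest and aligned, the next head is faster, yet by induction it does
not advance either. Robot `n` advances at most as fast as its neighbour, so an advance would
contradict the growth. -/
theorem Obeys.max_inner_right (hτ0 : 0 < τ) (hτ : τ ≤ 1 / 2) (ho : Obeys τ n q v) {M D : ℝ}
    (hM : 1 ≤ M) (hD : 0 < D) (hle : ∀ i, 1 ≤ i → i < n → dist (q i) (q (i + 1)) ≤ M)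
    (heq : ∀ i, 1 ≤ i → i < n → dist (q i) (q (i + 1)) = M →
      ⟪q (i + 1) - q i, v (i + 1) - v i⟫ = D) {e : Plane} (he : ‖e‖ = 1) :
    ∀ d i : ℕ, n - i = d → 1 < i → i ≤ n → q i - q (i - 1) = M • e → ⟪v i, e⟫ ≤ 0 := by
  have hM0 : 0 < M := by linarith
  intro d
  induction d using Nat.strong_induction_on with
  | _ d ih =>
    intro i hd h1 hin hi
    have hne : q (i - 1) ≠ q i := by
      intro h
      rw [h, sub_self, eq_comm, smul_eq_zero] at hi
      rcases hi with h | h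
      · linarith
      · rw [h, norm_zero] at he; exact zero_ne_one he
    have hdi : dist (q (i - 1)) (q i) = M := dist_eq_of_sub_eq hM0.le he hi
    have hdir : dir (q (i - 1)) (q i) = e := dir_eq_of_sub_eq hM0 he hi
    rcases hin.eq_or_lt with h | h
    · subst h
      have hstep := heq (i - 1) (by omega) (by omega) (by rwa [Nat.sub_add_cancel h1.le])
      rw [Nat.sub_add_cancel h1.le, hi, real_inner_smul_left, inner_sub_right, real_inner_comm,
        real_inner_comm (v (i - 1))] at hstep
      have hv := ho.2.1.2.2 hne.symm (by rw [dist_comm, hdi]; exact hM)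
      rw [hdir] at hv
      have hve : ⟪v i, e⟫ = max 0 (min (1 - τ) ⟪v (i - 1), e⟫) := by
        nth_rw 1 [hv]
        rw [real_inner_smul_left, real_inner_self_eq_norm_sq, he, one_pow, mul_one]
      by_contra hc
      push Not at hc
      rcases le_total 0 (min (1 - τ) ⟪v (i - 1), e⟫) with h2 | h2
      · rw [max_eq_right h2] at hve
        have := min_le_right (1 - τ) ⟪v (i - 1), e⟫
        nlinarith
      · rw [max_eq_left h2] at hve
        linarith
    by_cases hb : ∃ j k, j ≤ i ∧ i ≤ k ∧ IsBend n q j k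
    · obtain ⟨j, k', hj, hk', hb⟩ := hb
      have hji : j = i := by
        by_contra hc
        exact hne ((hb.2.2.2.1 (i - 1) (by omega) (by omega)).trans
          (hb.2.2.2.1 i hj hk').symm)
      subst hji
      obtain ⟨s, c, u, hB⟩ := (ho.2.2.1 _ _ hb).bendData hτ0 hτ hb
      rw [hB.vel j le_rfl hk', real_inner_smul_left, ← hdir, hB.inner_u_e₀]
      nlinarith [mul_nonneg hB.s_nonneg hB.c_pos.le]
    · have hst := isStraightAt_of_not_bend h1 h hb
      have hil := (isStraightAt_iff_inline h1.le).1 hst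
      have hdir' : dir (q (i - 1)) (q (i + 1)) = e := by
        rw [← hil.dir_eq le_rfl (by omega) (by omega) hne, hdir]
      have hnext := hil.sub_eq (a := i) (b := i + 1) (by omega) (by omega) le_rfl
      rw [hdir'] at hnext
      rcases (hle i h1.le h).eq_or_lt with h2 | h2
      · have hstep := heq i h1.le h h2
        have h3 := ih (n - (i + 1)) (by omega) (i + 1) rfl (by omega) (by omega)
          (by rw [Nat.add_sub_cancel, hnext, h2])
        rw [hnext, h2, real_inner_smul_left, inner_sub_right, real_inner_comm,
          real_inner_comm (v i)] at hstep
        by_contra hc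
        push Not at hc
        nlinarith
      · have hrule := ho.2.2.2 i h1 h hb fun hmid => by
          have h3 := sub_eq_of_eq_midpoint hmid
          have h4 : dist (q (i - 1)) (q i) = dist (q i) (q (i + 1)) := by
            rw [dist_eq_norm', dist_eq_norm', h3]
          linarith
        have h3 := hrule.2
        have h4 : q (i - 1) - q i = (-M) • e := by rw [neg_smul, ← hi]; abel
        rw [midpoint_sub, hnext, h4, ← add_smul, smul_smul, real_inner_smul_right] at h3
        by_contra hc
        push Not at hc
        nlinarith

/-- With growth assumed, `Obeys.max_inner_right` for the chain and for its reversal shows that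
neither end of a longest vector moves outwards. -/
theorem Obeys.max_deriv_nonpos (hn : 3 ≤ n) (hτ0 : 0 < τ) (hτ : τ ≤ 1 / 2) (ho : Obeys τ n q v)
    {M D : ℝ} (hM : 1 ≤ M) (hle : ∀ i, 1 ≤ i → i < n → dist (q i) (q (i + 1)) ≤ M)
    (heq : ∀ i, 1 ≤ i → i < n → dist (q i) (q (i + 1)) = M →
      ⟪q (i + 1) - q i, v (i + 1) - v i⟫ = D)
    (hex : ∃ i, 1 ≤ i ∧ i < n ∧ dist (q i) (q (i + 1)) = M) : D ≤ 0 := by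
  by_contra hD
  push Not at hD
  obtain ⟨i, h1, hin, hi⟩ := hex
  have hM0 : 0 < M := by linarith
  have hne : q i ≠ q (i + 1) := dist_pos.1 (by rw [hi]; exact hM0)
  set e := dir (q i) (q (i + 1)) with he
  have he1 : ‖e‖ = 1 := norm_dir hne
  have hsub : q (i + 1) - q i = M • e := by rw [he, ← dist_smul_dir, hi]
  have hR := ho.max_inner_right hτ0 hτ hM hD hle heq he1 _ (i + 1) rfl (by omega) (by omega) hsub
  have hL := (ho.rev hn).max_inner_right hτ0 hτ hM hD (fun j h2 h3 => ?_) (fun j h2 h3 => ?_)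
    (e := -e) (by rw [norm_neg, he1]) _ (n + 1 - i) rfl (by omega) (by omega) ?_
  · rw [rev_eq (j := i) (by omega), inner_neg_right] at hL
    have h2 := heq i h1 hin hi
    rw [hsub, real_inner_smul_left, inner_sub_right, real_inner_comm, real_inner_comm (v i)] at h2
    nlinarith
  · rw [rev_eq (j := n - j + 1) (by omega), rev_eq (j := n - j) (by omega), dist_comm]
    exact hle _ (by omega) (by omega)
  · rw [rev_eq (j := n - j + 1) (show n + 1 - j = _ by omega),
      rev_eq (j := n - j) (show n + 1 - (j + 1) = _ by omega),
      rev_eq (j := n - j + 1) (show n + 1 - j = _ by omega),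
      rev_eq (j := n - j) (show n + 1 - (j + 1) = _ by omega), dist_comm, ← neg_sub, ← neg_sub (v _),
      inner_neg_neg]
    exact heq _ (by omega) (by omega)
  · rw [rev_eq (j := i) (by omega), rev_eq (j := i + 1) (by omega), smul_neg, ← hsub]
    abel

variable {p : ℕ → ℝ → Plane}

theorem IsExecution.lipOn (hp : IsExecution τ n p) {i : ℕ} (h1 : 1 ≤ i) (hn : i ≤ n) {a b : ℝ}
    (ha : 0 ≤ a) : LipOn a b (p i) := by
  refine ⟨1, fun x hx y hy => ?_⟩
  have := (hp.lipschitz i h1 hn).dist_le_mul x (ha.trans hx.1) y (ha.trans hy.1)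
  rwa [dist_eq_norm, Real.dist_eq] at this

theorem IsExecution.ae_obeys (hp : IsExecution τ n p) :
    ∀ᵐ t : ℝ, 0 < t → ∃ v : ℕ → Plane,
      (∀ i, 1 ≤ i → i ≤ n → HasDerivAt (p i) (v i) t) ∧ Obeys τ n (fun m => p m t) v :=
  (ae_restrict_iff' measurableSet_Ioi).1 hp.velocity

theorem IsExecution.dist_le_one (hn : 3 ≤ n) (hτ0 : 0 < τ) (hτ : τ ≤ 1 / 2)
    (hp : IsExecution τ n p) (hconn : IsConnectedChain n (fun i => p i 0)) {t : ℝ} (ht : 0 ≤ t)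
    {i : ℕ} (h1 : 1 ≤ i) (hin : i < n) : dist (p i t) (p (i + 1) t) ≤ 1 := by
  -- Squared lengths are used because they are differentiable even where neighbours coincide.
  have key := le_of_maximum_principle (C := 1) (s := Finset.Ico 1 n)
    (f := fun i t => ‖p (i + 1) t - p i t‖ ^ 2) ht ?_ ?_ ?_ i (by simp [h1, hin])
  · rw [dist_eq_norm']
    have := norm_nonneg (p (i + 1) t - p i t)
    nlinarith
  · intro i hi
    rw [Finset.mem_Ico] at hi
    have h := ((hp.lipOn (i := i + 1) (by omega) (by omega) le_rfl (b := t)).sub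
      (hp.lipOn hi.1 hi.2.le le_rfl)).norm
    simpa only [pow_two] using h.mul h
  · intro i hi
    rw [Finset.mem_Ico] at hi
    have := hconn i hi.1 hi.2
    rw [dist_eq_norm'] at this
    have h0 := norm_nonneg (p (i + 1) 0 - p i 0)
    nlinarith
  · filter_upwards [hp.ae_obeys] with s hs hmem
    obtain ⟨v, hv, ho⟩ := hs hmem.1
    refine ⟨fun i => 2 * ⟪p (i + 1) s - p i s, v (i + 1) - v i⟫, fun i hi => ?_, ?_⟩
    · rw [Finset.mem_Ico] at hi
      exact ((hv (i + 1) (by omega) (by omega)).sub (hv i hi.1 hi.2.le)).norm_sq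
    · intro M D hM hex hle heq
      have hsq : ∀ i, dist (p i s) (p (i + 1) s) = √M ↔ ‖p (i + 1) s - p i s‖ ^ 2 = M := by
        intro i
        rw [dist_eq_norm', eq_comm, Real.sqrt_eq_iff_eq_sq (by linarith) (norm_nonneg _), eq_comm]
      have h2 : D / 2 ≤ 0 := by
        refine ho.max_deriv_nonpos hn hτ0 hτ (M := √M) (Real.one_le_sqrt.2 hM.le) ?_ ?_ ?_
        · intro i h1 h2
          rw [dist_eq_norm']
          exact Real.le_sqrt_of_sq_le (hle i (by simp [h1, h2]))
        · intro i h1 h2 h3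
          have := heq i (by simp [h1, h2]) ((hsq i).1 h3)
          linarith
        · obtain ⟨i, hi, hie⟩ := hex
          rw [Finset.mem_Ico] at hi
          exact ⟨i, hi.1, hi.2, (hsq i).2 hie⟩
      linarith

/-! ### Almost every time is regular -/

theorem IsExecution.ae_reg (hn : 3 ≤ n) (hτ0 : 0 < τ) (hτ : τ ≤ 1 / 2)
    (hp : IsExecution τ n p) (hconn : IsConnectedChain n (fun i => p i 0)) :
    ∀ᵐ t : ℝ, 0 < t → ∃ v : ℕ → Plane,
      (∀ i, 1 ≤ i → i ≤ n → HasDerivAt (p i) (v i) t) ∧ Reg τ n (fun m => p m t) v := by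
  have hu : ∀ᵐ t : ℝ, ∀ i, ‖p (i + 1) t - p i t‖ ^ 2 - 1 = 0 →
      ∀ d, HasDerivAt (fun t => ‖p (i + 1) t - p i t‖ ^ 2 - 1) d t → d = 0 :=
    ae_all_iff.2 fun i => ae_hasDerivAt_eq_zero fun t => ‖p (i + 1) t - p i t‖ ^ 2 - 1
  have hc : ∀ᵐ t : ℝ, ∀ i j, p i t - p j t = 0 →
      ∀ d, HasDerivAt (fun t => p i t - p j t) d t → d = 0 :=
    ae_all_iff.2 fun i => ae_all_iff.2 fun j => ae_hasDerivAt_eq_zero fun t => p i t - p j t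
  -- With `A = p j - p i` and `B = p k - p i`, the vector `⟪B, B⟫ • A - ⟪A, B⟫ • B` vanishes when
  -- `A` is a multiple of `B`. The part of its derivative perpendicular to `B` is the first-order
  -- collinearity relation.
  have hl : ∀ᵐ t : ℝ, ∀ i j k,
      ⟪p k t - p i t, p k t - p i t⟫ • (p j t - p i t)
        - ⟪p j t - p i t, p k t - p i t⟫ • (p k t - p i t) = 0 →
      ∀ d, HasDerivAt (fun t => ⟪p k t - p i t, p k t - p i t⟫ • (p j t - p i t)
        - ⟪p j t - p i t, p k t - p i t⟫ • (p k t - p i t)) d t → d = 0 :=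
    ae_all_iff.2 fun i => ae_all_iff.2 fun j => ae_all_iff.2 fun k => ae_hasDerivAt_eq_zero _
  filter_upwards [hp.ae_obeys, hu, hc, hl] with t h1 h2 h3 h4 ht
  obtain ⟨v, hv, ho⟩ := h1 ht
  refine ⟨v, hv, ⟨fun i hi hi' => ?_, fun i hi hi' => ?_, ho, fun i hi hi' hd => ?_,
    fun i j hi hi' hj hj' he => ?_, fun i j k hi hi' hj hj' hk hk' r w hr hne hw => ?_⟩⟩
  · have := (hv i hi hi').le_of_lipschitzOn (Ici_mem_nhds ht) (hp.lipschitz i hi hi')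
    simpa using this
  · exact hp.dist_le_one hn hτ0 hτ hconn ht.le hi hi'
  · have := h2 i (by rw [← dist_eq_norm', hd]; norm_num) _
      (((hv (i + 1) (by omega) (by omega)).sub (hv i hi hi'.le)).norm_sq.sub_const 1)
    simpa using this
  · have := h3 i j (sub_eq_zero.2 he) _ ((hv i hi hi').sub (hv j hj hj'))
    exact sub_eq_zero.1 this
  · have dA := (hv j hj hj').sub (hv i hi hi')
    have dB := (hv k hk hk').sub (hv i hi hi')
    have hz := h4 i j k ?_ _ (((dB.inner ℝ dB).smul dA).sub ((dA.inner ℝ dB).smul dB))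
    · have h5 := congrArg (fun z => ⟪w, z⟫) hz
      simp only [Pi.sub_apply, inner_sub_right, inner_add_right, real_inner_smul_right,
        inner_zero_right] at h5
      have h6 : ⟪w, p j t⟫ - ⟪w, p i t⟫ = 0 := by
        rw [← inner_sub_right, hr, real_inner_smul_right, hw, mul_zero]
      have h7 : ⟪w, p k t⟫ - ⟪w, p i t⟫ = 0 := by rw [← inner_sub_right, hw]
      rw [h6, h7, mul_zero, mul_zero, add_zero, add_zero] at h5
      have hB : ⟪p k t - p i t, p k t - p i t⟫ ≠ 0 := fun h =>
        hne (sub_eq_zero.1 (inner_self_eq_zero.1 h))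
      have h8 : ⟪p j t - p i t, p k t - p i t⟫ = r * ⟪p k t - p i t, p k t - p i t⟫ := by
        rw [hr, real_inner_smul_left]
      simp only [← inner_sub_right] at h5
      rw [h8] at h5
      have h9 : ⟪p k t - p i t, p k t - p i t⟫ *
          (⟪w, v j - v i⟫ - r * ⟪w, v k - v i⟫) = 0 := by linarith
      have := (mul_eq_zero.1 h9).resolve_left hB
      linarith
    · simp only [hr, real_inner_smul_left, smul_smul]
      rw [mul_comm, sub_self]

end MaxMob

end

/-! ### Persistence of chains in line. -/

noncomputable section

namespace MaxMob

open Filter Topology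

variable {τ : ℝ} {n : ℕ} {p : ℕ → ℝ → Plane}

/-! ### Equally spaced robots -/

theorem step_eq_of_mid {q : ℕ → Plane} {x y : ℕ} (h : ∀ m, x < m → m < y → IsMidAt q m) {m : ℕ}
    (hxm : x ≤ m) (hmy : m < y) : q (m + 1) - q m = q (x + 1) - q x := by
  induction m, hxm using Nat.le_induction with
  | base => rfl
  | succ m hxm ih =>
    rw [← ih (by omega)]
    have := sub_eq_of_eq_midpoint (h (m + 1) (by omega) hmy)
    simpa using this.symm

theorem inline_of_mid {q : ℕ → Plane} {x y : ℕ} (h : ∀ m, x < m → m < y → IsMidAt q m)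
    (hxy : x ≤ y) : Inline q x y := by
  refine inline_of_straight (fun i h1 h2 => ?_) (fun a b hab => ?_) hxy
  · have := h i h1 h2
    unfold IsMidAt at this
    unfold IsStraightAt
    rw [this]
    exact wbtw_midpoint ℝ _ _
  · obtain ⟨h1, h2, h3, h4, h5, -⟩ := hab
    have e1 := step_eq_of_mid h (m := a) h1.le (by omega)
    have e2 := step_eq_of_mid h (m := a - 1) (by omega) (by omega)
    rw [h4 (a + 1) (by omega) (by omega), sub_self] at e1
    rw [← e1, Nat.sub_add_cancel (by omega), sub_eq_zero] at e2
    exact h5 e2.symm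

theorem isMidAt_of_eq {q : ℕ → Plane} {m : ℕ} (h1 : q (m - 1) = q m) (h2 : q (m + 1) = q m) :
    IsMidAt q m := by
  unfold IsMidAt
  rw [h1, h2, midpoint_self]

/-! ### Chains that stay in line -/

/-- The robots `x, …, y` are in line from time `t` on. -/
def Forever (p : ℕ → ℝ → Plane) (x y : ℕ) (t : ℝ) : Prop :=
  ∀ t', t ≤ t' → Inline (fun m => p m t') x y

theorem Forever.mono {x y : ℕ} {s t : ℝ} (h : Forever p x y s) (hst : s ≤ t) : Forever p x y t :=
  fun t' ht => h t' (hst.trans ht)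

theorem Forever.sub {x y a b : ℕ} {t : ℝ} (h : Forever p x y t) (hxa : x ≤ a) (hab : a ≤ b)
    (hby : b ≤ y) : Forever p a b t :=
  fun t' ht => (h t' ht).sub hxa hab hby

theorem forever_succ (x : ℕ) (t : ℝ) : Forever p x (x + 1) t := fun _ _ => inline_succ x

theorem IsExecution.continuousOn (hp : IsExecution τ n p) {i : ℕ} (h1 : 1 ≤ i) (hn : i ≤ n) :
    ContinuousOn (p i) (Ici 0) := (hp.lipschitz i h1 hn).continuousOn

theorem IsExecution.continuousAt (hp : IsExecution τ n p) {i : ℕ} (h1 : 1 ≤ i) (hn : i ≤ n)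
    {t : ℝ} (ht : 0 < t) : ContinuousAt (p i) t :=
  (hp.continuousOn h1 hn).continuousAt (Ici_mem_nhds ht)

theorem IsExecution.tendsto_right (hp : IsExecution τ n p) {i : ℕ} (h1 : 1 ≤ i) (hn : i ≤ n)
    {t : ℝ} (ht : 0 ≤ t) : Tendsto (p i) (𝓝[>] t) (𝓝 (p i t)) :=
  ((hp.continuousOn h1 hn) t ht).mono fun _ hs => ht.trans (le_of_lt hs)

/-- Robots that coincide with both neighbours at time `s` are at midpoints and stay there, so `x, …,
b` remain equally spaced: two coinciding consecutive robots among them force all of them to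
coincide. -/
theorem IsExecution.block_left_end (hp : IsExecution τ n p) {x y a b : ℕ} {s r : ℝ} (hx : 1 ≤ x)
    (hy : y ≤ n) (hs : 0 ≤ s) (hsr : s ≤ r) (h : ∀ m, x ≤ m → m ≤ b → p m s = p x s) :
    ¬ InnerBlock (fun m => p m r) x y a b := by
  rintro ⟨h1, h2, h3, h4, h5, -⟩
  have hmid : ∀ m, x < m → m < b → IsMidAt (fun m => p m r) m := fun m hm1 hm2 =>
    hp.mid m (by omega) (by omega) s r hs hsr
      (isMidAt_of_eq ((h (m - 1) (by omega) (by omega)).trans (h m (by omega) (by omega)).symm)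
        ((h (m + 1) (by omega) (by omega)).trans (h m (by omega) (by omega)).symm))
  have e1 := step_eq_of_mid hmid (m := a) h1.le (by omega)
  have e2 := step_eq_of_mid hmid (m := a - 1) (by omega) (by omega)
  have h6 : p (a + 1) r = p a r := h4 (a + 1) (by omega) (by omega)
  simp only [h6, sub_self] at e1
  simp only [← e1, Nat.sub_add_cancel (show 1 ≤ a by omega), sub_eq_zero] at e2
  exact h5 e2.symm

theorem IsExecution.block_right_end (hp : IsExecution τ n p) {x y a b : ℕ} {s r : ℝ} (hx : 1 ≤ x)
    (hy : y ≤ n) (hs : 0 ≤ s) (hsr : s ≤ r) (h : ∀ m, a ≤ m → m ≤ y → p m s = p a s) :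
    ¬ InnerBlock (fun m => p m r) x y a b := by
  rintro ⟨h1, h2, h3, h4, -, h5⟩
  have hmid : ∀ m, a < m → m < y → IsMidAt (fun m => p m r) m := fun m hm1 hm2 =>
    hp.mid m (by omega) (by omega) s r hs hsr
      (isMidAt_of_eq ((h (m - 1) (by omega) (by omega)).trans (h m (by omega) (by omega)).symm)
        ((h (m + 1) (by omega) (by omega)).trans (h m (by omega) (by omega)).symm))
  have e2 := step_eq_of_mid hmid (m := b) (by omega) (by omega)
  have h6 : p (a + 1) r = p a r := h4 (a + 1) (by omega) (by omega)
  simp only [h6, sub_self, sub_eq_zero] at e2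
  exact h5 e2.symm

/-- Induction along the time axis. A block cannot close at time `s`, since just before, the vectors
inside it are shorter than those next to it, so its first robot is pulled back and its last one
forward. Right after `s`, only robots coinciding at `s` can form a block; these coincide with an end
of the chain, and equal spacing excludes the block. -/
theorem IsExecution.not_innerBlock (hp : IsExecution τ n p) {x y : ℕ} {t : ℝ}
    (hx : 1 ≤ x) (hxy : x ≤ y) (hy : y ≤ n) (ht : 0 ≤ t)
    (hs : ∀ i, x < i → i < y → IsStraightAt (fun m => p m t) i)
    (hb : ∀ a b, ¬ InnerBlock (fun m => p m t) x y a b) {t' : ℝ} (htt : t ≤ t') :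
    ∀ a b, ¬ InnerBlock (fun m => p m t') x y a b := by
  have hst : ∀ r, t ≤ r → ∀ i, x < i → i < y → IsStraightAt (fun m => p m r) i :=
    fun r hr i h1 h2 => hp.straight i (by omega) (by omega) t r ht hr (hs i h1 h2)
  refine real_induction (P := fun r => ∀ a b, ¬ InnerBlock (fun m => p m r) x y a b) hb
    (fun s hts hP a b hab => ?_) (fun s hts hP => ?_) t' htt
  · obtain ⟨hxa, hab', hby, hblock, h0, h1⟩ := hab
    have hs0 : 0 < s := lt_of_le_of_lt ht hts
    obtain ⟨δ, hδ, hδ0, hδ1⟩ : ∃ δ : ℝ, 0 < δ ∧ δ < dist (p (a - 1) s) (p a s) ∧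
        δ < dist (p b s) (p (b + 1) s) := by
      have h2 := dist_pos.2 h0
      have h3 := dist_pos.2 h1
      exact ⟨min (dist (p (a - 1) s) (p a s)) (dist (p b s) (p (b + 1) s)) / 2, by positivity,
        by linarith [min_le_left (dist (p (a - 1) s) (p a s)) (dist (p b s) (p (b + 1) s)),
          lt_min h2 h3],
        by linarith [min_le_right (dist (p (a - 1) s) (p a s)) (dist (p b s) (p (b + 1) s)),
          lt_min h2 h3]⟩
    have hcd : ∀ i, 1 ≤ i → i < n → ContinuousAt (fun r => dist (p i r) (p (i + 1) r)) s :=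
      fun i h2 h3 => (hp.continuousAt h2 h3.le hs0).dist (hp.continuousAt (by omega) (by omega) hs0)
    have ev1 : ∀ᶠ r in 𝓝 s, δ < dist (p (a - 1) r) (p a r) := by
      have := hcd (a - 1) (by omega) (by omega)
      rw [Nat.sub_add_cancel (by omega)] at this
      exact this.eventually_const_lt hδ0
    have ev2 : ∀ᶠ r in 𝓝 s, δ < dist (p b r) (p (b + 1) r) :=
      (hcd b (by omega) (by omega)).eventually_const_lt hδ1
    have ev3 : ∀ᶠ r in 𝓝 s, dist (p a r) (p (a + 1) r) < δ := by
      refine (hcd a (by omega) (by omega)).eventually_lt_const ?_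
      have h2 : p (a + 1) s = p a s := hblock (a + 1) (by omega) (by omega)
      simp only [h2, dist_self]; exact hδ
    have ev4 : ∀ᶠ r in 𝓝 s, dist (p (b - 1) r) (p b r) < δ := by
      have := hcd (b - 1) (by omega) (by omega)
      rw [Nat.sub_add_cancel (by omega)] at this
      refine this.eventually_lt_const ?_
      have h2 : p (b - 1) s = p a s := hblock (b - 1) (by omega) (by omega)
      have h3 : p b s = p a s := hblock b (by omega) (by omega)
      simp only [h2, h3, dist_self]; exact hδ
    obtain ⟨l, hl, hlI⟩ := exists_Ioc_subset_of_mem_nhds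
      (((ev1.and ev2).and (ev3.and ev4)).and (lt_mem_nhds hts)) ⟨t, hts⟩
    set r0 := (l + s) / 2 with hr0
    have hl' : l < s := hl
    have hr0s : r0 < s := by rw [hr0]; linarith
    have hlr0 : l < r0 := by rw [hr0]; linarith
    have hr0t : t < r0 := (hlI ⟨hlr0, hr0s.le⟩).2
    have hinl : ∀ r, r0 ≤ r → r < s → Inline (fun m => p m r) x y := fun r h2 h3 =>
      inline_of_straight (hst r (by linarith)) (hP r (by linarith) h3) hxy
    -- The distance between `a` and `b` does not decrease shortly before `s`, so if it is zero at
    -- `s` it was zero before.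
    have hLip : LipOn r0 s (fun r => -‖p b r - p a r‖ ^ 2) := by
      have := ((hp.lipOn (i := b) (by omega) (by omega) (ht.trans hr0t.le) (b := s)).sub
        (hp.lipOn (i := a) (by omega) (by omega) (ht.trans hr0t.le))).norm
      simpa only [pow_two] using (this.mul this).neg
    have hmono := hLip.le_add_mul (m := 0) hr0s.le ?_
    · have h2 : p b s = p a s := hblock b hab'.le le_rfl
      rw [h2, sub_self, norm_zero] at hmono
      have h3 : ‖p b r0 - p a r0‖ = 0 := by
        have := norm_nonneg (p b r0 - p a r0)
        nlinarith
      have h4 : p a r0 = p b r0 := (sub_eq_zero.1 (norm_eq_zero.1 h3)).symm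
      have h5 := hlI ⟨hlr0, hr0s.le⟩
      refine hP r0 hr0t.le hr0s a b ⟨hxa, hab', hby, fun m h6 h7 =>
        (hinl r0 le_rfl hr0s).eq_of_eq hxa.le hab'.le hby.le h4 h6 h7, ?_, ?_⟩
      · exact dist_pos.1 (hδ.trans h5.1.1.1)
      · exact dist_pos.1 (hδ.trans h5.1.1.2)
    · filter_upwards [hp.ae_obeys] with r hr hmem
      obtain ⟨v, hv, ho⟩ := hr (lt_of_le_of_lt (ht.trans hr0t.le) hmem.1)
      refine ⟨_, ?_, (((hv b (by omega) (by omega)).sub (hv a (by omega) (by omega))).norm_sq).neg⟩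
      have hi := hinl r hmem.1.le hmem.2
      have hev := (hlI ⟨hlr0.trans hmem.1, hmem.2.le⟩).1
      obtain ⟨⟨hd1, hd2⟩, hd3, hd4⟩ := hev
      have na : p (a - 1) r ≠ p a r := dist_pos.1 (hδ.trans hd1)
      have nb : p b r ≠ p (b + 1) r := dist_pos.1 (hδ.trans hd2)
      have hnab : p a r ≠ p b r := fun h4 => hP r (hr0t.le.trans hmem.1.le) hmem.2 a b
        ⟨hxa, hab', hby, fun m h6 h7 => hi.eq_of_eq hxa.le hab'.le hby.le h4 h6 h7, na, nb⟩
      have nxa : p x r ≠ p a r := fun he =>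
        na ((hi.eq_of_eq le_rfl hxa.le (by omega) he (m := a - 1) (by omega) (by omega)).trans he)
      have nxb : p x r ≠ p b r := fun he =>
        nxa (hi.eq_of_eq le_rfl (by omega) hby.le he (m := a) (by omega) (by omega)).symm
      have nby : p b r ≠ p y r := fun he =>
        nb (hi.eq_of_eq (by omega) hby.le le_rfl he (m := b + 1) (by omega) (by omega)).symm
      have nay : p a r ≠ p y r := fun he =>
        hnab (hi.eq_of_eq hxa.le (by omega) le_rfl he (m := b) (by omega) (by omega)).symm
      have ga := ho.2.2.2 a (by omega) (by omega) (hi.not_bend hxa (by omega) nxa nay) fun hmid => by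
        have h5 : p a r - p (a - 1) r = p (a + 1) r - p a r := sub_eq_of_eq_midpoint hmid
        rw [dist_eq_norm', h5, ← dist_eq_norm'] at hd1
        linarith
      have gb := ho.2.2.2 b (by omega) (by omega) (hi.not_bend (by omega) hby nxb nby) fun hmid => by
        have h5 : p b r - p (b - 1) r = p (b + 1) r - p b r := sub_eq_of_eq_midpoint hmid
        rw [dist_eq_norm', ← h5, ← dist_eq_norm'] at hd2
        linarith
      have ea := hi.sub_eq (a := a - 1) (b := a) (by omega) (by omega) (by omega)
      have ea' := hi.sub_eq (a := a) (b := a + 1) (by omega) (by omega) (by omega)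
      have eb := hi.sub_eq (a := b - 1) (b := b) (by omega) (by omega) (by omega)
      have eb' := hi.sub_eq (a := b) (b := b + 1) (by omega) (by omega) (by omega)
      have eab := hi.sub_eq (a := a) (b := b) (by omega) (by omega) (by omega)
      set e := dir (p x r) (p y r)
      have g1 := ga.2
      have g2 := gb.2
      rw [midpoint_sub, ← neg_sub (p a r), ea, ea', ← neg_smul, ← add_smul, smul_smul,
        real_inner_smul_right] at g1
      rw [midpoint_sub, ← neg_sub (p b r), eb, eb', ← neg_smul, ← add_smul, smul_smul,
        real_inner_smul_right] at g2
      have g3 : ⟪v a, e⟫ ≤ 0 := by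
        by_contra hc
        push Not at hc
        nlinarith
      have g4 : 0 ≤ ⟪v b, e⟫ := by
        by_contra hc
        push Not at hc
        nlinarith
      rw [Pi.sub_apply, eab, real_inner_smul_left, inner_sub_right, real_inner_comm, real_inner_comm (v a)]
      have : 0 ≤ dist (p a r) (p b r) * (⟪v b, e⟫ - ⟪v a, e⟫) :=
        mul_nonneg dist_nonneg (by linarith)
      linarith
  · have hs0 : 0 ≤ s := ht.trans hts
    have hi : Inline (fun m => p m s) x y := inline_of_straight (hst s hts) (hP s hts le_rfl) hxy
    have hev : ∀ a ∈ Finset.range n, ∀ b ∈ Finset.range n,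
        ∀ᶠ r in 𝓝[>] s, ¬ InnerBlock (fun m => p m r) x y a b := by
      intro a _ b _
      by_cases hidx : x < a ∧ a < b ∧ b < y
      swap
      · exact Eventually.of_forall fun r hr => hidx ⟨hr.1, hr.2.1, hr.2.2.1⟩
      obtain ⟨hxa, hab, hby⟩ := hidx
      by_cases hco : p a s = p b s
      swap
      · have h1 := (hp.tendsto_right (i := a) (by omega) (by omega) hs0).sub
          (hp.tendsto_right (i := b) (by omega) (by omega) hs0)
        filter_upwards [h1.eventually_ne (sub_ne_zero.2 hco)] with r hr hbk
        exact hr (sub_eq_zero.2 (hbk.2.2.2.1 b hab.le le_rfl).symm)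
      have hblock : ∀ m, a ≤ m → m ≤ b → p m s = p a s := fun m h1 h2 =>
        hi.eq_of_eq hxa.le hab.le hby.le hco h1 h2
      -- Otherwise, extending `a, …, b` to a maximal block would give an interior block at time `s`.
      have key : (∀ m, x ≤ m → m ≤ b → p m s = p x s) ∨ (∀ m, a ≤ m → m ≤ y → p m s = p a s) := by
        by_cases h1 : p x s = p a s
        · exact Or.inl fun m h2 h3 =>
            hi.eq_of_eq le_rfl (by omega) hby.le (h1.trans hco) h2 h3
        by_cases h2 : p b s = p y s
        · exact Or.inr fun m h3 h4 =>
            hi.eq_of_eq hxa.le (by omega) le_rfl (hco.trans h2) h3 h4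
        exfalso
        obtain ⟨a', ha1, ha2, ha3, ha4⟩ := exists_block_start (q := fun m => p m s) hxa.le h1
        obtain ⟨b', hb1, hb2, hb3, hb4⟩ := exists_block_end (q := fun m => p m s) hby.le h2
        have h6 : p a s = p a' s := ha4 a ha2 le_rfl
        refine hP s hts le_rfl a' b' ⟨ha1, by omega, hb2, fun m h3 h4 => ?_, ha3, hb3⟩
        rcases Nat.lt_or_ge m a with h5 | h5
        · exact ha4 m h3 h5.le
        rcases Nat.lt_or_ge m b with h7 | h7
        · exact (hblock m h5 h7.le).trans h6
        · exact ((hb4 m h7 h4).trans hco.symm).trans h6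
      filter_upwards [self_mem_nhdsWithin] with r hr
      rcases key with h | h
      · exact hp.block_left_end hx hy hs0 (le_of_lt hr) h
      · exact hp.block_right_end hx hy hs0 (le_of_lt hr) h
    have hall : ∀ᶠ r in 𝓝[>] s, ∀ a ∈ Finset.range n, ∀ b ∈ Finset.range n,
        ¬ InnerBlock (fun m => p m r) x y a b := by
      rw [Finset.eventually_all]
      intro a ha
      rw [Finset.eventually_all]
      exact hev a ha
    obtain ⟨u, hu, huI⟩ := mem_nhdsGT_iff_exists_Ioo_subset.1 hall
    refine ⟨u - s, sub_pos.2 hu, fun r h1 h2 a b hab => ?_⟩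
    have h3 := huI (show r ∈ Ioo s u from ⟨h1, by linarith⟩)
    have := hab.2.1
    have := hab.2.2.1
    exact h3 a (Finset.mem_range.2 (by omega)) b (Finset.mem_range.2 (by omega)) hab

/-- At a regular time, a chain in line stays in line. -/
theorem IsExecution.forever_of_reg (hτ0 : 0 < τ) (hτ : τ ≤ 1 / 2) (hp : IsExecution τ n p)
    {x y : ℕ} {t : ℝ} {v : ℕ → Plane} (hx : 1 ≤ x) (hxy : x ≤ y) (hy : y ≤ n) (ht : 0 ≤ t)
    (hr : Reg τ n (fun m => p m t) v) (hi : Inline (fun m => p m t) x y) : Forever p x y t := by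
  intro t' htt
  refine inline_of_straight (fun i h1 h2 => hp.straight i (by omega) (by omega) t t' ht htt
    (hi.isStraightAt h1 h2)) ?_ hxy
  exact hp.not_innerBlock hx hxy hy ht (fun i h1 h2 => hi.isStraightAt h1 h2)
    (fun a b => hr.not_innerBlock hτ0 hτ hx hy hi) htt

theorem exists_mem_Ioo_of_ae {P : ℝ → Prop} (h : ∀ᵐ t : ℝ, P t) {a b : ℝ} (hab : a < b) :
    ∃ t ∈ Ioo a b, P t := by
  by_contra hc
  push Not at hc
  have h1 : volume (Ioo a b) = 0 := measure_mono_null (fun t ht => hc t ht) h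
  rw [Real.volume_Ioo, ENNReal.ofReal_eq_zero] at h1
  linarith

theorem continuousWithinAt_chainLen (hp : IsExecution τ n p) {x y : ℕ} (hx : 1 ≤ x) (hy : y ≤ n)
    {t : ℝ} (ht : 0 ≤ t) :
    ContinuousWithinAt (fun r => chainLen (fun m => p m r) x y) (Ici 0) t := by
  unfold chainLen
  refine tendsto_finsetSum _ fun i hi => ?_
  rw [Finset.mem_Ico] at hi
  exact ((hp.continuousOn (by omega) (by omega)) t ht).dist
    ((hp.continuousOn (by omega) (by omega)) t ht)

/-- The times at which a chain is in line are closed. -/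
theorem inline_of_frequently (hp : IsExecution τ n p) {x y : ℕ} (hx : 1 ≤ x) (hxy : x ≤ y)
    (hy : y ≤ n) {t : ℝ} (ht : 0 ≤ t) {l : Filter ℝ} (hl : l ≤ 𝓝[Ici 0] t)
    (h : ∃ᶠ r in l, Inline (fun m => p m r) x y) : Inline (fun m => p m t) x y := by
  by_contra hc
  unfold Inline at hc
  push Not at hc
  have h1 := ((((hp.continuousOn (i := x) (by omega) (by omega)) t ht).dist
    ((hp.continuousOn (i := y) (by omega) (by omega)) t ht)).eventually_lt
      (continuousWithinAt_chainLen hp hx hy ht) hc)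
  exact h ((h1.filter_mono hl).mono fun r hr hi => absurd hi (not_le.2 hr))

/-- A chain that is in line at all times shortly after `t` stays in line from `t` on. -/
theorem IsExecution.forever_of_eventually (hn : 3 ≤ n) (hτ0 : 0 < τ) (hτ : τ ≤ 1 / 2)
    (hp : IsExecution τ n p) (hconn : IsConnectedChain n (fun i => p i 0)) {x y : ℕ} {t : ℝ}
    (hx : 1 ≤ x) (hxy : x ≤ y) (hy : y ≤ n) (ht : 0 ≤ t)
    (h : ∀ᶠ r in 𝓝[>] t, Inline (fun m => p m r) x y) : Forever p x y t := by
  obtain ⟨u, hu, huI⟩ := mem_nhdsGT_iff_exists_Ioo_subset.1 h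
  intro t' htt
  rcases htt.eq_or_lt with h1 | h1
  · subst h1
    exact inline_of_frequently hp hx hxy hy ht
      (nhdsWithin_mono _ fun s hs => ht.trans (le_of_lt hs)) h.frequently
  · obtain ⟨r, hr, hreg⟩ := exists_mem_Ioo_of_ae (hp.ae_reg hn hτ0 hτ hconn)
      (lt_min (show t < u from hu) h1)
    have hr0 : 0 < r := lt_of_le_of_lt ht hr.1
    obtain ⟨v, -, hR⟩ := hreg hr0
    exact hp.forever_of_reg hτ0 hτ hx hxy hy hr0.le hR
      (huI ⟨hr.1, hr.2.trans_le (min_le_left _ _)⟩) t' (hr.2.le.trans (min_le_right _ _))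

/-! ### Reversal of executions -/

theorem IsExecution.rev (hn : 3 ≤ n) (hp : IsExecution τ n p) :
    IsExecution τ n (fun i => p (n + 1 - i)) where
  lipschitz i h1 h2 := hp.lipschitz _ (by omega) (by omega)
  straight i h1 h2 s t hs hst h := by
    have := hp.straight (n + 1 - i) (by omega) (by omega) s t hs hst
      ((isStraightAt_rev (q := fun m => p m s) h1.le h2.le).1 h)
    exact (isStraightAt_rev (q := fun m => p m t) h1.le h2.le).2 this
  mid i h1 h2 s t hs hst h := by
    have e2 : n + 1 - (i - 1) = n + 1 - i + 1 := by omega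
    have e3 : n + 1 - (i + 1) = n + 1 - i - 1 := by omega
    simp only [IsMidAt, e2, e3] at h ⊢
    rw [midpoint_comm] at h ⊢
    exact hp.mid (n + 1 - i) (by omega) (by omega) s t hs hst h
  velocity := by
    filter_upwards [hp.velocity] with t ht
    obtain ⟨v, hv, ho⟩ := ht
    exact ⟨MaxMob.rev n v, fun i h1 h2 => hv _ (by omega) (by omega), ho.rev hn⟩

theorem IsConnectedChain.rev {q : ℕ → Plane} (h : IsConnectedChain n q) :
    IsConnectedChain n (fun i => q (n + 1 - i)) := by
  intro i h1 h2
  have := h (n - i) (by omega) (by omega)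
  simp only [show n + 1 - (i + 1) = n - i by omega, show n + 1 - i = n - i + 1 by omega]
  rwa [dist_comm]

theorem forever_rev {x y : ℕ} {t : ℝ} (hy : y ≤ n) :
    Forever (fun i => p (n + 1 - i)) x y t ↔ Forever p (n + 1 - y) (n + 1 - x) t :=
  forall_congr' fun t' => forall_congr' fun _ => inline_rev (q := fun m => p m t') hy

/-- Let `a` be the first robot of the coinciding block that contains `h` and `y`. The robots from
`a` to `y` remain equally spaced. Robot `a` coincides with its successor, so it is between its
neighbours and stays there, while it stays away from `a - 1` for a short time. Hence the equally
spaced part leaves `a` in the direction of the chain before it. If even `x` belongs to the block,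
the whole chain remains equally spaced. -/
theorem IsExecution.forever_join_right (hn : 3 ≤ n) (hτ0 : 0 < τ) (hτ : τ ≤ 1 / 2)
    (hp : IsExecution τ n p) (hconn : IsConnectedChain n (fun i => p i 0)) {x h y : ℕ} {t : ℝ}
    (hx : 1 ≤ x) (hxh : x ≤ h) (hhy : h ≤ y) (hy : y ≤ n) (ht : 0 ≤ t) (h1 : Forever p x h t)
    (h2 : Forever p h y t) (he : p h t = p y t) : Forever p x y t := by
  rcases hxh.eq_or_lt with rfl | hxh'
  · exact h2
  rcases hhy.eq_or_lt with rfl | hhy'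
  · exact h1
  have hmids : ∀ a, 1 ≤ a → (∀ m, a ≤ m → m ≤ y → p m t = p a t) → ∀ r, t ≤ r →
      Inline (fun m => p m r) a y ∨ y < a := by
    intro a ha hall r hr
    rcases Nat.lt_or_ge y a with h | h
    · exact Or.inr h
    refine Or.inl (inline_of_mid (fun m hm1 hm2 => hp.mid m (by omega) (by omega) t r ht hr
      (isMidAt_of_eq ?_ ?_)) h)
    · exact (hall (m - 1) (by omega) (by omega)).trans (hall m (by omega) (by omega)).symm
    · exact (hall (m + 1) (by omega) (by omega)).trans (hall m (by omega) (by omega)).symm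
  have hhy_eq : ∀ m, h ≤ m → m ≤ y → p m t = p h t := fun m h3 h4 =>
    (h2 t le_rfl).eq_of_eq le_rfl hhy le_rfl he h3 h4
  by_cases hxe : p x t = p h t
  · have hall : ∀ m, x ≤ m → m ≤ y → p m t = p x t := by
      intro m h3 h4
      rcases Nat.lt_or_ge m h with h5 | h5
      · exact (h1 t le_rfl).eq_of_eq le_rfl hxh le_rfl hxe h3 h5.le
      · exact (hhy_eq m h5 h4).trans hxe.symm
    exact fun r hr => (hmids x hx hall r hr).resolve_right (by omega)
  obtain ⟨a, ha1, ha2, ha3, ha4⟩ := exists_block_start (q := fun m => p m t) hxh hxe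
  have hha : p h t = p a t := ha4 h ha2 le_rfl
  have hall : ∀ m, a ≤ m → m ≤ y → p m t = p a t := by
    intro m h3 h4
    rcases Nat.lt_or_ge m h with h5 | h5
    · exact ha4 m h3 h5.le
    · exact (hhy_eq m h5 h4).trans hha
  refine hp.forever_of_eventually hn hτ0 hτ hconn hx (by omega) hy ht ?_
  have hne : ∀ᶠ r in 𝓝[>] t, p (a - 1) r - p a r ≠ 0 :=
    ((hp.tendsto_right (i := a - 1) (by omega) (by omega) ht).sub
      (hp.tendsto_right (i := a) (by omega) (by omega) ht)).eventually_ne (sub_ne_zero.2 ha3)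
  filter_upwards [hne, self_mem_nhdsWithin] with r hr htr
  have htr' : t ≤ r := le_of_lt htr
  have i1 : Inline (fun m => p m r) x a := (h1 r htr').sub le_rfl ha1.le ha2
  have i2 : Inline (fun m => p m r) a y := (hmids a (by omega) hall r htr').resolve_right (by omega)
  have hst : IsStraightAt (fun m => p m r) a := by
    refine hp.straight a (by omega) (by omega) t r ht htr' ?_
    have : p (a + 1) t = p a t := hall (a + 1) (by omega) (by omega)
    simp only [IsStraightAt, this]
    exact wbtw_self_right ℝ _ _
  have i3 := i1.extend ha1 hst (sub_ne_zero.1 hr)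
  -- If the first step after `a` is zero, so are all steps up to `y`; if not, it is the overlap
  -- needed for joining.
  by_cases hz : p a r = p (a + 1) r
  · refine i1.join_of_eq i2 ha1.le (by omega) (Or.inr ?_)
    have e := i2
    have hsteps : ∀ m, a < m → m < y → IsMidAt (fun m => p m r) m := fun m hm1 hm2 =>
      hp.mid m (by omega) (by omega) t r ht htr'
        (isMidAt_of_eq ((hall (m - 1) (by omega) (by omega)).trans
          (hall m (by omega) (by omega)).symm)
          ((hall (m + 1) (by omega) (by omega)).trans (hall m (by omega) (by omega)).symm))
    have key : ∀ m, a ≤ m → m ≤ y → p m r = p a r := by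
      intro m hm
      induction m, hm using Nat.le_induction with
      | base => exact fun _ => rfl
      | succ m hm ih =>
        intro hmy
        have h3 := step_eq_of_mid hsteps (m := m) hm (by omega)
        simp only [← hz, sub_self] at h3
        rw [sub_eq_zero.1 h3]
        exact ih (by omega)
    exact (key y (by omega) le_rfl).symm
  · exact i3.join i2 ha1.le (by omega) (by omega) hz

/-- If two adjacent parts stay in line and one of them is collapsed, then their union stays in
line. -/
theorem IsExecution.forever_join (hn : 3 ≤ n) (hτ0 : 0 < τ) (hτ : τ ≤ 1 / 2)
    (hp : IsExecution τ n p) (hconn : IsConnectedChain n (fun i => p i 0)) {x h y : ℕ} {t : ℝ}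
    (hx : 1 ≤ x) (hxh : x ≤ h) (hhy : h ≤ y) (hy : y ≤ n) (ht : 0 ≤ t) (h1 : Forever p x h t)
    (h2 : Forever p h y t) (he : p x t = p h t ∨ p h t = p y t) : Forever p x y t := by
  rcases he with he | he
  · have key := (hp.rev hn).forever_join_right hn hτ0 hτ hconn.rev (x := n + 1 - y)
      (h := n + 1 - h) (y := n + 1 - x) (t := t) (by omega) (by omega) (by omega) (by omega) ht
      ((forever_rev (by omega)).2 ?_) ((forever_rev (by omega)).2 ?_) ?_
    · have := (forever_rev (by omega)).1 key
      rwa [show n + 1 - (n + 1 - x) = x by omega, show n + 1 - (n + 1 - y) = y by omega] at this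
    · rwa [show n + 1 - (n + 1 - h) = h by omega, show n + 1 - (n + 1 - y) = y by omega]
    · rwa [show n + 1 - (n + 1 - h) = h by omega, show n + 1 - (n + 1 - x) = x by omega]
    · rw [show n + 1 - (n + 1 - h) = h by omega, show n + 1 - (n + 1 - x) = x by omega, he]
  · exact hp.forever_join_right hn hτ0 hτ hconn hx hxh hhy hy ht h1 h2 he

end MaxMob

end

/-! ### Velocities at the ends of parts in line, and tools for differentiation. -/

noncomputable section

namespace MaxMob

open Filter Topology

variable {τ : ℝ} {n : ℕ} {q v : ℕ → Plane}

/-! ### Completely stretched chains -/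

theorem inline_of_isFullRight {k : ℕ} (hkn : k ≤ n) (h : IsFullRight n q k) :
    Inline q k n ∧ dist (q k) (q n) = n - k := by
  have h1 : Inline q k n := by
    refine inline_of_straight (fun i h1 h2 => (h i h1.le h2).2 h1) (fun a b hab => ?_) hkn
    obtain ⟨h1, h2, h3, h4, -, -⟩ := hab
    have := (h a h1.le (by omega)).1
    rw [h4 (a + 1) (by omega) (by omega), dist_self] at this
    exact zero_ne_one this
  refine ⟨h1, ?_⟩
  rw [← h1.chainLen_eq hkn, chainLen, Finset.sum_congr rfl fun i hi => (h i (Finset.mem_Ico.1 hi).1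
    (Finset.mem_Ico.1 hi).2).1, Finset.sum_const, Nat.card_Ico, nsmul_eq_mul, mul_one,
    Nat.cast_sub hkn]

theorem inline_of_isFullLeft {k : ℕ} (hk : 1 ≤ k) (h : IsFullLeft q k) :
    Inline q 1 k ∧ dist (q 1) (q k) = k - 1 := by
  have := inline_of_isFullRight (n := k) (q := q) (k := 1) hk fun m h1 h2 => h m h1 h2
  simpa using this

theorem Inline.dist_le {x y : ℕ} (h : Inline q x y) (hxy : x ≤ y)
    (hs : ∀ m, x ≤ m → m < y → dist (q m) (q (m + 1)) ≤ 1) : dist (q x) (q y) ≤ y - x := by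
  rw [← h.chainLen_eq hxy, ← Nat.cast_sub hxy, ← Nat.card_Ico, ← nsmul_one]
  exact Finset.sum_le_card_nsmul _ _ _ fun i hi =>
    hs i (Finset.mem_Ico.1 hi).1 (Finset.mem_Ico.1 hi).2

theorem Inline.step_eq_of_dist_eq {x y : ℕ} (h : Inline q x y)
    (hs : ∀ m, x ≤ m → m < y → dist (q m) (q (m + 1)) ≤ 1) (hd : (y : ℝ) - x ≤ dist (q x) (q y))
    {m : ℕ} (hxm : x ≤ m) (hmy : m < y) : q (m + 1) - q m = dir (q x) (q y) := by
  have h1 := (h.sub le_rfl hxm hmy.le).dist_le hxm fun i h1 h2 => hs i h1 (by omega)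
  have h2 := (h.sub (a := m + 1) (by omega) hmy le_rfl).dist_le hmy
    fun i h1 h2 => hs i (by omega) h2
  have h3 := h.dist_add hxm hmy.le
  have h4 := (h.sub hxm hmy.le le_rfl).dist_add (Nat.le_succ m) hmy
  have h5 := hs m hxm hmy
  push_cast at h2
  rw [h.sub_eq hxm (Nat.le_succ m) hmy, show dist (q m) (q (m + 1)) = 1 by
    simp only [Nat.succ_eq_add_one] at h4; linarith, one_smul]

/-! ### The bend between two chains in line -/

/-- At a regular time, if `x, …, h` and `h, …, y` are in line but `x, …, y` is not, then the block
that contains `h` is a bend. -/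
theorem Reg.exists_bend (hτ0 : 0 < τ) (hτ : τ ≤ 1 / 2) (hr : Reg τ n q v) {x h y : ℕ} (hx : 1 ≤ x)
    (hxh : x ≤ h) (hhy : h ≤ y) (hy : y ≤ n) (h1 : Inline q x h) (h2 : Inline q h y)
    (hne : ¬ Inline q x y) :
    q x ≠ q h ∧ q h ≠ q y ∧ ∃ (a k : ℕ) (s c : ℝ) (u : Plane), x < a ∧ a ≤ h ∧ h ≤ k ∧ k < y ∧
      q a = q h ∧ q k = q h ∧ q (a - 1) ≠ q a ∧ v h = s • u ∧ IsBend n q a k ∧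
      BendData τ n q v a k s c u (dir (q x) (q h)) (dir (q h) (q y)) := by
  have n0 : q x ≠ q h := fun he => hne (h1.join_of_eq h2 hxh hhy (Or.inl he))
  have n1 : q h ≠ q y := fun he => hne (h1.join_of_eq h2 hxh hhy (Or.inr he))
  obtain ⟨a, hxa, hah, ha, hab⟩ := exists_block_start hxh n0
  obtain ⟨k, hhk, hky, hk, hkb⟩ := exists_block_end hhy n1
  have eah : q a = q h := (hab h hah le_rfl).symm
  have ekh : q k = q h := hkb k hhk le_rfl
  have hblock : ∀ m, a ≤ m → m ≤ k → q m = q a := by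
    intro m hm1 hm2
    rcases le_total m h with hm | hm
    · exact hab m hm1 hm
    · rw [hkb m hm hm2, eah]
  have hk' : q (k + 1) ≠ q a := by rw [eah, ← ekh]; exact hk.symm
  refine ⟨n0, n1, a, k, ?_⟩
  have hbend : IsBend n q a k := by
    refine (isBend_or_wbtw (by omega) (by omega) (by omega) hblock ha hk').resolve_right ?_
    -- Without a bend, the block and its two neighbours would be in line and glue both chains
    -- together.
    intro hw
    have hin : Inline q (a - 1) (k + 1) := by
      have e1 : Inline q (a - 1) a := by
        have := inline_succ (q := q) (a - 1)
        rwa [Nat.sub_add_cancel (by omega)] at this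
      have e2 : Inline q a k := (h1.sub hxa.le hah le_rfl).join_of_eq (h2.sub le_rfl hhk hky.le)
        hah hhk (Or.inl eah)
      have e3 : Inline q (a - 1) k :=
        e1.join_of_eq e2 (by omega) (by omega) (Or.inr (eah.trans ekh.symm))
      unfold Inline
      rw [← chainLen_add (b := k) (by omega) (by omega), e3.chainLen_eq (by omega), chainLen_succ]
      have := dist_add_dist_eq_iff.2 hw
      rw [ekh, ← eah]
      exact this.le
    have e4 : Inline q x (k + 1) := h1.join hin (by omega) (by omega) (by omega) (by rwa [← eah])
    exact hne (e4.join h2 (by omega) (by omega) (by omega) (by rw [← eah]; exact hk'.symm))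
  obtain ⟨s, c, u, hB⟩ := (hr.obeys.2.2.1 a k hbend).bendData hτ0 hτ hbend
  rw [h1.dir_eq (by omega) (by omega) (by omega) ha, h2.dir_eq (by omega) (by omega) (by omega) hk]
    at hB
  exact ⟨s, c, u, hxa, hah, hhk, hky, eah, ekh, ha, hB.vel h hah hhk, hbend, hB⟩

/-- The velocity of the first robot if the chain is in line up to a bend. -/
theorem Reg.first_velocity (hn : 3 ≤ n) (hτ0 : 0 < τ) (hτ : τ ≤ 1 / 2) (hr : Reg τ n q v)
    {h a k : ℕ} {s c : ℝ} {u e₁ : Plane} (h1 : Inline q 1 h) (h1a : 1 < a) (hah : a ≤ h)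
    (hhk : h ≤ k) (hkn : k < n) (hne : q 1 ≠ q h) (eah : q a = q h) (hne' : q (a - 1) ≠ q a)
    (hvh : v h = s • u)
    (hb : IsBend n q a k) (hB : BendData τ n q v a k s c u (dir (q 1) (q h)) e₁) :
    ∃ x : ℝ, 0 ≤ x ∧ x ≤ 1 - τ ∧ v 1 = -x • dir (q 1) (q h) ∧ (IsFullLeft q a → x = c) ∧
      (x = 1 - τ ∨ IsFullLeft q a ∨ IsFullRight n q k ∧ c ≤ x) := by
  obtain ⟨x, hx0, hx1, hv1, hx⟩ := hr.outer_cases hτ0 hτ (by omega) (by omega) h1 hne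
  refine ⟨x, hx0, hx1, hv1, ?_, ?_⟩
  · intro hf
    have hs := hB.full_left hf
    obtain ⟨hi, hd⟩ := inline_of_isFullLeft h1a.le hf
    have hrun : ∀ m, 1 ≤ m → m < a → q (m + 1) - q m = dir (q 1) (q h) := by
      intro m hm1 hm2
      rw [← eah]
      exact hi.step_eq_of_dist_eq (fun m h3 h4 => hr.short m h3 (by omega))
        (by rw [hd, Nat.cast_one]) hm1 hm2
    have := run_inner_eq hr hB.norm_e₀ le_rfl h1a.le (by omega) hrun
    rw [hB.vel a le_rfl (by omega), hs, one_smul, hB.inner_u_e₀, hv1, real_inner_smul_left,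
      real_inner_self_eq_norm_sq, hB.norm_e₀] at this
    linarith
  · rcases hx with h2 | ⟨b, hb1, hb2, hb3, hb4⟩ | ⟨l, hl0, hl1, hl⟩
    · exact Or.inl h2
    · right; left
      have hab : a ≤ b := by
        by_contra hc
        push Not at hc
        have := h1.eq_of_eq (a := b) (b := h) (by omega) (by omega) le_rfl hb3 (m := a - 1)
          (by omega) (by omega)
        exact hne' (this.trans (hb3.trans eah.symm))
      exact isFullLeft_of_run hB.norm_e₀ fun m h3 h4 => hb4 m h3 (by omega)
    -- The equation reads `x ^ 2 + l ^ 2 * s ^ 2 * (1 - c ^ 2) = 1`, hence `c ≤ x`. A bend at rest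
    -- would give `x = 1`, which is too fast, and `1 - τ ≤ c` gives `x = 1 - τ`; only the stretched
    -- cases remain.
    · rw [hvh, norm_smul, Real.norm_of_nonneg hB.s_nonneg, hB.norm_u, real_inner_smul_left,
        hB.inner_u_e₀] at hl
      have hc0 := hB.c_pos
      have hc1 := hB.c_le
      have hs0 := hB.s_nonneg
      have hs1 := hB.s_le
      have hl2 : l ^ 2 < 1 := by nlinarith
      have hs2 : s ^ 2 ≤ 1 := by nlinarith
      have hc2 : 0 ≤ 1 - c ^ 2 := by nlinarith
      have hls : l ^ 2 * s ^ 2 ≤ 1 := by nlinarith [sq_nonneg l, sq_nonneg s]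
      have hx2 : c ^ 2 ≤ x ^ 2 := by
        nlinarith [mul_le_mul_of_nonneg_right hls hc2]
      have hcx : c ≤ x := abs_le_of_sq_le_sq' hx2 hx0 |>.2
      rcases hr.bend_cases hn hτ0 hτ hb hB with h3 | h3 | h3 | h3
      · exfalso
        rw [h3] at hl
        nlinarith
      · exact Or.inl (by linarith)
      · exact Or.inr (Or.inl h3)
      · exact Or.inr (Or.inr ⟨h3, hcx⟩)

/-- The velocity of the last robot if the chain is in line from a bend on. -/
theorem Reg.last_velocity (hn : 3 ≤ n) (hτ0 : 0 < τ) (hτ : τ ≤ 1 / 2) (hr : Reg τ n q v)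
    {h a k : ℕ} {s c : ℝ} {u e₀ : Plane} (h1 : Inline q h n) (h1a : 1 < a) (hah : a ≤ h)
    (hhk : h ≤ k) (hkn : k < n) (hne : q h ≠ q n) (ekh : q k = q h) (hne' : q k ≠ q (k + 1))
    (hvh : v h = s • u)
    (hb : IsBend n q a k) (hB : BendData τ n q v a k s c u e₀ (dir (q h) (q n))) :
    ∃ x : ℝ, 0 ≤ x ∧ x ≤ 1 - τ ∧ v n = x • dir (q h) (q n) ∧ (IsFullRight n q k → x = c) ∧
      (x = 1 - τ ∨ IsFullRight n q k ∨ IsFullLeft q a ∧ c ≤ x) := by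
  have e1 : ∀ f : ℕ → Plane, MaxMob.rev n f 1 = f n := fun f => rev_eq (by omega)
  have e2 : ∀ f : ℕ → Plane, MaxMob.rev n f (n + 1 - h) = f h := fun f => rev_eq (by omega)
  have e3 : ∀ f : ℕ → Plane, MaxMob.rev n f (n + 1 - k) = f k := fun f => rev_eq (by omega)
  have h1' : Inline q (n + 1 - (n + 1 - h)) (n + 1 - 1) := by
    rwa [show n + 1 - (n + 1 - h) = h by omega, show n + 1 - 1 = n by omega]
  have hB' := hB.rev hb
  have e4 : -dir (q h) (q n) = dir (MaxMob.rev n q 1) (MaxMob.rev n q (n + 1 - h)) := by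
    rw [e1, e2, dir_swap (q h)]
  rw [e4] at hB'
  obtain ⟨x, hx0, hx1, hv, hx2, hx3⟩ := (hr.rev hn).first_velocity hn hτ0 hτ (h := n + 1 - h)
    ((inline_rev (by omega)).2 h1') (by omega) (by omega) (by omega) (by omega)
    (by rw [e1, e2]; exact hne.symm) (by rw [e2, e3]; exact ekh)
    (by rw [e3, rev_eq (j := k + 1) (by omega)]; exact hne'.symm) (by rw [e2]; exact hvh) hb.rev hB'
  · have fL : IsFullLeft (MaxMob.rev n q) (n + 1 - k) ↔ IsFullRight n q k := by
      constructor
      · intro hf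
        have := isFullRight_of_rev (by omega) (by omega) hf
        rwa [show n + 1 - (n + 1 - k) = k by omega] at this
      · intro hf
        refine isFullLeft_of_rev (q := MaxMob.rev n q) (by omega) (by omega) fun m h1 h2 => ?_
        have := hf m h1 h2
        have hm : ∀ i, 1 ≤ i → i ≤ n → MaxMob.rev n (MaxMob.rev n q) i = q i := fun i hi1 hi2 => by
          rw [rev_eq (j := n + 1 - i) rfl, rev_eq (j := i) (by omega)]
        unfold IsStraightAt at this ⊢
        rwa [hm m (by omega) (by omega), hm (m + 1) (by omega) (by omega),
          hm (m - 1) (by omega) (by omega)]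
    have fR : IsFullRight n (MaxMob.rev n q) (n + 1 - a) → IsFullLeft q a := by
      intro hf
      have := isFullLeft_of_rev (by omega) (by omega) hf
      rwa [show n + 1 - (n + 1 - a) = a by omega] at this
    rw [← e4, e1, smul_neg, neg_smul, neg_neg] at hv
    exact ⟨x, hx0, hx1, hv, fun hf => hx2 (fL.2 hf), hx3.imp_right (Or.imp fL.1 (And.imp_left fR))⟩

/-! ### Derivatives -/

variable {p : ℕ → ℝ → Plane} {t : ℝ}

theorem hasDerivAt_dist {x y : ℝ → Plane} {x' y' : Plane} (hx : HasDerivAt x x' t)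
    (hy : HasDerivAt y y' t) (hne : x t ≠ y t) :
    HasDerivAt (fun r => dist (x r) (y r)) ⟪dir (x t) (y t), y' - x'⟫ t := by
  simp only [dist_eq_norm']
  have := hasDerivAt_norm (hy.sub hx) fun h => absurd (sub_eq_zero.1 h).symm hne
  refine this.congr_deriv ?_
  rw [MaxMob.dir, real_inner_smul_left, Pi.sub_apply]

theorem hasDerivAt_dir {x y : ℝ → Plane} {x' y' : Plane} (hx : HasDerivAt x x' t)
    (hy : HasDerivAt y y' t) (hne : x t ≠ y t) :
    HasDerivAt (fun r => dir (x r) (y r)) ((dist (x t) (y t))⁻¹ •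
      ((y' - x') - ⟪dir (x t) (y t), y' - x'⟫ • dir (x t) (y t))) t := by
  have h0 : dist (x t) (y t) ≠ 0 := dist_ne_zero.2 hne
  have h1 := ((hasDerivAt_dist hx hy hne).inv h0).smul (hy.sub hx)
  have e : (fun r => dir (x r) (y r)) = fun r => (dist (x r) (y r))⁻¹ • (y r - x r) := by
    funext r
    rw [dir, dist_eq_norm']
  rw [e]
  refine h1.congr_deriv ?_
  have e2 : y t - x t = dist (x t) (y t) • dir (x t) (y t) := (dist_smul_dir _ _).symm
  rw [Pi.sub_apply, Pi.inv_apply, e2, smul_smul, smul_sub (_ : ℝ) (y' - x'), smul_smul]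
  rw [show -⟪dir (x t) (y t), y' - x'⟫ / dist (x t) (y t) ^ 2 * dist (x t) (y t)
    = -((dist (x t) (y t))⁻¹ * ⟪dir (x t) (y t), y' - x'⟫) by field_simp, neg_smul, ← sub_eq_add_neg]

theorem LipOn.dist {x y : ℝ → Plane} {a b : ℝ} (hx : LipOn a b x) (hy : LipOn a b y) :
    LipOn a b fun t => Dist.dist (x t) (y t) := by
  simp only [dist_eq_norm]
  exact (hx.sub hy).norm

theorem LipOn.dir {x y : ℝ → Plane} {a b : ℝ} (hx : LipOn a b x) (hy : LipOn a b y)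
    (hne : ∀ t ∈ Icc a b, x t ≠ y t) : LipOn a b fun t => MaxMob.dir (x t) (y t) := by
  unfold MaxMob.dir
  exact ((hy.sub hx).norm.inv fun t ht => norm_pos_iff.2 (sub_ne_zero.2 (hne t ht).symm)).smul
    (hy.sub hx)

/-- Half of the norm of a vector `f` with direction `u`. -/
theorem hasDerivAt_half_norm {f : ℝ → Plane} {d u : Plane} {c : ℝ} (hc : 0 < c) (hu : ‖u‖ = 1)
    (hf : HasDerivAt f d t) (he : f t = (2 * c) • u) :
    HasDerivAt (fun r => 1 / 2 * ‖f r‖) (1 / 2 * ⟪u, d⟫) t := by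
  have hn : ‖f t‖ = 2 * c := by rw [he, norm_smul, hu, Real.norm_of_nonneg (by linarith), mul_one]
  have h0 : f t = 0 → d = 0 := fun h => by rw [h, norm_zero] at hn; linarith
  refine ((hasDerivAt_norm hf h0).const_mul (1 / 2)).congr_deriv ?_
  rw [hn, he, real_inner_smul_left]
  field_simp

/-! ### First times -/

theorem first_time {S : ℝ → Prop} {a b : ℝ} (hcl : ∀ t, a ≤ t → (∀ r, t < r → S r) → S t)
    (hmono : ∀ s t, s ≤ t → S s → S t) (hb : S b) (hab : a ≤ b) :
    ∃ c, a ≤ c ∧ c ≤ b ∧ S c ∧ ∀ t, a ≤ t → t < c → ¬ S t := by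
  set A : Set ℝ := {t | a ≤ t ∧ S t} with hA
  have hbA : b ∈ A := ⟨hab, hb⟩
  have hbdd : BddBelow A := ⟨a, fun t ht => ht.1⟩
  have hac : a ≤ sInf A := le_csInf ⟨b, hbA⟩ fun t ht => ht.1
  refine ⟨sInf A, hac, csInf_le hbdd hbA, hcl _ hac fun r hr => ?_, fun t hat ht hS =>
    not_lt.2 (csInf_le hbdd ⟨hat, hS⟩) ht⟩
  obtain ⟨s, hs, hsr⟩ := exists_lt_of_csInf_lt ⟨b, hbA⟩ hr
  exact hmono s r hsr.le hs.2

theorem IsExecution.forever_of_forall_gt (hp : IsExecution τ n p) {x y : ℕ} (hx : 1 ≤ x)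
    (hxy : x ≤ y) (hy : y ≤ n) (ht : 0 ≤ t) (h : ∀ r, t < r → Forever p x y r) :
    Forever p x y t := by
  intro t' htt
  rcases htt.eq_or_lt with rfl | h1
  · refine inline_of_frequently hp hx hxy hy ht (l := 𝓝[>] t)
      (nhdsWithin_mono _ fun s hs => ht.trans (le_of_lt hs)) (Eventually.frequently ?_)
    exact eventually_nhdsWithin_of_forall fun r hr => h r hr r le_rfl
  · exact h t' h1 t' le_rfl

end MaxMob

end

noncomputable section

namespace MaxMob

open Filter Topology

/-! ### A chain in line -/

section Straight

variable {τ : ℝ} {n : ℕ} {q v : ℕ → Plane}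

/-- When the last robot moves along the line there is no sideways motion, so robot `1` being pushed
would mean `x ^ 2 = 1`. The stretched case contradicts a length below `n - 1`. -/
theorem Reg.first_speed_of_parallel (hn : 3 ≤ n) (hτ0 : 0 < τ) (hτ : τ ≤ 1 / 2) (hr : Reg τ n q v)
    (hi : Inline q 1 n) (hne : q 1 ≠ q n) {x' : ℝ} (hvn : v n = x' • dir (q 1) (q n)) :
    ∃ x, 0 ≤ x ∧ v 1 = -x • dir (q 1) (q n) ∧ (dist (q 1) (q n) < n - 1 → x = 1 - τ) := by
  have he : ‖dir (q 1) (q n)‖ = 1 := norm_dir hne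
  obtain ⟨x, hx0, hx1, hv, hc⟩ := hr.outer_cases hτ0 hτ (by omega) le_rfl hi hne
  refine ⟨x, hx0, hv, fun hd => ?_⟩
  rcases hc with hc | ⟨a, ha1, han, hqa, hrun⟩ | ⟨l, hl0, hl1, hl⟩
  · exact hc
  · exfalso
    have hae : a = n := by
      by_contra hc
      refine hr.last_ne hn hτ0 hτ le_rfl (by omega) hne ?_
      exact (hi.eq_of_eq (a := a) (b := n) (by omega) (by omega) le_rfl hqa (by omega)
        (by omega)).trans hqa
    subst hae
    have h1 := (inline_of_isFullLeft (by omega) (isFullLeft_of_run he hrun)).2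
    linarith
  · exfalso
    rw [hvn, norm_smul, he, real_inner_smul_left, real_inner_self_eq_norm_sq, he,
      Real.norm_eq_abs] at hl
    have h2 : (|x'| * 1) ^ 2 - (x' * 1 ^ 2) ^ 2 = 0 := by rw [mul_one, sq_abs]; ring
    rw [h2] at hl
    nlinarith

theorem Reg.end_velocities (hn : 3 ≤ n) (hτ0 : 0 < τ) (hτ : τ ≤ 1 / 2) (hr : Reg τ n q v)
    (hi : Inline q 1 n) (hne : q 1 ≠ q n) :
    ∃ x x' : ℝ, 0 ≤ x ∧ 0 ≤ x' ∧ v 1 = -x • dir (q 1) (q n) ∧ v n = x' • dir (q 1) (q n) ∧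
      (dist (q 1) (q n) < n - 1 → x = 1 - τ ∧ x' = 1 - τ) := by
  -- Each end needs the other to move along the line. That robot `1` does so is known before its
  -- speed is, so the speed of robot `n` is found first and then that of robot `1`.
  obtain ⟨x0, -, -, hv0, -⟩ := hr.outer_cases hτ0 hτ (by omega) le_rfl hi hne
  have e1 : ∀ f : ℕ → Plane, MaxMob.rev n f 1 = f n := fun f => rev_eq (by omega)
  have e2 : ∀ f : ℕ → Plane, MaxMob.rev n f n = f 1 := fun f => rev_eq (by omega)
  obtain ⟨x', hx', hv', hd'⟩ := (hr.rev hn).first_speed_of_parallel hn hτ0 hτ (x' := x0)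
    ((inline_rev le_rfl).2 (by rwa [show n + 1 - n = 1 by omega, Nat.add_sub_cancel]))
    (by rw [e1, e2]; exact hne.symm)
    (by rw [e1, e2, e2, dir_swap (q 1), hv0, neg_smul, smul_neg])
  rw [e1, e1, e2, dir_swap, smul_neg, neg_smul, neg_neg] at hv'
  rw [e1, e2, dist_comm] at hd'
  obtain ⟨x, hx, hv, hd⟩ := hr.first_speed_of_parallel hn hτ0 hτ hi hne hv'
  exact ⟨x, x', hx, hx', hv, hv', fun h => ⟨hd h, hd' h⟩⟩

/-- Along a run of unit vectors both ends have the same component in its direction, yet neither end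
moves inwards; so both are at rest. -/
theorem Reg.ends_at_rest (hn : 3 ≤ n) (hτ0 : 0 < τ) (hτ : τ ≤ 1 / 2) (hr : Reg τ n q v)
    (hi : Inline q 1 n) (hd : (n : ℝ) - 1 ≤ dist (q 1) (q n)) : v 1 = 0 ∧ v n = 0 := by
  have hn' : (3 : ℝ) ≤ n := by exact_mod_cast hn
  have hne : q 1 ≠ q n := by
    intro h
    rw [h, dist_self] at hd
    linarith
  have he : ‖dir (q 1) (q n)‖ = 1 := norm_dir hne
  obtain ⟨x, x', hx, hx', hv, hv', -⟩ := hr.end_velocities hn hτ0 hτ hi hne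
  have h1 := run_inner_eq hr he le_rfl (by omega) le_rfl fun m h1 h2 =>
    hi.step_eq_of_dist_eq (fun m h1 h2 => hr.short m h1 h2) (by simpa using hd) h1 h2
  rw [hv, hv', real_inner_smul_left, real_inner_smul_left, real_inner_self_eq_norm_sq, he] at h1
  have hx0 : x = 0 := by linarith
  have hx0' : x' = 0 := by linarith
  rw [hv, hv', hx0, hx0', neg_zero, zero_smul]
  exact ⟨rfl, rfl⟩

end Straight

variable {τ : ℝ} {n : ℕ} {p : ℕ → ℝ → Plane}

theorem IsExecution.dist_le_of_inline (hn : 3 ≤ n) (hτ0 : 0 < τ) (hτ : τ ≤ 1 / 2)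
    (hp : IsExecution τ n p) (hconn : IsConnectedChain n (fun i => p i 0)) {x y : ℕ} {t : ℝ}
    (ht : 0 ≤ t) (hx : 1 ≤ x) (hxy : x ≤ y) (hy : y ≤ n) (hi : Inline (fun m => p m t) x y) :
    dist (p x t) (p y t) ≤ y - x :=
  hi.dist_le hxy fun m h1 h2 => hp.dist_le_one hn hτ0 hτ hconn ht (by omega) (by omega)

/-- A chain in line collapses or has maximal length after time `(n - 1) / (2 (1 - τ))`. -/
theorem IsExecution.exists_collapsed_or_full (hn : 3 ≤ n) (hτ0 : 0 < τ) (hτ : τ ≤ 1 / 2)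
    (hp : IsExecution τ n p) (hconn : IsConnectedChain n (fun i => p i 0)) {t₀ : ℝ} (ht₀ : 0 ≤ t₀)
    (hF : Forever p 1 n t₀) :
    ∃ t, t₀ ≤ t ∧ t ≤ t₀ + (n - 1) / (2 * (1 - τ)) ∧
      (p 1 t = p n t ∨ (n : ℝ) - 1 ≤ dist (p 1 t) (p n t)) := by
  have hn' : (3 : ℝ) ≤ n := by exact_mod_cast hn
  by_contra hc
  push Not at hc
  set T := t₀ + (n - 1) / (2 * (1 - τ)) with hT
  have hT0 : t₀ ≤ T := le_add_of_nonneg_right (div_nonneg (by linarith) (by linarith))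
  have hlip : LipOn t₀ T fun t => -dist (p 1 t) (p n t) :=
    ((hp.lipOn le_rfl (by omega) ht₀).dist (hp.lipOn (by omega) le_rfl ht₀)).neg
  have key := hlip.le_add_mul hT0 (m := -(2 * (1 - τ))) ?_
  · have h1 : 2 * (1 - τ) * (T - t₀) = n - 1 := by
      rw [hT, add_sub_cancel_left, mul_div_cancel₀]
      have : 0 < 1 - τ := by linarith
      positivity
    have h2 := (hc T hT0 le_rfl).2
    have h3 : 0 ≤ dist (p 1 t₀) (p n t₀) := dist_nonneg
    linarith
  · filter_upwards [hp.ae_reg hn hτ0 hτ hconn] with t ht hmem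
    obtain ⟨v, hv, hr⟩ := ht (lt_of_le_of_lt ht₀ hmem.1)
    obtain ⟨h1, h2⟩ := hc t hmem.1.le hmem.2.le
    obtain ⟨x, x', hx, hx', hv1, hvn, hd⟩ := hr.end_velocities hn hτ0 hτ (hF t hmem.1.le) h1
    obtain ⟨rfl, rfl⟩ := hd h2
    have he : ‖dir (p 1 t) (p n t)‖ = 1 := norm_dir h1
    refine ⟨_, ?_, (hasDerivAt_dist (hv 1 le_rfl (by omega)) (hv n (by omega) le_rfl) h1).neg⟩
    rw [hv1, hvn, inner_sub_right, real_inner_smul_right, real_inner_smul_right,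
      real_inner_self_eq_norm_sq, he]
    linarith

/-- A straight chain of maximal length stays at rest. -/
theorem IsExecution.isMaxChain_of_full (hn : 3 ≤ n) (hτ0 : 0 < τ) (hτ : τ ≤ 1 / 2)
    (hp : IsExecution τ n p) (hconn : IsConnectedChain n (fun i => p i 0)) {t₀ : ℝ} (ht₀ : 0 ≤ t₀)
    (hF : Forever p 1 n t₀) (hd : (n : ℝ) - 1 ≤ dist (p 1 t₀) (p n t₀)) :
    IsMaxChain n (fun i => p i t₀) ∧ ∀ t, t₀ ≤ t → ∀ i, 1 ≤ i → i ≤ n → p i t = p i t₀ := by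
  have hn' : (3 : ℝ) ≤ n := by exact_mod_cast hn
  have hfull : ∀ t, t₀ ≤ t → (n : ℝ) - 1 ≤ dist (p 1 t) (p n t) := by
    intro t htt
    have hlip : LipOn t₀ t fun t => -dist (p 1 t) (p n t) :=
      ((hp.lipOn le_rfl (by omega) ht₀).dist (hp.lipOn (by omega) le_rfl ht₀)).neg
    have key := hlip.le_add_mul htt (m := 0) ?_
    · linarith
    filter_upwards [hp.ae_reg hn hτ0 hτ hconn] with r ht hmem
    obtain ⟨v, hv, hr⟩ := ht (lt_of_le_of_lt ht₀ hmem.1)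
    by_cases h1 : p 1 r = p n r
    · have h2 := hr.coin 1 n le_rfl (by omega) (by omega) le_rfl h1
      have h3 : HasDerivAt (fun r => dist (p 1 r) (p n r)) 0 r := by
        simp only [dist_eq_norm]
        have := hasDerivAt_norm ((hv 1 le_rfl (by omega)).sub (hv n (by omega) le_rfl))
          fun _ => sub_eq_zero.2 h2
        rwa [h2, sub_self, inner_zero_right, mul_zero] at this
      exact ⟨-0, by simp, h3.neg⟩
    · obtain ⟨x, x', hx, hx', hv1, hvn, -⟩ := hr.end_velocities hn hτ0 hτ (hF r hmem.1.le) h1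
      have he : ‖dir (p 1 r) (p n r)‖ = 1 := norm_dir h1
      refine ⟨_, ?_, (hasDerivAt_dist (hv 1 le_rfl (by omega)) (hv n (by omega) le_rfl) h1).neg⟩
      rw [hv1, hvn, inner_sub_right, real_inner_smul_right, real_inner_smul_right,
        real_inner_self_eq_norm_sq, he]
      linarith
  have hstep : ∀ t, t₀ ≤ t → ∀ m, 1 ≤ m → m < n → p (m + 1) t - p m t = dir (p 1 t) (p n t) :=
    fun t htt m h1 h2 => (hF t htt).step_eq_of_dist_eq
      (fun m h1 h2 => hp.dist_le_one hn hτ0 hτ hconn (ht₀.trans htt) h1 h2)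
      (by simpa using hfull t htt) h1 h2
  have hnorm : ∀ t, t₀ ≤ t → ‖dir (p 1 t) (p n t)‖ = 1 := by
    intro t htt
    refine norm_dir fun h => ?_
    have := hfull t htt
    rw [h, dist_self] at this
    linarith
  have hrest : ∀ i, i = 1 ∨ i = n → ∀ t, t₀ ≤ t → p i t = p i t₀ := by
    intro i hi t htt
    have hi1 : 1 ≤ i := by omega
    have hin : i ≤ n := by omega
    -- Testing the position against its own displacement reduces constancy of a curve to the scalar
    -- growth bound.
    have hlip : LipOn t₀ t fun r => ⟪p i t - p i t₀, p i r⟫ :=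
      (LipOn.const _).inner (hp.lipOn hi1 hin ht₀)
    have key := hlip.le_add_mul htt (m := 0) ?_
    · rw [zero_mul, add_zero, ← sub_nonpos, ← inner_sub_right, real_inner_self_eq_norm_sq] at key
      have h2 : ‖p i t - p i t₀‖ = 0 := by
        have := norm_nonneg (p i t - p i t₀)
        nlinarith
      exact sub_eq_zero.1 (norm_eq_zero.1 h2)
    filter_upwards [hp.ae_reg hn hτ0 hτ hconn] with r ht hmem
    obtain ⟨v, hv, hr⟩ := ht (lt_of_le_of_lt ht₀ hmem.1)
    obtain ⟨h1, h2⟩ := hr.ends_at_rest hn hτ0 hτ (hF r hmem.1.le) (hfull r hmem.1.le)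
    have h3 : v i = 0 := by rcases hi with rfl | rfl <;> assumption
    have h4 := (hasDerivAt_const r (p i t - p i t₀)).inner ℝ (hv i hi1 hin)
    rw [h3] at h4
    exact ⟨_, by simp, h4⟩
  refine ⟨⟨fun i h1 h2 => ?_, fun i h1 h2 => ?_⟩, fun t htt i h1 h2 => ?_⟩
  · rw [dist_eq_norm', hstep t₀ le_rfl i h1 h2, hnorm t₀ le_rfl]
  · have := hstep t₀ le_rfl (i - 1) (by omega) (by omega)
    rw [Nat.sub_add_cancel (by omega)] at this
    exact (hstep t₀ le_rfl i (by omega) h2).trans this.symm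
  · induction i, h1 using Nat.le_induction with
    | base => exact hrest 1 (Or.inl rfl) t htt
    | succ i h1 ih =>
      have e1 := hstep t htt i h1 h2
      have e2 := hstep t₀ le_rfl i h1 h2
      rw [hrest 1 (Or.inl rfl) t htt, hrest n (Or.inr rfl) t htt, ← e2, ih (by omega)] at e1
      exact sub_left_injective e1

/-- The end of an execution after the chain is in line. -/
theorem IsExecution.finish (hn : 3 ≤ n) (hτ0 : 0 < τ) (hτ : τ ≤ 1 / 2)
    (hp : IsExecution τ n p) (hconn : IsConnectedChain n (fun i => p i 0)) {t₀ : ℝ} (ht₀ : 0 ≤ t₀)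
    (hF : Forever p 1 n t₀) :
    ∃ t, t₀ ≤ t ∧ t ≤ t₀ + (n - 1) / (2 * (1 - τ)) ∧
      ((IsMaxChain n (fun i => p i t) ∧ ∀ t', t ≤ t' → ∀ i, 1 ≤ i → i ≤ n → p i t' = p i t) ∨
        IsCollapsed n (fun i => p i t)) := by
  obtain ⟨t, h1, h2, h3⟩ := hp.exists_collapsed_or_full hn hτ0 hτ hconn ht₀ hF
  refine ⟨t, h1, h2, ?_⟩
  rcases h3 with h3 | h3
  · right
    intro i hi1 hin
    exact (hF t h1).eq_of_eq le_rfl (by omega) le_rfl h3 hi1 hin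
  · left
    exact hp.isMaxChain_of_full hn hτ0 hτ hconn (ht₀.trans h1) (hF.mono h1) h3

end MaxMob

end

/-! ### Straightening a single bend. -/

noncomputable section

namespace MaxMob

open Filter Topology

variable {τ : ℝ} {n : ℕ} {p : ℕ → ℝ → Plane}

/-- The cosine of half of the angle at robot `j` between the directions to the robots `i` and `k`. -/
def halfCos (p : ℕ → ℝ → Plane) (i j k : ℕ) (t : ℝ) : ℝ :=
  1 / 2 * ‖dir (p j t) (p k t) - dir (p i t) (p j t)‖

theorem halfCos_nonneg (i j k : ℕ) (t : ℝ) : 0 ≤ halfCos p i j k t := by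
  unfold halfCos
  positivity

theorem norm_dir_le (x y : Plane) : ‖dir x y‖ ≤ 1 := by
  rcases eq_or_ne x y with rfl | h
  · simp [dir]
  · exact (norm_dir h).le

theorem halfCos_le_one (i j k : ℕ) (t : ℝ) : halfCos p i j k t ≤ 1 := by
  unfold halfCos
  have := norm_sub_le (dir (p j t) (p k t)) (dir (p i t) (p j t))
  have := norm_dir_le (p j t) (p k t)
  have := norm_dir_le (p i t) (p j t)
  linarith

theorem halfCos_eq {i j k : ℕ} {t c : ℝ} {u : Plane} (hc : 0 < c) (hu : ‖u‖ = 1)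
    (h : dir (p j t) (p k t) - dir (p i t) (p j t) = (2 * c) • u) : halfCos p i j k t = c := by
  rw [halfCos, h, norm_smul, hu, Real.norm_of_nonneg (by linarith)]
  ring

theorem hasDerivAt_halfCos {i j k : ℕ} {t c : ℝ} {u vi vj vk : Plane} (hc : 0 < c) (hu : ‖u‖ = 1)
    (h : dir (p j t) (p k t) - dir (p i t) (p j t) = (2 * c) • u) (hi : HasDerivAt (p i) vi t)
    (hj : HasDerivAt (p j) vj t) (hk : HasDerivAt (p k) vk t) (hij : p i t ≠ p j t)
    (hjk : p j t ≠ p k t) :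
    HasDerivAt (halfCos p i j k) (1 / 2 * ((dist (p j t) (p k t))⁻¹ * (⟪u, vk - vj⟫
      - ⟪dir (p j t) (p k t), vk - vj⟫ * ⟪u, dir (p j t) (p k t)⟫) - (dist (p i t) (p j t))⁻¹ *
      (⟪u, vj - vi⟫ - ⟪dir (p i t) (p j t), vj - vi⟫ * ⟪u, dir (p i t) (p j t)⟫))) t := by
  refine (hasDerivAt_half_norm hc hu
    ((hasDerivAt_dir hj hk hjk).sub (hasDerivAt_dir hi hj hij)) h).congr_deriv ?_
  rw [inner_sub_right u (_ • _) (_ • _), real_inner_smul_right, real_inner_smul_right,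
    inner_sub_right u (vk - vj), inner_sub_right u (vj - vi), real_inner_smul_right u,
    real_inner_smul_right u]

theorem IsExecution.lipOn_halfCos (hp : IsExecution τ n p) {i j k : ℕ} (hi : 1 ≤ i) (hij : i ≤ j)
    (hjk : j ≤ k) (hk : k ≤ n) {a b : ℝ} (ha : 0 ≤ a) (h0 : ∀ t ∈ Icc a b, p i t ≠ p j t)
    (h1 : ∀ t ∈ Icc a b, p j t ≠ p k t) : LipOn a b (halfCos p i j k) :=
  (((hp.lipOn (by omega) (by omega) ha).dir (hp.lipOn (by omega) (by omega) ha) h1).sub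
    ((hp.lipOn (by omega) (by omega) ha).dir (hp.lipOn (by omega) (by omega) ha) h0)).norm.const_mul
    _

/-- The motion of a chain that is in line on both sides of a bend. -/
theorem Reg.single_bend (hn : 3 ≤ n) (hτ0 : 0 < τ) (hτ : τ ≤ 1 / 2) {t : ℝ} {v : ℕ → Plane}
    (hv : ∀ i, 1 ≤ i → i ≤ n → HasDerivAt (p i) (v i) t) (hr : Reg τ n (fun m => p m t) v) {h : ℕ}
    (h1 : 1 < h) (hhn : h < n) (hi0 : Inline (fun m => p m t) 1 h) (hi1 : Inline (fun m => p m t) h n)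
    (hne : ¬ Inline (fun m => p m t) 1 n) :
    ∃ s x x' : ℝ, 0 ≤ s ∧ s ≤ 1 ∧ 0 < halfCos p 1 h n t ∧ (1 - τ < halfCos p 1 h n t → s = 1) ∧
      x ≤ 1 - τ ∧ x' ≤ 1 - τ ∧
      HasDerivAt (fun t => dist (p 1 t) (p h t)) (x - s * halfCos p 1 h n t) t ∧
      HasDerivAt (fun t => dist (p h t) (p n t)) (x' - s * halfCos p 1 h n t) t ∧
      HasDerivAt (halfCos p 1 h n) (-(s * (1 - halfCos p 1 h n t ^ 2) / 2 *
        ((dist (p 1 t) (p h t))⁻¹ + (dist (p h t) (p n t))⁻¹))) t ∧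
      (x = 1 - τ ∧ x' = 1 - τ ∨
        s = 1 ∧ (x = 1 - τ ∨ halfCos p 1 h n t ≤ x) ∧ (x' = 1 - τ ∨ halfCos p 1 h n t ≤ x')) := by
  obtain ⟨n0, n1, a, k, s, c, u, h1a, hah, hhk, hkn, eah, ekh, ha, hvh, hb, hB⟩ :=
    hr.exists_bend hτ0 hτ le_rfl h1.le hhn.le le_rfl hi0 hi1 hne
  have hk : p k t ≠ p (k + 1) t := by
    intro he
    exact hb.2.2.2.2.2.1 (he.symm.trans (ekh.trans eah.symm))
  obtain ⟨x, hx0, hx1, hv1, hx2, hx3⟩ :=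
    hr.first_velocity hn hτ0 hτ hi0 h1a hah hhk hkn n0 eah ha hvh hb hB
  obtain ⟨x', hx0', hx1', hvn, hx2', hx3'⟩ :=
    hr.last_velocity hn hτ0 hτ hi1 h1a hah hhk hkn n1 ekh hk hvh hb hB
  have hc : halfCos p 1 h n t = c := halfCos_eq hB.c_pos hB.norm_u hB.sub_eq
  have d1 := hv 1 le_rfl (by omega)
  have dh := hv h h1.le hhn.le
  have dn := hv n (by omega) le_rfl
  have i0 := hB.inner_u_e₀
  have i1 := hB.inner_u_e₁
  have j0 := i0
  have j1 := i1
  rw [real_inner_comm] at j0 j1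
  rw [hc]
  refine ⟨s, x, x', hB.s_nonneg, hB.s_le, hB.c_pos, hB.full_speed, hx1, hx1', ?_, ?_, ?_, ?_⟩
  · refine (hasDerivAt_dist d1 dh n0).congr_deriv ?_
    rw [hvh, hv1, inner_sub_right, real_inner_smul_right, real_inner_smul_right, j0,
      real_inner_self_eq_norm_sq, hB.norm_e₀]
    ring
  · refine (hasDerivAt_dist dh dn n1).congr_deriv ?_
    rw [hvh, hvn, inner_sub_right, real_inner_smul_right, real_inner_smul_right, j1,
      real_inner_self_eq_norm_sq, hB.norm_e₁]
    ring
  · refine (hasDerivAt_halfCos hB.c_pos hB.norm_u hB.sub_eq d1 dh dn n0 n1).congr_deriv ?_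
    simp only [hvh, hvn, hv1, inner_sub_right, real_inner_smul_right, j0, j1, i0, i1,
      real_inner_self_eq_norm_sq, hB.norm_e₀, hB.norm_e₁, hB.norm_u]
    ring
  -- A stretched end forces full speed of the bend, and then each end moves at least as fast as it
  -- is pulled or at speed `1 - τ`. Without a stretched end both outer robots have speed `1 - τ`.
  · by_cases hf : IsFullLeft (fun m => p m t) a ∨ IsFullRight n (fun m => p m t) k
    · right
      refine ⟨hf.elim hB.full_left hB.full_right, ?_, ?_⟩
      · rcases hx3 with h | h | h
        · exact Or.inl h
        · exact Or.inr (hx2 h).ge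
        · exact Or.inr h.2
      · rcases hx3' with h | h | h
        · exact Or.inl h
        · exact Or.inr (hx2' h).ge
        · exact Or.inr h.2
    · left
      push Not at hf
      exact ⟨hx3.resolve_right fun h => h.elim hf.1 fun h => hf.2 h.1,
        hx3'.resolve_right fun h => h.elim hf.2 fun h => hf.1 h.1⟩

/-- The inequality between arithmetic and harmonic mean; with `m = n - 1` it bounds the turning rate
of the bend from below. -/
theorem four_div_le_inv_add_inv {a b m : ℝ} (ha : 0 < a) (hb : 0 < b) (h : a + b ≤ m) :
    4 / m ≤ a⁻¹ + b⁻¹ := by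
  have hm : 0 < m := by linarith
  rw [div_le_iff₀ hm]
  have h1 : 4 ≤ (a⁻¹ + b⁻¹) * (a + b) := by
    have : (a⁻¹ + b⁻¹) * (a + b) = 4 + (a - b) ^ 2 / (a * b) := by field_simp; ring
    rw [this]
    have : 0 ≤ (a - b) ^ 2 / (a * b) := by positivity
    linarith
  exact h1.trans (mul_le_mul_of_nonneg_left h (by positivity))

section SingleBend

variable {h : ℕ} {t₀ T : ℝ}

/-- A collapsed part would complete the merger. While the merger is pending, both lengths are
therefore positive and the directions, hence `halfCos`, are Lipschitz. -/
theorem IsExecution.ne_of_not_forever (hn : 3 ≤ n) (hτ0 : 0 < τ) (hτ : τ ≤ 1 / 2)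
    (hp : IsExecution τ n p) (hconn : IsConnectedChain n (fun i => p i 0)) {x y : ℕ} {t : ℝ}
    (ht : 0 ≤ t) (hx : 1 ≤ x) (hxh : x ≤ h) (hhy : h ≤ y) (hy : y ≤ n) (h0 : Forever p x h t)
    (h1 : Forever p h y t) (hne : ¬ Forever p x y t) : p x t ≠ p h t ∧ p h t ≠ p y t :=
  ⟨fun he => hne (hp.forever_join hn hτ0 hτ hconn hx hxh hhy hy ht h0 h1 (Or.inl he)),
    fun he => hne (hp.forever_join hn hτ0 hτ hconn hx hxh hhy hy ht h0 h1 (Or.inr he))⟩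

/-- While the angle at the single bend is below `ψ`, it opens up within time `(n - 1) / τ`. -/
theorem IsExecution.single_bend_opens (hn : 3 ≤ n) (hτ0 : 0 < τ) (hτ : τ ≤ 1 / 2)
    (hp : IsExecution τ n p) (hconn : IsConnectedChain n (fun i => p i 0)) (ht₀ : 0 ≤ t₀)
    (h1 : 1 < h) (hhn : h < n) (hF0 : Forever p 1 h t₀) (hF1 : Forever p h n t₀)
    (hne : ¬ Forever p 1 n (t₀ + (n - 1) / τ)) :
    ∃ t, t₀ ≤ t ∧ t ≤ t₀ + (n - 1) / τ ∧ halfCos p 1 h n t ≤ 1 - τ := by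
  have hn' : (3 : ℝ) ≤ n := by exact_mod_cast hn
  by_contra hc
  push Not at hc
  set T := t₀ + (n - 1) / τ with hT
  have hT0 : t₀ ≤ T := le_add_of_nonneg_right (div_nonneg (by linarith) hτ0.le)
  have hnt : ∀ t ∈ Icc t₀ T, p 1 t ≠ p h t ∧ p h t ≠ p n t := fun t ht =>
    hp.ne_of_not_forever hn hτ0 hτ hconn (ht₀.trans ht.1) le_rfl h1.le hhn.le le_rfl
      (hF0.mono ht.1) (hF1.mono ht.1) fun hf => hne (hf.mono ht.2)
  have hl : ∀ t, t₀ ≤ t → dist (p 1 t) (p h t) + dist (p h t) (p n t) ≤ n - 1 := by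
    intro t ht
    have e1 := hp.dist_le_of_inline hn hτ0 hτ hconn (ht₀.trans ht) le_rfl h1.le hhn.le (hF0 t ht)
    have e2 := hp.dist_le_of_inline hn hτ0 hτ hconn (ht₀.trans ht) h1.le hhn.le le_rfl (hF1 t ht)
    push_cast at e1
    linarith
  -- The length changes at rate at most `2 * (1 - τ) - 2 * c`, and the cosine term at rate at most
  -- `-2 * (1 - c ^ 2)`. The sum is at most `-2 * τ - 2 * c * (1 - c)`. The potential starts at no
  -- more than `2 * (n - 1)`.
  have hlip : LipOn t₀ T fun t => dist (p 1 t) (p h t) + dist (p h t) (p n t)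
      + (n - 1) * halfCos p 1 h n t :=
    (((hp.lipOn le_rfl (by omega) ht₀).dist (hp.lipOn (by omega) (by omega) ht₀)).add
      ((hp.lipOn h1.le (by omega) ht₀).dist (hp.lipOn (by omega) (by omega) ht₀))).add
      ((hp.lipOn_halfCos le_rfl h1.le hhn.le le_rfl ht₀ (fun t ht => (hnt t ht).1)
        fun t ht => (hnt t ht).2).const_mul _)
  have key := hlip.le_add_mul hT0 (m := -(2 * τ)) ?_
  · have e1 : 2 * τ * (T - t₀) = 2 * (n - 1) := by
      rw [hT, add_sub_cancel_left]
      field_simp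
    have e2 := dist_pos.2 (hnt T ⟨hT0, le_rfl⟩).1
    have e3 := dist_pos.2 (hnt T ⟨hT0, le_rfl⟩).2
    have e4 := halfCos_nonneg (p := p) 1 h n T
    have e5 := halfCos_le_one (p := p) 1 h n t₀
    have e6 := hl t₀ le_rfl
    nlinarith
  · filter_upwards [hp.ae_reg hn hτ0 hτ hconn] with t ht hmem
    obtain ⟨v, hv, hr⟩ := ht (lt_of_le_of_lt ht₀ hmem.1)
    have hm : t ∈ Icc t₀ T := Ioo_subset_Icc_self hmem
    have hni : ¬ Inline (fun m => p m t) 1 n := fun hi => hne ((hp.forever_of_reg hτ0 hτ le_rfl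
      (by omega) le_rfl (ht₀.trans hm.1) hr hi).mono hm.2)
    obtain ⟨s, x, x', hs0, hs1, hc0, hfs, hx, hx', hd0, hd1, hd2, -⟩ :=
      hr.single_bend hn hτ0 hτ hv h1 hhn (hF0 t hm.1) (hF1 t hm.1) hni
    refine ⟨_, ?_, (hd0.add hd1).add (hd2.const_mul _)⟩
    obtain rfl := hfs (hc t hm.1 hm.2)
    have e1 := four_div_le_inv_add_inv (dist_pos.2 (hnt t hm).1) (dist_pos.2 (hnt t hm).2)
      (hl t hm.1)
    have e2 := halfCos_le_one (p := p) 1 h n t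
    set c := halfCos p 1 h n t
    set K := (dist (p 1 t) (p h t))⁻¹ + (dist (p h t) (p n t))⁻¹
    rw [div_le_iff₀ (by linarith)] at e1
    have e3 : 0 ≤ 1 - c ^ 2 := by nlinarith
    nlinarith [mul_le_mul_of_nonneg_left e1 e3]

/-- The angle at the single bend does not decrease. -/
theorem IsExecution.halfCos_antitone (hn : 3 ≤ n) (hτ0 : 0 < τ) (hτ : τ ≤ 1 / 2)
    (hp : IsExecution τ n p) (hconn : IsConnectedChain n (fun i => p i 0)) (ht₀ : 0 ≤ t₀)
    (h1 : 1 < h) (hhn : h < n) (hF0 : Forever p 1 h t₀) (hF1 : Forever p h n t₀) (hT0 : t₀ ≤ T)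
    (hne : ¬ Forever p 1 n T) : halfCos p 1 h n T ≤ halfCos p 1 h n t₀ := by
  have hnt : ∀ t ∈ Icc t₀ T, p 1 t ≠ p h t ∧ p h t ≠ p n t := fun t ht =>
    hp.ne_of_not_forever hn hτ0 hτ hconn (ht₀.trans ht.1) le_rfl h1.le hhn.le le_rfl
      (hF0.mono ht.1) (hF1.mono ht.1) fun hf => hne (hf.mono ht.2)
  have key := (hp.lipOn_halfCos le_rfl h1.le hhn.le le_rfl ht₀ (fun t ht => (hnt t ht).1)
        fun t ht => (hnt t ht).2).le_add_mul hT0 (m := 0) ?_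
  · linarith
  · filter_upwards [hp.ae_reg hn hτ0 hτ hconn] with t ht hmem
    obtain ⟨v, hv, hr⟩ := ht (lt_of_le_of_lt ht₀ hmem.1)
    have hm : t ∈ Icc t₀ T := Ioo_subset_Icc_self hmem
    have hni : ¬ Inline (fun m => p m t) 1 n := fun hi => hne ((hp.forever_of_reg hτ0 hτ le_rfl
      (by omega) le_rfl (ht₀.trans hm.1) hr hi).mono hm.2)
    obtain ⟨s, x, x', hs0, hs1, hc0, hfs, hx, hx', hd0, hd1, hd2, -⟩ :=
      hr.single_bend hn hτ0 hτ hv h1 hhn (hF0 t hm.1) (hF1 t hm.1) hni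
    refine ⟨_, ?_, hd2⟩
    have e2 := halfCos_le_one (p := p) 1 h n t
    have e3 : 0 ≤ 1 - halfCos p 1 h n t ^ 2 := by nlinarith
    rw [neg_nonpos]
    positivity

/-- While the angle at the single bend is at least `ψ`, the bend straightens. -/
theorem IsExecution.single_bend_straightens (hn : 3 ≤ n) (hτ0 : 0 < τ) (hτ : τ ≤ 1 / 2)
    (hp : IsExecution τ n p) (hconn : IsConnectedChain n (fun i => p i 0)) (ht₀ : 0 ≤ t₀)
    (h1 : 1 < h) (hhn : h < n) (hF0 : Forever p 1 h t₀) (hF1 : Forever p h n t₀)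
    (hc₀ : halfCos p 1 h n t₀ ≤ 1 - τ) :
    Forever p 1 n (t₀ + ((n - 1) / (2 * (1 - τ)) + (n - 1) / (2 * τ))) := by
  have hn' : (3 : ℝ) ≤ n := by exact_mod_cast hn
  have hτ1 : 0 < 1 - τ := by linarith
  by_contra hne
  set T := t₀ + ((n - 1) / (2 * (1 - τ)) + (n - 1) / (2 * τ)) with hT
  have hT0 : t₀ ≤ T := le_add_of_nonneg_right (add_nonneg (div_nonneg (by linarith) (by linarith))
    (div_nonneg (by linarith) (by linarith)))
  have hnt : ∀ t ∈ Icc t₀ T, p 1 t ≠ p h t ∧ p h t ≠ p n t := fun t ht =>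
    hp.ne_of_not_forever hn hτ0 hτ hconn (ht₀.trans ht.1) le_rfl h1.le hhn.le le_rfl
      (hF0.mono ht.1) (hF1.mono ht.1) fun hf => hne (hf.mono ht.2)
  have hl : ∀ t, t₀ ≤ t → dist (p 1 t) (p h t) + dist (p h t) (p n t) ≤ n - 1 := by
    intro t ht
    have e1 := hp.dist_le_of_inline hn hτ0 hτ hconn (ht₀.trans ht) le_rfl h1.le hhn.le (hF0 t ht)
    have e2 := hp.dist_le_of_inline hn hτ0 hτ hconn (ht₀.trans ht) h1.le hhn.le le_rfl (hF1 t ht)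
    push_cast at e1
    linarith
  -- The weights make the two terms complementary when the bend has speed `s`: since `τ ≤ 1 - c ^
  -- 2`, the cosine term falls at rate at least `s`; since `c ≤ 1 - τ`, growth of the length lowers
  -- the other term at rate at least `1 - s`.
  have hlip : LipOn t₀ T fun t => (2 * (1 - τ))⁻¹ * -(dist (p 1 t) (p h t) + dist (p h t) (p n t))
      + (n - 1) / (2 * τ) * halfCos p 1 h n t :=
    (((hp.lipOn le_rfl (by omega) ht₀).dist (hp.lipOn (by omega) (by omega) ht₀)).add
      ((hp.lipOn h1.le (by omega) ht₀).dist (hp.lipOn (by omega) (by omega) ht₀))).neg.const_mul _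
      |>.add ((hp.lipOn_halfCos le_rfl h1.le hhn.le le_rfl ht₀ (fun t ht => (hnt t ht).1)
        fun t ht => (hnt t ht).2).const_mul _)
  have key := hlip.le_add_mul hT0 (m := -1) ?_
  · have e1 : T - t₀ = (2 * (1 - τ))⁻¹ * (n - 1) + (n - 1) / (2 * τ) := by
      rw [hT]; ring
    rw [e1] at key
    have e2 := dist_pos.2 (hnt t₀ ⟨le_rfl, hT0⟩).1
    have e3 := dist_pos.2 (hnt t₀ ⟨le_rfl, hT0⟩).2
    have e4 := halfCos_nonneg (p := p) 1 h n T
    have e6 := hl T hT0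
    have e7 : 0 < (2 * (1 - τ))⁻¹ := by positivity
    have e8 : 0 < ((n : ℝ) - 1) / (2 * τ) := div_pos (by linarith) (by linarith)
    have e9 := mul_le_mul_of_nonneg_left e6 e7.le
    have e10 := mul_pos e7 (add_pos e2 e3)
    have e11 := mul_nonneg e8.le e4
    have e12 := mul_le_mul_of_nonneg_left (hc₀.trans (by linarith : 1 - τ ≤ 1)) e8.le
    linarith
  · filter_upwards [hp.ae_reg hn hτ0 hτ hconn] with t ht hmem
    obtain ⟨v, hv, hr⟩ := ht (lt_of_le_of_lt ht₀ hmem.1)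
    have hm : t ∈ Icc t₀ T := Ioo_subset_Icc_self hmem
    have hni : ¬ Inline (fun m => p m t) 1 n := fun hi => hne ((hp.forever_of_reg hτ0 hτ le_rfl
      (by omega) le_rfl (ht₀.trans hm.1) hr hi).mono hm.2)
    obtain ⟨s, x, x', hs0, hs1, hc0, hfs, hx, hx', hd0, hd1, hd2, hcs⟩ :=
      hr.single_bend hn hτ0 hτ hv h1 hhn (hF0 t hm.1) (hF1 t hm.1) hni
    refine ⟨_, ?_, ((hd0.add hd1).neg.const_mul _).add (hd2.const_mul _)⟩
    have hcle := (hp.halfCos_antitone hn hτ0 hτ hconn ht₀ h1 hhn hF0 hF1 hm.1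
      fun hf => hne (hf.mono hm.2)).trans hc₀
    have e1 := four_div_le_inv_add_inv (dist_pos.2 (hnt t hm).1) (dist_pos.2 (hnt t hm).2)
      (hl t hm.1)
    set c := halfCos p 1 h n t
    set K := (dist (p 1 t) (p h t))⁻¹ + (dist (p h t) (p n t))⁻¹
    rw [div_le_iff₀ (by linarith)] at e1
    have e3 : τ ≤ 1 - c ^ 2 := by nlinarith
    have e4 : s ≤ (n - 1) / (2 * τ) * (s * (1 - c ^ 2) / 2 * K) := by
      rw [div_mul_eq_mul_div, le_div_iff₀ (by linarith)]
      have : 4 * (s * τ) ≤ K * (n - 1) * (s * (1 - c ^ 2)) :=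
        mul_le_mul e1 (mul_le_mul_of_nonneg_left e3 hs0) (by positivity) (by linarith)
      linarith
    have e5 : (2 * (1 - τ))⁻¹ * -(x - s * c + (x' - s * c)) ≤ s - 1 := by
      rw [inv_mul_le_iff₀ (by linarith)]
      rcases hcs with ⟨rfl, rfl⟩ | ⟨rfl, h2, h3⟩
      · nlinarith
      · have h2' : c ≤ x := h2.elim (fun h => h ▸ hcle) id
        have h3' : c ≤ x' := h3.elim (fun h => h ▸ hcle) id
        linarith
    linarith

theorem IsExecution.straighten_single_bend (hn : 3 ≤ n) (hτ0 : 0 < τ) (hτ : τ ≤ 1 / 2)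
    (hp : IsExecution τ n p) (hconn : IsConnectedChain n (fun i => p i 0)) (ht₀ : 0 ≤ t₀)
    (h1 : 1 < h) (hhn : h < n) (hF0 : Forever p 1 h t₀) (hF1 : Forever p h n t₀) :
    Forever p 1 n (t₀ + ((n - 1) / τ + ((n - 1) / (2 * (1 - τ)) + (n - 1) / (2 * τ)))) := by
  have hn' : (3 : ℝ) ≤ n := by exact_mod_cast hn
  have hpos : 0 ≤ ((n : ℝ) - 1) / (2 * (1 - τ)) + (n - 1) / (2 * τ) :=
    add_nonneg (div_nonneg (by linarith) (by linarith)) (div_nonneg (by linarith) (by linarith))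
  by_cases hne : Forever p 1 n (t₀ + (n - 1) / τ)
  · exact hne.mono (by linarith)
  obtain ⟨t, ht0, ht1, hc⟩ := hp.single_bend_opens hn hτ0 hτ hconn ht₀ h1 hhn hF0 hF1 hne
  exact (hp.single_bend_straightens hn hτ0 hτ hconn (ht₀.trans ht0) h1 hhn (hF0.mono ht0)
    (hF1.mono ht0) hc).mono (by linarith)

end SingleBend

end MaxMob

end

noncomputable section

namespace MaxMob

open Filter Topology

/-! ### Bends next to the ends of the chain -/

section Static

variable {τ : ℝ} {n : ℕ} {q v : ℕ → Plane}

/-- The case of `Reg.first_velocity` in which the first robot is pushed needs a chain stretched from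
the bend to robot `n`, which would put `h, …, n` in line. -/
theorem Reg.left_bend (hn : 3 ≤ n) (hτ0 : 0 < τ) (hτ : τ ≤ 1 / 2) (hr : Reg τ n q v) {h y : ℕ}
    (h1 : 1 < h) (hhy : h < y) (hy : y ≤ n) (hi0 : Inline q 1 h) (hi1 : Inline q h y)
    (hne : ¬ Inline q 1 y) (hne' : ¬ Inline q h n) :
    q 1 ≠ q h ∧ q h ≠ q y ∧ ∃ (a : ℕ) (s c x : ℝ) (u : Plane), 1 < a ∧ a ≤ h ∧ q a = q h ∧
      v h = s • u ∧ v 1 = -x • dir (q 1) (q h) ∧ 0 ≤ x ∧ x ≤ 1 - τ ∧ 0 ≤ s ∧ s ≤ 1 ∧ 0 < c ∧ c ≤ 1 ∧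
      ‖u‖ = 1 ∧ dir (q h) (q y) - dir (q 1) (q h) = (2 * c) • u ∧ ⟪u, dir (q 1) (q h)⟫ = -c ∧
      ⟪u, dir (q h) (q y)⟫ = c ∧ (IsFullLeft q a → s = 1 ∧ x = c) ∧
      (x = 1 - τ ∨ IsFullLeft q a) := by
  obtain ⟨n0, n1, a, k, s, c, u, h1a, hah, hhk, hkn, eah, ekh, ha, hvh, hb, hB⟩ :=
    hr.exists_bend hτ0 hτ le_rfl h1.le hhy.le hy hi0 hi1 hne
  obtain ⟨x, hx0, hx1, hv1, hx2, hx3⟩ :=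
    hr.first_velocity hn hτ0 hτ hi0 h1a hah hhk (by omega) n0 eah ha hvh hb hB
  refine ⟨n0, n1, a, s, c, x, u, h1a, hah, eah, hvh, hv1, hx0, hx1, hB.s_nonneg, hB.s_le, hB.c_pos,
    hB.c_le, hB.norm_u, hB.sub_eq, hB.inner_u_e₀, hB.inner_u_e₁,
    fun hf => ⟨hB.full_left hf, hx2 hf⟩, hx3.imp_right (Or.rec id fun hf => absurd ?_ hne')⟩
  exact (hi1.sub le_rfl hhk hkn.le).join_of_eq (inline_of_isFullRight (by omega) hf.1).1 hhk
    (by omega) (Or.inl ekh.symm)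

theorem Reg.right_bend (hn : 3 ≤ n) (hτ0 : 0 < τ) (hτ : τ ≤ 1 / 2) (hr : Reg τ n q v) {x h : ℕ}
    (hx : 1 ≤ x) (hxh : x < h) (hhn : h < n) (hi0 : Inline q x h) (hi1 : Inline q h n)
    (hne : ¬ Inline q x n) (hne' : ¬ Inline q 1 h) :
    q x ≠ q h ∧ q h ≠ q n ∧ ∃ (k : ℕ) (s c x' : ℝ) (u : Plane), h ≤ k ∧ k < n ∧ q k = q h ∧
      v h = s • u ∧ v n = x' • dir (q h) (q n) ∧ 0 ≤ x' ∧ x' ≤ 1 - τ ∧ 0 ≤ s ∧ s ≤ 1 ∧ 0 < c ∧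
      c ≤ 1 ∧ ‖u‖ = 1 ∧ dir (q h) (q n) - dir (q x) (q h) = (2 * c) • u ∧
      ⟪u, dir (q x) (q h)⟫ = -c ∧ ⟪u, dir (q h) (q n)⟫ = c ∧
      (IsFullRight n q k → s = 1 ∧ x' = c) ∧ (x' = 1 - τ ∨ IsFullRight n q k) := by
  obtain ⟨n0, n1, a, k, s, c, u, h1a, hah, hhk, hkn, eah, ekh, ha, hvh, hb, hB⟩ :=
    hr.exists_bend hτ0 hτ hx hxh.le hhn.le le_rfl hi0 hi1 hne
  have hk : q k ≠ q (k + 1) := fun he => hb.2.2.2.2.2.1 (he.symm.trans (ekh.trans eah.symm))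
  obtain ⟨x', hx0, hx1, hvn, hx2, hx3⟩ :=
    hr.last_velocity hn hτ0 hτ hi1 (by omega) hah hhk hkn n1 ekh hk hvh hb hB
  refine ⟨n0, n1, k, s, c, x', u, hhk, hkn, ekh, hvh, hvn, hx0, hx1, hB.s_nonneg, hB.s_le, hB.c_pos,
    hB.c_le, hB.norm_u, hB.sub_eq, hB.inner_u_e₀, hB.inner_u_e₁,
    fun hf => ⟨hB.full_right hf, hx2 hf⟩, hx3.imp_right (Or.rec id fun hf => absurd ?_ hne')⟩
  exact (inline_of_isFullLeft (by omega) hf.1).1.join_of_eq (hi0.sub (by omega) hah le_rfl) (by omega)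
    hah (Or.inr eah)

/-- The bend at the end of the second chain in line. -/
theorem Reg.middle_bend (hn : 3 ≤ n) (hτ0 : 0 < τ) (hτ : τ ≤ 1 / 2) (hr : Reg τ n q v) {h y : ℕ}
    (h1 : 1 ≤ h) (hhy : h < y) (hy : y < n) (hi : Inline q h y) (hne : ¬ Inline q 1 y)
    (hne' : ¬ Inline q h (y + 1)) :
    ∃ (s c : ℝ) (u : Plane), v y = s • u ∧ 0 ≤ s ∧ s ≤ 1 ∧ 0 < c ∧ ‖u‖ = 1 ∧
      dir (q y) (q (y + 1)) - dir (q h) (q y) = (2 * c) • u ∧ ⟪u, dir (q h) (q y)⟫ = -c ∧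
      (s = 0 ∨ 1 - τ ≤ c ∨ IsFullRight n q y ∧ s = 1) := by
  obtain ⟨n0, n1, a, k, s, c, u, h1a, hah, hhk, hkn, eah, ekh, ha, hvh, hb, hB⟩ :=
    hr.exists_bend hτ0 hτ h1 hhy.le (Nat.le_succ y) hy hi (inline_succ y) hne'
  obtain rfl : k = y := by omega
  refine ⟨s, c, u, hvh, hB.s_nonneg, hB.s_le, hB.c_pos, hB.norm_u, hB.sub_eq, hB.inner_u_e₀, ?_⟩
  rcases hr.bend_cases hn hτ0 hτ hb hB with hf | hf | hf | hf
  · exact Or.inl hf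
  · exact Or.inr (Or.inl hf)
  · exact absurd ((inline_of_isFullLeft (by omega) hf).1.join_of_eq (hi.sub (by omega) hah le_rfl)
      (by omega) hah (Or.inr eah)) hne
  · exact Or.inr (Or.inr ⟨hf, hB.full_right hf⟩)

end Static

variable {τ : ℝ} {n : ℕ} {p : ℕ → ℝ → Plane}

/-! ### The potential of two consecutive chains in line -/

/-- Half of the distance of robot `y` from the position it would have if the chain `1, …, h, …, y`
were in line. -/
def deviation (p : ℕ → ℝ → Plane) (h y : ℕ) (t : ℝ) : ℝ :=
  1 / 2 * ‖(p y t - p h t) - dist (p h t) (p y t) • dir (p 1 t) (p h t)‖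

theorem deviation_nonneg (h y : ℕ) (t : ℝ) : 0 ≤ deviation p h y t := by
  unfold deviation
  positivity

theorem deviation_le (h y : ℕ) (t : ℝ) : deviation p h y t ≤ dist (p h t) (p y t) := by
  unfold deviation
  have h1 := norm_sub_le (p y t - p h t) (dist (p h t) (p y t) • dir (p 1 t) (p h t))
  rw [norm_smul, Real.norm_of_nonneg dist_nonneg, ← dist_eq_norm' (p h t)] at h1
  have h2 := mul_le_mul_of_nonneg_left (norm_dir_le (p 1 t) (p h t))
    (dist_nonneg (x := p h t) (y := p y t))
  linarith

/-- The rest of the potential. -/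
def reserve (τ : ℝ) (n : ℕ) (p : ℕ → ℝ → Plane) (h y : ℕ) (t : ℝ) : ℝ :=
  2 * (dist (p h t) (p y t) + 2 * (n - 1 - y)) + 2 / (1 - τ) *
    (h - 1 - dist (p 1 t) (p h t) + dist (p h t) (p y t) + (n - 1 - y) + (n - 1 - h))

/-- The only harmful term is `s' * g ≤ 1`, the second bend carrying `y` away. If `x = 1 - τ`, the
last term contributes `-2`. If `s = 1`, the term `-s` is enough once `s' * g` is absorbed by `2 *
(s' * c' + s * c)`: by `c' ≥ 1 - τ ≥ 1 / 2`, or by `c + c' ≥ 1 / 2` with `s' = 1`. -/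
theorem potential_rate {s c x s' c' g : ℝ} (hτ0 : 0 < τ) (hτ : τ ≤ 1 / 2) (hx : 0 ≤ x) (hs : 0 ≤ s)
    (hc : 0 ≤ c) (hs0' : 0 ≤ s') (hs1' : s' ≤ 1) (hc' : 0 ≤ c') (hg : g ≤ 1)
    (hcase : x = 1 - τ ∨ s = 1 ∧ (s' = 0 ∨ 1 - τ ≤ c' ∨ s' = 1 ∧ 1 / 2 ≤ c + c')) :
    s' * g - s - (c + 2) * (s' * c' + s * c) - 2 / (1 - τ) * (x + s' * c') ≤ -1 := by
  have hτ1 : 0 < 1 - τ := by linarith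
  have h1 : s' * g ≤ s' := mul_le_of_le_one_right hs0' hg
  have h2 : 0 ≤ s' * c' := by positivity
  have h3 : 0 ≤ s * c := by positivity
  have h4 : 0 ≤ c * (s' * c' + s * c) := by positivity
  rcases hcase with rfl | ⟨rfl, hcase⟩
  · have h5 : 2 / (1 - τ) * (1 - τ) = 2 := div_mul_cancel₀ _ hτ1.ne'
    have h6 : 0 ≤ 2 / (1 - τ) * (s' * c') := by positivity
    linarith
  · have h5 : 0 ≤ 2 / (1 - τ) * (x + s' * c') := by positivity
    rcases hcase with rfl | h6 | ⟨rfl, h6⟩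
    · linarith
    · have h7 : s' * (1 / 2) ≤ s' * c' := mul_le_mul_of_nonneg_left (by linarith) hs0'
      linarith
    · linarith

theorem Reg.hasDerivAt_potential (hn : 3 ≤ n) (hτ0 : 0 < τ) (hτ : τ ≤ 1 / 2) {t : ℝ} {v : ℕ → Plane}
    (hv : ∀ i, 1 ≤ i → i ≤ n → HasDerivAt (p i) (v i) t) (hr : Reg τ n (fun m => p m t) v)
    {h y : ℕ} (h1 : 1 < h) (hhy : h < y) (hy : y < n) (hi0 : Inline (fun m => p m t) 1 h)
    (hi1 : Inline (fun m => p m t) h y) (hne : ¬ Inline (fun m => p m t) 1 y)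
    (hne' : ¬ Inline (fun m => p m t) h (y + 1)) :
    (∃ d ≤ -1, HasDerivAt (fun t => 2 * deviation p h y t + reserve τ n p h y t) d t) ∨
    (∃ a, 1 < a ∧ a ≤ h ∧ p a t = p h t ∧ IsFullLeft (fun m => p m t) a ∧
      IsFullRight n (fun m => p m t) y ∧
      halfCos p 1 h y t + halfCos p h y (y + 1) t < 1 / 2) := by
  obtain ⟨n0, n1, a, s, c, x, u, h1a, hah, eah, hvh, hv1, hx0, hx1, hs0, hs1, hc0, hc1, hu, hsub, i0,
    i1, hfull, hcase⟩ := hr.left_bend hn hτ0 hτ h1 hhy hy.le hi0 hi1 hne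
      fun hf => hne' (hf.sub le_rfl (by omega) hy)
  obtain ⟨s', c', u', hvy, hs0', hs1', hc0', hu', hsub', i1', hcase'⟩ :=
    hr.middle_bend hn hτ0 hτ h1.le hhy hy hi1 hne hne'
  by_cases hsp : IsFullLeft (fun m => p m t) a ∧ IsFullRight n (fun m => p m t) y ∧ c + c' < 1 / 2
  · right
    refine ⟨a, h1a, hah, eah, hsp.1, hsp.2.1, ?_⟩
    rw [halfCos_eq hc0 hu hsub, halfCos_eq hc0' hu' hsub']
    exact hsp.2.2
  left
  have d1 := hv 1 le_rfl (by omega)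
  have dh := hv h h1.le (by omega)
  have dy := hv y (by omega) hy.le
  have hd0 := hasDerivAt_dist d1 dh n0
  have hd1 := hasDerivAt_dist dh dy n1
  have hdir := hasDerivAt_dir d1 dh n0
  have hl1 : 0 < dist (p h t) (p y t) := dist_pos.2 n1
  have hl0 : 0 < dist (p 1 t) (p h t) := dist_pos.2 n0
  -- The vector whose norm defines the deviation is `l1 • (e₁ - e₀) = (2 * l1 * c) • u`.
  have hG := hasDerivAt_half_norm (c := dist (p h t) (p y t) * c) (mul_pos hl1 hc0) hu
    ((dy.sub dh).sub (hd1.smul hdir)) (by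
      change p y t - p h t - dist (p h t) (p y t) • dir (p 1 t) (p h t) = _
      rw [← dist_smul_dir (p h t) (p y t), ← smul_sub]
      rw [hsub, smul_smul]
      ring_nf)
  have j0 := i0
  have j1 := i1
  have j1' := i1'
  rw [real_inner_comm] at j0 j1 j1'
  have e0 : ‖dir (p 1 t) (p h t)‖ = 1 := norm_dir n0
  have e1 : ‖dir (p h t) (p y t)‖ = 1 := norm_dir n1
  have hg : ⟪u, u'⟫ ≤ 1 := by
    have := real_inner_le_norm u u'
    rwa [hu, hu', one_mul] at this
  have hD := (hG.const_mul 2).add (((hd1.add_const (2 * ((n : ℝ) - 1 - y))).const_mul 2).add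
    ((((((hd0.const_sub ((h : ℝ) - 1)).add hd1).add_const ((n : ℝ) - 1 - y)).add_const
      ((n : ℝ) - 1 - h))).const_mul (2 / (1 - τ))))
  refine ⟨_, ?_, hD⟩
  simp only [hvh, hv1, hvy, inner_sub_right, inner_add_right, real_inner_smul_right, i0, j0, j1,
    j1', real_inner_self_eq_norm_sq, hu, e0]
  set g := ⟪u, u'⟫
  set l0 := dist (p 1 t) (p h t)
  set l1 := dist (p h t) (p y t)
  -- The turning of the first chain towards the second only helps, and its contribution is dropped.
  have hR : 0 ≤ l1 * (l0⁻¹ * (s * (1 - c ^ 2))) := by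
    have : 0 ≤ 1 - c ^ 2 := by nlinarith
    positivity
  have hmain : s' * g - s - (c + 2) * (s' * c' + s * c) - 2 / (1 - τ) * (x + s' * c') ≤ -1 := by
    refine potential_rate hτ0 hτ hx0 hs0 hc0.le hs0' hs1' hc0'.le hg ?_
    rcases hcase with h2 | h2
    · exact Or.inl h2
    obtain ⟨h3, h4⟩ := hfull h2
    refine Or.inr ⟨h3, ?_⟩
    rcases hcase' with h5 | h5 | h5
    · exact Or.inl h5
    · exact Or.inr (Or.inl h5)
    · refine Or.inr (Or.inr ⟨h5.2, ?_⟩)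
      by_contra hc
      exact hsp ⟨h2, h5.1, not_le.1 hc⟩
  linarith
end MaxMob

end

noncomputable section

namespace MaxMob

open Filter Topology

variable {τ : ℝ} {n : ℕ} {p : ℕ → ℝ → Plane}

/-! ### Two bends between completely stretched ends -/

theorem isFullLeft_of_dist {q v : ℕ → Plane} (hr : Reg τ n q v) {a : ℕ} (h1 : 1 < a)
    (han : a ≤ n) (hi : Inline q 1 a) (hd : (a : ℝ) - 1 ≤ dist (q 1) (q a)) : IsFullLeft q a := by
  have ha : (1 : ℝ) < a := by exact_mod_cast h1
  have hne : q 1 ≠ q a := by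
    intro h
    rw [h, dist_self] at hd
    linarith
  exact isFullLeft_of_run (norm_dir hne) fun m h1 h2 => hi.step_eq_of_dist_eq
    (fun m h3 h4 => hr.short m h3 (by omega)) (by simpa using hd) h1 h2

theorem isFullRight_of_dist {q v : ℕ → Plane} (hr : Reg τ n q v) {b : ℕ} (h1 : 1 ≤ b)
    (hbn : b < n) (hi : Inline q b n) (hd : (n : ℝ) - b ≤ dist (q b) (q n)) :
    IsFullRight n q b := by
  have hb : (b : ℝ) < n := by exact_mod_cast hbn
  have hne : q b ≠ q n := by
    intro h
    rw [h, dist_self] at hd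
    linarith
  exact isFullRight_of_run (norm_dir hne) h1 fun m h1 h2 => hi.step_eq_of_dist_eq
    (fun m h3 h4 => hr.short m (by omega) h4) hd h1 h2

/-- The middle chain contributes half of `l₁⁻¹ * (2 * g - 2 + (c + c') ^ 2)`, which is not positive.
Each outer chain contributes at most `-(3 / 8) / N`, because `c` and `c'` are below `1 / 2`. -/
theorem two_bends_rate {c c' g l₀ l₁ l₂ N : ℝ} (hc : 0 < c) (hc' : 0 < c') (hC : c + c' < 1 / 2)
    (hg : (c + c') ^ 2 ≤ 2 - 2 * g) (h0 : 0 < l₀) (h1 : 0 < l₁) (h2 : 0 < l₂) (hN0 : l₀ ≤ N)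
    (hN2 : l₂ ≤ N) :
    1 / 2 * (l₁⁻¹ * (g - 1 + (c' + c) * c) - l₀⁻¹ * (1 - c ^ 2)) +
      1 / 2 * (-(l₂⁻¹ * (1 - c' ^ 2)) - l₁⁻¹ * (1 - g - (c' + c) * c')) ≤ -(1 / (2 * N)) := by
  have hN : 0 < N := by linarith
  have e1 : l₁⁻¹ * (2 * g - 2 + (c + c') ^ 2) ≤ 0 :=
    mul_nonpos_of_nonneg_of_nonpos (by positivity) (by linarith)
  have e2 : N⁻¹ * (3 / 4) ≤ l₀⁻¹ * (1 - c ^ 2) :=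
    mul_le_mul (inv_anti₀ h0 hN0) (by nlinarith) (by norm_num) (by positivity)
  have e3 : N⁻¹ * (3 / 4) ≤ l₂⁻¹ * (1 - c' ^ 2) :=
    mul_le_mul (inv_anti₀ h2 hN2) (by nlinarith) (by norm_num) (by positivity)
  have e4 : 1 / (2 * N) = N⁻¹ * (1 / 2) := by field_simp
  have e5 : 0 < N⁻¹ := by positivity
  rw [e4]
  nlinarith

/-- Since each cosine is below `1 / 2 ≤ 1 - τ`, an outer robot with speed `1 - τ` outruns the pull
of its bend, and a stretched end keeps its length. Stretched ends make both bends move at full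
speed. -/
theorem Reg.two_bends (hn : 3 ≤ n) (hτ0 : 0 < τ) (hτ : τ ≤ 1 / 2) {t : ℝ} {v : ℕ → Plane}
    (hv : ∀ i, 1 ≤ i → i ≤ n → HasDerivAt (p i) (v i) t) (hr : Reg τ n (fun m => p m t) v)
    {a b : ℕ} (h1 : 1 < a) (hab : a < b) (hbn : b < n) (hi0 : Inline (fun m => p m t) 1 a)
    (hi1 : Inline (fun m => p m t) a b) (hi2 : Inline (fun m => p m t) b n)
    (hne : ¬ Inline (fun m => p m t) 1 b) (hne' : ¬ Inline (fun m => p m t) a n)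
    (hC : halfCos p 1 a b t + halfCos p a b n t < 1 / 2) :
    (∃ d, 0 ≤ d ∧ HasDerivAt (fun t => dist (p 1 t) (p a t)) d t) ∧
    (∃ d, 0 ≤ d ∧ HasDerivAt (fun t => dist (p b t) (p n t)) d t) ∧
    ((a : ℝ) - 1 ≤ dist (p 1 t) (p a t) → (n : ℝ) - b ≤ dist (p b t) (p n t) →
      ∃ d ≤ -(1 / (2 * (n : ℝ))),
        HasDerivAt (fun t => halfCos p 1 a b t + halfCos p a b n t) d t) := by
  obtain ⟨n0, n1, a', s, c, x, u, ha1, haa, -, hva, hv1, hx0, hx1, hs0, hs1, hc0, hc1, hu, hsub, i0,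
    i1, hfull, hcase⟩ := hr.left_bend hn hτ0 hτ h1 hab hbn.le hi0 hi1 hne hne'
  obtain ⟨-, n2, b', s', c', x', u', hbb, hbn', -, hvb, hvn, hx0', hx1', hs0', hs1', hc0', hc1', hu',
    hsub', i1', i2', hfull', hcase'⟩ := hr.right_bend hn hτ0 hτ h1.le hab hbn hi1 hi2 hne' hne
  rw [halfCos_eq hc0 hu hsub, halfCos_eq hc0' hu' hsub'] at hC
  have d1 := hv 1 le_rfl (by omega)
  have da := hv a h1.le (by omega)
  have db := hv b (by omega) hbn.le
  have dn := hv n (by omega) le_rfl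
  have j0 := i0
  have j1 := i1
  have j1' := i1'
  have j2' := i2'
  rw [real_inner_comm] at j0 j1 j1' j2'
  have e0 : ‖dir (p 1 t) (p a t)‖ = 1 := norm_dir n0
  have e1 : ‖dir (p a t) (p b t)‖ = 1 := norm_dir n1
  have e2 : ‖dir (p b t) (p n t)‖ = 1 := norm_dir n2
  refine ⟨⟨_, ?_, hasDerivAt_dist d1 da n0⟩, ⟨_, ?_, hasDerivAt_dist db dn n2⟩, fun hd0 hd2 => ?_⟩
  · rw [hva, hv1, inner_sub_right, real_inner_smul_right, real_inner_smul_right, j0,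
      real_inner_self_eq_norm_sq, e0]
    rcases hcase with h2 | h2
    · nlinarith
    · obtain ⟨rfl, rfl⟩ := hfull h2
      linarith
  · rw [hvb, hvn, inner_sub_right, real_inner_smul_right, real_inner_smul_right, j2',
      real_inner_self_eq_norm_sq, e2]
    rcases hcase' with h2 | h2
    · nlinarith
    · obtain ⟨rfl, rfl⟩ := hfull' h2
      linarith
  · have hL := isFullLeft_of_dist hr h1 (by omega) hi0 hd0
    have hR := isFullRight_of_dist hr (by omega) hbn hi2 hd2
    obtain ⟨rfl, rfl⟩ := hfull fun m h2 h3 => hL m h2 (by omega)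
    obtain ⟨rfl, rfl⟩ := hfull' fun m h2 h3 => by
      have := hR m (by omega) h3
      exact ⟨this.1, fun h4 => this.2 (by omega)⟩
    have ha : (a : ℝ) ≤ n := by exact_mod_cast (by omega : a ≤ n)
    have hb : (0 : ℝ) ≤ b := by positivity
    have g0 := hi0.dist_le h1.le fun m h3 h4 => hr.short m h3 (by omega)
    have g2 := hi2.dist_le hbn.le fun m h3 h4 => hr.short m (by omega) h4
    push_cast at g0
    -- The two bisectors differ by `x + x'` in the direction of the middle chain.
    have hg : (x + x') ^ 2 ≤ 2 - 2 * ⟪u, u'⟫ := by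
      have h2 := abs_real_inner_le_norm (u - u') (dir (p a t) (p b t))
      rw [inner_sub_left, i1, i1', e1, mul_one, sub_neg_eq_add] at h2
      have h3 := norm_sub_sq_real u u'
      rw [hu, hu'] at h3
      have h4 := pow_le_pow_left₀ (abs_nonneg _) h2 2
      rw [sq_abs] at h4
      linarith
    refine ⟨_, ?_, (hasDerivAt_halfCos hc0 hu hsub d1 da db n0 n1).add
      (hasDerivAt_halfCos hc0' hu' hsub' da db dn n1 n2)⟩
    have key := two_bends_rate hc0 hc0' hC hg (dist_pos.2 n0) (dist_pos.2 n1) (dist_pos.2 n2)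
      (N := n) (by linarith) (by linarith)
    refine le_trans (le_of_eq ?_) key
    have hcomm : ⟪u', u⟫ = ⟪u, u'⟫ := real_inner_comm _ _
    simp only [hva, hv1, hvb, hvn, inner_sub_right, real_inner_smul_right, i0, j0, i1, j1, i1', j1',
      i2', j2', real_inner_self_eq_norm_sq, hu, hu', e0, e2, hcomm]
    ring

theorem IsExecution.two_bends_straighten (hn : 3 ≤ n) (hτ0 : 0 < τ) (hτ : τ ≤ 1 / 2)
    (hp : IsExecution τ n p) (hconn : IsConnectedChain n (fun i => p i 0)) {a b : ℕ} {t₀ : ℝ}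
    (ht₀ : 0 ≤ t₀) (h1 : 1 < a) (hab : a < b) (hbn : b < n) (hF0 : Forever p 1 a t₀)
    (hF1 : Forever p a b t₀) (hF2 : Forever p b n t₀) (hd0 : (a : ℝ) - 1 ≤ dist (p 1 t₀) (p a t₀))
    (hd2 : (n : ℝ) - b ≤ dist (p b t₀) (p n t₀))
    (hC : halfCos p 1 a b t₀ + halfCos p a b n t₀ < 1 / 2) :
    Forever p 1 b (t₀ + n) ∨ Forever p a n (t₀ + n) := by
  have hn' : (3 : ℝ) ≤ n := by exact_mod_cast hn
  by_contra hS
  push Not at hS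
  set T := t₀ + n with hT
  have hT0 : t₀ ≤ T := by linarith
  have hnl : ∀ t ∈ Icc t₀ T, p 1 t ≠ p a t ∧ p a t ≠ p b t := fun t ht =>
    hp.ne_of_not_forever hn hτ0 hτ hconn (ht₀.trans ht.1) le_rfl h1.le hab.le hbn.le
      (hF0.mono ht.1) (hF1.mono ht.1) fun hf => hS.1 (hf.mono ht.2)
  have hnr : ∀ t ∈ Icc t₀ T, p a t ≠ p b t ∧ p b t ≠ p n t := fun t ht =>
    hp.ne_of_not_forever hn hτ0 hτ hconn (ht₀.trans ht.1) h1.le hab.le hbn.le le_rfl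
      (hF1.mono ht.1) (hF2.mono ht.1) fun hf => hS.2 (hf.mono ht.2)
  set C : ℝ → ℝ := fun t => halfCos p 1 a b t + halfCos p a b n t with hCdef
  have hlipC : LipOn t₀ T C :=
    (hp.lipOn_halfCos le_rfl h1.le hab.le hbn.le ht₀ (fun t ht => (hnl t ht).1)
      fun t ht => (hnl t ht).2).add
    (hp.lipOn_halfCos h1.le hab.le hbn.le le_rfl ht₀ (fun t ht => (hnr t ht).1)
      fun t ht => (hnr t ht).2)
  have key : ∀ r, t₀ ≤ r → r ≤ T → (∀ t, t₀ ≤ t → t < r → C t < 1 / 2) →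
      C r ≤ C t₀ + -(1 / (2 * n)) * (r - t₀) := by
    intro r hr0 hrT hlt
    have hreg : ∀ᵐ t : ℝ, t ∈ Ioo t₀ r →
        (∃ d, 0 ≤ d ∧ HasDerivAt (fun t => dist (p 1 t) (p a t)) d t) ∧
        (∃ d, 0 ≤ d ∧ HasDerivAt (fun t => dist (p b t) (p n t)) d t) ∧
        ((a : ℝ) - 1 ≤ dist (p 1 t) (p a t) → (n : ℝ) - b ≤ dist (p b t) (p n t) →
          ∃ d ≤ -(1 / (2 * (n : ℝ))), HasDerivAt C d t) := by
      filter_upwards [hp.ae_reg hn hτ0 hτ hconn] with t ht hmem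
      obtain ⟨v, hv, hr⟩ := ht (lt_of_le_of_lt ht₀ hmem.1)
      have ht0 := ht₀.trans hmem.1.le
      exact hr.two_bends hn hτ0 hτ hv h1 hab hbn (hF0 t hmem.1.le) (hF1 t hmem.1.le)
        (hF2 t hmem.1.le)
        (fun hi => hS.1 ((hp.forever_of_reg hτ0 hτ le_rfl (by omega) hbn.le ht0 hr hi).mono
          (hmem.2.le.trans hrT)))
        (fun hi => hS.2 ((hp.forever_of_reg hτ0 hτ h1.le (by omega) le_rfl ht0 hr hi).mono
          (hmem.2.le.trans hrT))) (hlt t hmem.1.le hmem.2)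
    have hl0 : LipOn t₀ r fun t => -dist (p 1 t) (p a t) :=
      ((hp.lipOn le_rfl (by omega) ht₀).dist (hp.lipOn h1.le (by omega) ht₀)).neg
    have hl2 : LipOn t₀ r fun t => -dist (p b t) (p n t) :=
      ((hp.lipOn (by omega) hbn.le ht₀).dist (hp.lipOn (by omega) le_rfl ht₀)).neg
    refine (hlipC.mono le_rfl hrT).le_add_mul hr0 ?_
    filter_upwards [hreg] with t ht hmem
    refine (ht hmem).2.2 ?_ ?_
    · have := (hl0.mono le_rfl hmem.2.le).le_add_mul hmem.1.le (m := 0) (by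
        filter_upwards [hreg] with s hs hsm
        obtain ⟨d, hd, hd'⟩ := (hs ⟨hsm.1, hsm.2.trans hmem.2⟩).1
        exact ⟨-d, neg_nonpos.2 hd, hd'.neg⟩)
      linarith
    · have := (hl2.mono le_rfl hmem.2.le).le_add_mul hmem.1.le (m := 0) (by
        filter_upwards [hreg] with s hs hsm
        obtain ⟨d, hd, hd'⟩ := (hs ⟨hsm.1, hsm.2.trans hmem.2⟩).2.1
        exact ⟨-d, neg_nonpos.2 hd, hd'.neg⟩)
      linarith
  have hn0 : (0 : ℝ) < 1 / (2 * n) := by positivity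
  -- Up to the first time with `C = 1 / 2` the sum would only have decreased from its initial value
  -- below `1 / 2`.
  have hlt : ∀ t, t₀ ≤ t → t ≤ T → C t < 1 / 2 := by
    by_contra hc
    push Not at hc
    obtain ⟨t, ht0, htT, hct⟩ := hc
    have hcomp : IsCompact (Icc t₀ T ∩ C ⁻¹' Ici (1 / 2)) :=
      isCompact_Icc.of_isClosed_subset
        (hlipC.continuousOn.preimage_isClosed_of_isClosed isClosed_Icc isClosed_Ici) inter_subset_left
    obtain ⟨c, ⟨hcI, hcC⟩, hmin⟩ := hcomp.exists_isLeast ⟨t, ⟨ht0, htT⟩, hct⟩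
    have h2 := key c hcI.1 hcI.2 fun s hs0 hsc => by
      by_contra h3
      exact not_le.2 hsc (hmin ⟨⟨hs0, hsc.le.trans hcI.2⟩, not_lt.1 h3⟩)
    have h3 : (1 : ℝ) / 2 ≤ C c := hcC
    nlinarith [hcI.1]
  have h2 := key T hT0 le_rfl fun t h3 h4 => hlt t h3 h4.le
  have h3 : 1 / (2 * (n : ℝ)) * (T - t₀) = 1 / 2 := by
    rw [hT, add_sub_cancel_left]
    field_simp
  have h4 : 0 ≤ C T := add_nonneg (halfCos_nonneg _ _ _ _) (halfCos_nonneg _ _ _ _)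
  have h5 : C t₀ < 1 / 2 := hC
  linarith

end MaxMob

end

noncomputable section

namespace MaxMob

open Filter Topology

variable {τ : ℝ} {n : ℕ} {p : ℕ → ℝ → Plane}

/-! ### Merging chains in line -/

theorem IsExecution.dist_le_sub (hn : 3 ≤ n) (hτ0 : 0 < τ) (hτ : τ ≤ 1 / 2)
    (hp : IsExecution τ n p) (hconn : IsConnectedChain n (fun i => p i 0)) {h y : ℕ} {t : ℝ}
    (ht : 0 ≤ t) (h1 : 1 < h) (hy : y ≤ n) (hhy : h ≤ y) (hF : Forever p 1 h t) :
    dist (p 1 t) (p h t) ≤ h - 1 := by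
  simpa using hp.dist_le_of_inline hn hτ0 hτ hconn ht le_rfl h1.le (hhy.trans hy) (hF t le_rfl)

theorem IsExecution.reserve_nonneg (hn : 3 ≤ n) (hτ0 : 0 < τ) (hτ : τ ≤ 1 / 2)
    (hp : IsExecution τ n p) (hconn : IsConnectedChain n (fun i => p i 0)) {h y : ℕ} {t : ℝ}
    (ht : 0 ≤ t) (h1 : 1 < h) (hhy : h < y) (hy : y < n) (hF : Forever p 1 h t) :
    0 ≤ reserve τ n p h y t := by
  have e1 := hp.dist_le_sub hn hτ0 hτ hconn ht h1 hy.le hhy.le hF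
  have e2 : (y : ℝ) + 1 ≤ n := by exact_mod_cast hy
  have e3 : (h : ℝ) + 1 ≤ y := by exact_mod_cast hhy
  have e4 : 0 ≤ dist (p h t) (p y t) := dist_nonneg
  have e5 : 0 < 2 / (1 - τ) := div_pos two_pos (by linarith)
  unfold reserve
  exact add_nonneg (by linarith) (mul_nonneg e5.le (by linarith))

/-- The new second chain is one vector of length at most one; its deviation and length cost at most
`4`, which the drop of `n - 1 - y` pays. The right side omits the old deviation, which may not be
controlled at the moment of merging. -/
theorem IsExecution.potential_shift (hn : 3 ≤ n) (hτ0 : 0 < τ) (hτ : τ ≤ 1 / 2)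
    (hp : IsExecution τ n p) (hconn : IsConnectedChain n (fun i => p i 0)) {h y : ℕ} {t : ℝ}
    (ht : 0 ≤ t) (h1 : 1 < h) (hhy : h < y) (hy : y < n) (hF : Forever p 1 y t) :
    2 * deviation p y (y + 1) t + reserve τ n p y (y + 1) t ≤ reserve τ n p h y t := by
  have e1 := (hF t le_rfl).dist_add h1.le hhy.le
  have e2 := deviation_le (p := p) y (y + 1) t
  have e3 := hp.dist_le_one hn hτ0 hτ hconn ht (i := y) (by omega) hy
  have e4 : 0 ≤ dist (p h t) (p y t) := dist_nonneg
  have e5 : 0 < 2 / (1 - τ) := div_pos two_pos (by linarith)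
  unfold reserve
  have e6 : (y : ℝ) - 1 - dist (p 1 t) (p y t) + dist (p y t) (p (y + 1) t)
      + (n - 1 - (y + 1 : ℕ)) + (n - 1 - y) ≤ h - 1 - dist (p 1 t) (p h t) + dist (p h t) (p y t)
      + (n - 1 - y) + (n - 1 - h) := by
    push_cast
    linarith
  have e7 := mul_le_mul_of_nonneg_left e6 e5.le
  push_cast at e7 ⊢
  linarith

/-- The absorbed vector has length at most one and raises the deviation and the length by at most
that much; the units reserved for vectors beyond `y` pay for both. -/
theorem IsExecution.potential_extend (hn : 3 ≤ n) (hτ0 : 0 < τ) (hτ : τ ≤ 1 / 2)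
    (hp : IsExecution τ n p) (hconn : IsConnectedChain n (fun i => p i 0)) {h y : ℕ} {t : ℝ}
    (ht : 0 ≤ t) (hhy : h < y) (hy : y < n) (hF : Forever p h (y + 1) t) :
    2 * deviation p h (y + 1) t + reserve τ n p h (y + 1) t ≤
      2 * deviation p h y t + reserve τ n p h y t := by
  have e1 := (hF t le_rfl).dist_add hhy.le (Nat.le_succ y)
  have e3 := hp.dist_le_one hn hτ0 hτ hconn ht (i := y) (by omega) hy
  have e5 : 0 < 2 / (1 - τ) := div_pos two_pos (by linarith)
  have e8 : deviation p h (y + 1) t ≤ deviation p h y t + dist (p y t) (p (y + 1) t) := by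
    unfold deviation
    rw [← e1]
    set e := dir (p 1 t) (p h t)
    have g1 : p (y + 1) t - p h t - (dist (p h t) (p y t) + dist (p y t) (p (y + 1) t)) • e =
        (p y t - p h t - dist (p h t) (p y t) • e) +
          ((p (y + 1) t - p y t) - dist (p y t) (p (y + 1) t) • e) := by
      rw [add_smul]; abel
    have g2 := norm_add_le (p y t - p h t - dist (p h t) (p y t) • e)
      ((p (y + 1) t - p y t) - dist (p y t) (p (y + 1) t) • e)
    have g3 := norm_sub_le (p (y + 1) t - p y t) (dist (p y t) (p (y + 1) t) • e)
    rw [norm_smul, Real.norm_of_nonneg dist_nonneg, ← dist_eq_norm' (p y t)] at g3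
    have g4 := mul_le_mul_of_nonneg_left (norm_dir_le (p 1 t) (p h t))
      (dist_nonneg (x := p y t) (y := p (y + 1) t))
    rw [g1]
    linarith
  unfold reserve
  have e6 : (h : ℝ) - 1 - dist (p 1 t) (p h t) + dist (p h t) (p (y + 1) t)
      + (n - 1 - (y + 1 : ℕ)) + (n - 1 - h) ≤ h - 1 - dist (p 1 t) (p h t) + dist (p h t) (p y t)
      + (n - 1 - y) + (n - 1 - h) := by
    push_cast
    linarith
  have e7 := mul_le_mul_of_nonneg_left e6 e5.le
  push_cast at e7 ⊢
  linarith

theorem IsExecution.lipOn_reserve (hp : IsExecution τ n p) {h y : ℕ} (h1 : 1 < h) (hhy : h < y)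
    (hy : y < n) {a b : ℝ} (ha : 0 ≤ a) : LipOn a b (reserve τ n p h y) := by
  have d0 := (hp.lipOn le_rfl (by omega) ha (b := b)).dist (hp.lipOn h1.le (by omega) ha)
  have d1 := (hp.lipOn h1.le (by omega) ha (b := b)).dist (hp.lipOn (i := y) (by omega) hy.le ha)
  exact ((d1.add (LipOn.const _)).const_mul 2).add
    ((((((LipOn.const _).sub d0).add d1).add (LipOn.const _)).add (LipOn.const _)).const_mul _)

theorem IsExecution.lipOn_deviation (hp : IsExecution τ n p) {h y : ℕ} (h1 : 1 < h) (hhy : h < y)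
    (hy : y < n) {a b : ℝ} (ha : 0 ≤ a) (hne : ∀ t ∈ Icc a b, p 1 t ≠ p h t) :
    LipOn a b (deviation p h y) := by
  have l1 := hp.lipOn le_rfl (by omega) ha (b := b)
  have lh := hp.lipOn (i := h) h1.le (by omega) ha (b := b)
  have ly := hp.lipOn (i := y) (by omega) hy.le ha (b := b)
  exact ((ly.sub lh).sub ((lh.dist ly).smul (l1.dir lh hne))).norm.const_mul _

theorem LipOn.le_of_forall_lt {a b C : ℝ} {f : ℝ → ℝ} (hf : LipOn a b f) (hab : a < b)
    (h : ∀ t, a ≤ t → t < b → f t ≤ C) : f b ≤ C := by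
  have h1 : Tendsto f (𝓝[Ico a b] b) (𝓝 (f b)) :=
    (hf.continuousOn b ⟨hab.le, le_rfl⟩).mono Ico_subset_Icc_self
  have : (𝓝[Ico a b] b).NeBot := by
    rw [nhdsWithin_Ico_eq_nhdsLT hab]
    infer_instance
  exact le_of_tendsto h1 (eventually_nhdsWithin_of_forall fun t ht => h t ht.1 ht.2)

/-- At a time at which the potential might not decrease, both ends are completely stretched. -/
theorem IsExecution.exists_single_of_full (hn : 3 ≤ n) (hτ0 : 0 < τ) (hτ : τ ≤ 1 / 2)
    (hp : IsExecution τ n p) (hconn : IsConnectedChain n (fun i => p i 0)) {h y a : ℕ} {t : ℝ}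
    {v : ℕ → Plane} (ht : 0 ≤ t) (hr : Reg τ n (fun m => p m t) v) (hhy : h < y)
    (hy : y < n) (hF0 : Forever p 1 h t) (hF1 : Forever p h y t) (h1a : 1 < a) (hah : a ≤ h)
    (ha : p a t = p h t) (hL : IsFullLeft (fun m => p m t) a)
    (hR : IsFullRight n (fun m => p m t) y)
    (hC : halfCos p 1 h y t + halfCos p h y (y + 1) t < 1 / 2) :
    ∃ h', 1 < h' ∧ h' < n ∧ Forever p 1 h' (t + n) ∧ Forever p h' n (t + n) := by
  obtain ⟨-, hd0⟩ := inline_of_isFullLeft h1a.le hL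
  obtain ⟨hi2, hd2⟩ := inline_of_isFullRight hy.le hR
  -- The stretched part ends at the first robot `a` of the block, so `a` replaces `h` as the place
  -- of the first bend.
  have hF1' : Forever p a y t := hp.forever_of_reg hτ0 hτ h1a.le (by omega) hy.le ht hr
    (((hF0 t le_rfl).sub h1a.le hah le_rfl).join_of_eq (hF1 t le_rfl) hah hhy.le (Or.inl ha))
  have hF2' : Forever p y n t := hp.forever_of_reg hτ0 hτ (by omega) hy.le le_rfl ht hr hi2
  have hne : p y t ≠ p (y + 1) t := by
    intro he
    have := (hR y le_rfl hy).1
    simp only [he, dist_self] at this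
    exact zero_ne_one this
  have hdir : dir (p y t) (p (y + 1) t) = dir (p y t) (p n t) :=
    hi2.dir_eq le_rfl (Nat.le_succ y) hy hne
  have htn : t ≤ t + n := le_add_of_nonneg_right n.cast_nonneg
  rcases hp.two_bends_straighten hn hτ0 hτ hconn ht h1a (by omega) hy
    (hF0.sub le_rfl h1a.le hah) hF1' hF2' hd0.ge hd2.ge
    (by
      unfold halfCos at hC ⊢
      rwa [ha, ← hdir]) with hf | hf
  · exact ⟨y, by omega, hy, hf, hF2'.mono htn⟩
  · exact ⟨a, h1a, by omega, (hF0.sub le_rfl h1a.le hah).mono htn, hf⟩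

/-- Each merger replaces `(h, y)` by `(y, y + 1)` or `(h, y + 1)` without raising the potential,
which falls at unit rate in between. The final `n` is spent at most once, in the exceptional case,
which ends the recursion. -/
theorem IsExecution.exists_single (hn : 3 ≤ n) (hτ0 : 0 < τ) (hτ : τ ≤ 1 / 2)
    (hp : IsExecution τ n p) (hconn : IsConnectedChain n (fun i => p i 0)) :
    ∀ d h y : ℕ, ∀ t₀ : ℝ, 2 * n - h - y = d → 0 ≤ t₀ → 1 < h → h < y → y < n →
      Forever p 1 h t₀ → Forever p h y t₀ →
      ∃ t, t₀ ≤ t ∧ t ≤ t₀ + (2 * deviation p h y t₀ + reserve τ n p h y t₀) + 1 + n ∧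
        ∃ h', 1 < h' ∧ h' < n ∧ Forever p 1 h' t ∧ Forever p h' n t := by
  intro d
  induction d using Nat.strong_induction_on with
  | _ d ih =>
  intro h y t₀ hd ht₀ h1 hhy hy hF0 hF1
  have hn0 : (0 : ℝ) ≤ n := n.cast_nonneg
  set V : ℝ → ℝ := fun t => 2 * deviation p h y t + reserve τ n p h y t with hV
  have hVle : ∀ t, reserve τ n p h y t ≤ V t := fun t => by
    have := deviation_nonneg (p := p) h y t
    simp only [hV]
    linarith
  have hV0 : ∀ t, t₀ ≤ t → 0 ≤ V t := fun t ht => (hp.reserve_nonneg hn hτ0 hτ hconn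
    (ht₀.trans ht) h1 hhy hy (hF0.mono ht)).trans (hVle t)
  change ∃ t, t₀ ≤ t ∧ t ≤ t₀ + V t₀ + 1 + n ∧ _
  have hVt := hV0 t₀ le_rfl
  -- One unit more than the potential can last, so that it would become negative without a merger.
  set T := t₀ + V t₀ + 1 with hT
  by_cases hsp : ∃ t, t₀ < t ∧ t < T ∧ ∃ h', 1 < h' ∧ h' < n ∧ Forever p 1 h' (t + n) ∧
      Forever p h' n (t + n)
  · obtain ⟨t, ht0, htT, h'⟩ := hsp
    exact ⟨t + n, by linarith, by linarith, h'⟩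
  have hdec : ∀ r, t₀ ≤ r → r ≤ T → ¬ Forever p 1 y r → (∀ t, t₀ ≤ t → t < r →
      ¬ Forever p h (y + 1) t) → V r ≤ V t₀ - (r - t₀) := by
    intro r hr0 hrT hne hne'
    have hnt : ∀ t ∈ Icc t₀ r, p 1 t ≠ p h t := fun t ht =>
      (hp.ne_of_not_forever hn hτ0 hτ hconn (ht₀.trans ht.1) le_rfl h1.le hhy.le hy.le
        (hF0.mono ht.1) (hF1.mono ht.1) fun hf => hne (hf.mono ht.2)).1
    have hlip : LipOn t₀ r V := ((hp.lipOn_deviation h1 hhy hy ht₀ hnt).const_mul 2).add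
      (hp.lipOn_reserve h1 hhy hy ht₀)
    have key := hlip.le_add_mul hr0 (m := -1) ?_
    · linarith
    filter_upwards [hp.ae_reg hn hτ0 hτ hconn] with t ht hmem
    obtain ⟨v, hv, hr⟩ := ht (lt_of_le_of_lt ht₀ hmem.1)
    have ht0 := ht₀.trans hmem.1.le
    rcases hr.hasDerivAt_potential hn hτ0 hτ hv h1 hhy hy (hF0 t hmem.1.le) (hF1 t hmem.1.le)
      (fun hi => hne ((hp.forever_of_reg hτ0 hτ le_rfl (by omega) hy.le ht0 hr hi).mono
        hmem.2.le))
      (fun hi => hne' t hmem.1.le hmem.2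
        (hp.forever_of_reg hτ0 hτ h1.le (by omega) hy ht0 hr hi)) with hder | hspecial
    · exact hder
    · obtain ⟨a, h1a, hah, ha, hL, hR, hC⟩ := hspecial
      exact absurd ⟨t, hmem.1, hmem.2.trans_le hrT, hp.exists_single_of_full hn hτ0 hτ hconn ht0 hr
        hhy hy (hF0.mono hmem.1.le) (hF1.mono hmem.1.le) h1a hah ha hL hR hC⟩ hsp
  by_cases hS : Forever p 1 y T ∨ Forever p h (y + 1) T
  swap
  · exfalso
    push Not at hS
    have h2 := hdec T (by linarith) le_rfl hS.1 fun t _ ht hf => hS.2 (hf.mono ht.le)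
    have h3 := hV0 T (by linarith)
    linarith
  obtain ⟨c, hc0, hcT, hcS, hcn⟩ := first_time (a := t₀) (b := T)
    (S := fun t => Forever p 1 y t ∨ Forever p h (y + 1) t) (fun t ht hall => by
      by_cases hA : ∀ r, t < r → Forever p 1 y r
      · exact Or.inl (hp.forever_of_forall_gt le_rfl (by omega) hy.le (ht₀.trans ht) hA)
      · push Not at hA
        obtain ⟨r₀, hr₀, hA⟩ := hA
        refine Or.inr (hp.forever_of_forall_gt h1.le (by omega) hy (ht₀.trans ht) fun r hr => ?_)
        have := (hall (min r r₀) (lt_min hr hr₀)).resolve_left fun hf =>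
          hA (hf.mono (min_le_right _ _))
        exact this.mono (min_le_left _ _))
    (fun s t hst => Or.imp (fun hf => hf.mono hst) fun hf => hf.mono hst) hS (by linarith)
  by_cases hcA : Forever p 1 y c
  -- When `1, …, y` comes in line the first chain may collapse and the deviation jump. The reserve
  -- stays Lipschitz, so its bound passes to the limit.
  · have hres : reserve τ n p h y c ≤ V t₀ - (c - t₀) := by
      rcases hc0.eq_or_lt with rfl | hlt
      · simpa using hVle t₀
      · have := ((hp.lipOn_reserve h1 hhy hy ht₀).add LipOn.id).le_of_forall_lt (C := V t₀ + t₀)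
          hlt fun t ht htc => by
            have h2 := hdec t ht (htc.le.trans hcT) (fun hf => hcn t ht htc (Or.inl hf))
              fun s hs hst hf => hcn s hs (hst.trans htc) (Or.inr hf)
            have h3 := hVle t
            linarith
        linarith
    by_cases hyn : y + 1 = n
    · refine ⟨c, hc0, by linarith, y, by omega, hy, hcA, ?_⟩
      rw [← hyn]
      exact forever_succ y c
    · obtain ⟨t, ht0, ht1, h'⟩ := ih _ (by omega) y (y + 1) c rfl (ht₀.trans hc0) (by omega)
        (by omega) (by omega) hcA (forever_succ y c)
      have h2 := hp.potential_shift hn hτ0 hτ hconn (ht₀.trans hc0) h1 hhy hy hcA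
      exact ⟨t, by linarith, by linarith, h'⟩
  · have hcB := hcS.resolve_left hcA
    have hVc := hdec c hc0 hcT hcA fun t ht htc hf => hcn t ht htc (Or.inr hf)
    by_cases hyn : y + 1 = n
    · refine ⟨c, hc0, by linarith, h, h1, by omega, hF0.mono hc0, ?_⟩
      rw [← hyn]
      exact hcB
    · obtain ⟨t, ht0, ht1, h'⟩ := ih _ (by omega) h (y + 1) c rfl (ht₀.trans hc0) h1
        (by omega) (by omega) (hF0.mono hc0) hcB
      have h2 := hp.potential_extend hn hτ0 hτ hconn (ht₀.trans hc0) hhy hy hcB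
      simp only [hV] at hVc ⊢
      exact ⟨t, by linarith, by linarith, h'⟩

/-- A chain that starts connected consists of at most two chains in line after time `O(n)`. -/
theorem IsExecution.exists_single_of_connected (hn : 3 ≤ n) (hτ0 : 0 < τ) (hτ : τ ≤ 1 / 2)
    (hp : IsExecution τ n p) (hconn : IsConnectedChain n (fun i => p i 0)) :
    ∃ t, 0 ≤ t ∧ t ≤ 20 * ((n : ℝ) - 3) + 2 * (n - 3) * (1 / (1 - τ)) + (2 * n + 1) * (1 / (1 - τ)) ∧
      ∃ h', 1 < h' ∧ h' < n ∧ Forever p 1 h' t ∧ Forever p h' n t := by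
  have hτ1 : 0 < 1 / (1 - τ) := div_pos one_pos (by linarith)
  -- Three robots have only one inner robot, so there is nothing to merge.
  rcases hn.eq_or_lt with rfl | hn4
  · exact ⟨0, le_rfl, by norm_num; linarith [inv_pos.2 (show 0 < 1 - τ by linarith)], 2, by norm_num,
      by norm_num, forever_succ 1 0, forever_succ 2 0⟩
  have hn' : (4 : ℝ) ≤ n := by exact_mod_cast hn4
  obtain ⟨t, ht0, ht1, h'⟩ := hp.exists_single hn hτ0 hτ hconn _ 2 3 0 rfl le_rfl (by omega)
    (by omega) (by omega) (forever_succ 1 0) (forever_succ 2 0)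
  refine ⟨t, ht0, ht1.trans ?_, h'⟩
  have e1 := deviation_le (p := p) 2 3 0
  have e2 := hp.dist_le_one hn hτ0 hτ hconn le_rfl (i := 2) (by omega) (by omega)
  have e3 : 0 ≤ dist (p 1 0) (p 2 0) := dist_nonneg
  have e4 := mul_le_mul_of_nonneg_left (show ((2 : ℕ) : ℝ) - 1 - dist (p 1 0) (p 2 0)
    + dist (p 2 0) (p 3 0) + (n - 1 - (3 : ℕ)) + (n - 1 - (2 : ℕ)) ≤ 2 * n - 5 by
      push_cast; linarith) (show 0 ≤ 2 / (1 - τ) from (div_pos two_pos (by linarith)).le)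
  unfold reserve
  have e5 : 2 / (1 - τ) = 2 * (1 / (1 - τ)) := by ring
  rw [e5] at e4 ⊢
  push_cast at e4 ⊢
  nlinarith

end MaxMob

end

theorem mainTheorem1 (n : ℕ) (hn : 3 ≤ n) (τ : ℝ) (hτ0 : 0 < τ) (hτ : τ ≤ 1 / 2)
    (p : ℕ → ℝ → Plane) (hp : MaxMob.IsExecution τ n p)
    (hconn : MaxMob.IsConnectedChain n (fun i => p i 0)) :
    ∃ t : ℝ, 0 ≤ t ∧
      t ≤ 2 * ((n : ℝ) - 3) * (1 / (1 - τ) + 1 / √(2 - √2) + 10)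
        + 3 * (n : ℝ) * (1 / τ + 1 / (1 - τ)) ∧
      ((MaxMob.IsMaxChain n (fun i => p i t) ∧
          ∀ t', t ≤ t' → ∀ i, 1 ≤ i → i ≤ n → p i t' = p i t) ∨
        MaxMob.IsCollapsed n (fun i => p i t)) := by
  have hn' : (3 : ℝ) ≤ n := by exact_mod_cast hn
  obtain ⟨t₁, h10, h11, h, h1, hhn, hF0, hF1⟩ :=
    hp.exists_single_of_connected hn hτ0 hτ hconn
  have hF := hp.straighten_single_bend hn hτ0 hτ hconn h10 h1 hhn hF0 hF1
  have hA : 0 < 1 / τ := by positivity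
  have hB : 0 < 1 / (1 - τ) := div_pos one_pos (by linarith)
  have e1 : ((n : ℝ) - 1) / τ = (n - 1) * (1 / τ) := by ring
  have e2 : ((n : ℝ) - 1) / (2 * τ) = (n - 1) / 2 * (1 / τ) := by field_simp
  have e3 : ((n : ℝ) - 1) / (2 * (1 - τ)) = (n - 1) / 2 * (1 / (1 - τ)) := by
    rw [div_mul_div_comm, mul_one]
  -- This summand of the bound is pure slack; the other terms already dominate the times found.
  have hs : 0 ≤ 2 * ((n : ℝ) - 3) * (1 / √(2 - √2)) :=
    mul_nonneg (by linarith) (by positivity)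
  rw [e1, e2, e3] at hF
  set A := 1 / τ
  set B := 1 / (1 - τ)
  have hn1 : (0 : ℝ) ≤ n - 1 := by linarith
  have hpos : 0 ≤ ((n : ℝ) - 1) * A + ((n - 1) / 2 * B + (n - 1) / 2 * A) := by positivity
  obtain ⟨t, ht0, ht1, hres⟩ := hp.finish hn hτ0 hτ hconn (by linarith) hF
  rw [e3] at ht1
  refine ⟨t, by linarith, ?_, hres⟩
  have hnA : 0 ≤ (n : ℝ) * A := by positivity
  nlinarith
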